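/- **Setting.** Let $\mathcal A$ be the free associative unital algebra over $\mathbb C$ on the variables $u_k,v_k$ ($k\ge 0$), and $\mathcal P$ the commutative polynomial algebra on the same variables; write $u=u_0$, $u_x=u_1$, $u_{xx}=u_2$, and similarly for $v$. On both algebras $D$ is the derivation with $D(u_k)=u_{k+1}$, $D(v_k)=v_{k+1}$; write also $(a)_x=D(a)$. A system $u_t=P$, $v_t=Q$ defines the derivation $D_t$ with $D_t(u_k)=D^k(P)$, $D_t(v_k)=D^k(Q)$. In $\mathcal P$, $\rho$ is a conserved density if $D_t(\rho)\in\operatorname{Im}D$; in $\mathcal A$, if $D_t(\rho)\in[\mathcal A,\mathcal A]+\operatorname{Im}D$, where $[\mathcal A,\mathcal A]$ is the linear span of the commutators $[a,b]=ab-ba$. For real $\nu_1,\nu_2$ let $u_k,v_k$ have weights $\nu_1+k$, $\nu_2+k$; the system is homogeneous with weights $(\mu,\nu_1,\nu_2)$ if $P$ and $Q$ are homogeneous of weights $\mu+\nu_1$ and $\mu+\nu_2$. The scalar systems are the following systems over $\mathcal P$: * $S_1$: $u_t=u_{xx}+2u^2v$, $\ v_t=-v_{xx}-2v^2u$; * $S_2$: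 $u_t=u_{xx}+2uu_x+2vu_x+2uv_x$, $\ v_t=-v_{xx}+2vv_x+2vu_x+2uv_x$; * $S_3$: $u_t=u_{xx}+2u_xv+2uv_x$, $\ v_t=-v_{xx}+2vv_x+2u_x$; * $S_4$: $u_t=u_{xx}+2(u+v)u_x$, $\ v_t=-v_{xx}+2(u+v)v_x$; * $S_5(\alpha,\beta)$, with $(\alpha,\beta)\in\mathbb C^2\setminus\{(0,0)\}$: $u_t=u_{xx}+2\alpha u^2v_x+2\beta uvu_x+\alpha(\beta-2\alpha)u^3v^2$, $\ v_t=-v_{xx}+2\alpha v^2u_x+2\beta uvv_x-\alpha(\beta-2\alpha)u^2v^3$; * $B_1$: $u_t=u_{xx}+(u+v)^2$, $\ v_t=-v_{xx}-(u+v)^2$; * $B_2$: $u_t=u_{xx}+2vv_x$, $\ v_t=-v_{xx}+u_x$; * $B_3$: $u_t=u_{xx}+6(u+v)v_x-6(u+v)^3$, $\ v_t=-v_{xx}+6(u+v)u_x+6(u+v)^3$; * $B_4$: $u_t=u_{xx}+2vv_x$, $\ v_t=-v_{xx}+2uu_x$. **Theorem.** Let $u_t=P$, $v_t=Q$ with $P,Q\in\mathcal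 A$ be a non-Abelian analog of one of these scalar systems in the following sense: 1. it is homogeneous with all the weights $(\mu,\nu_1,\nu_2)$ with which the scalar system is homogeneous (if these contain an arbitrary parameter, then for all its values); 2. it turns into the scalar system under the homomorphism $\mathcal A\to\mathcal P$ that makes the variables commute; 3. every homogeneous conserved density of the scalar system is the image under this homomorphism of a conserved density of the non-Abelian system that is homogeneous of the same weight (weights taken as in 1). Call two systems over $\mathcal A$ equivalent if one is obtained from the other by a scaling $u\mapsto\kappa_1u$, $v\mapsto\kappa_2v$ ($\kappa_1,\kappa_2\in\mathbb C\setminus\{0\}$), possibly combined with the $\mathbb C$-linear involution $\star$ given by $u_k^\star=u_k$, $v_k^\star=v_k$, $(ab)^\star=b^\star a^\star$. Then the analog is equivalent to one of the systems listed for the given scalar system: * for $S_1$: $u_t=u_{xx}+2uvu$, $\ v_t=-v_{xx}-2vuv$; * for $S_2$: ($S_2'$) $u_t=u_{xx}+2u_xu+2(vu)_x+2[vu,u]$, $\ v_t=-v_{xx}+2v_xv+2(uv)_x+2[v,uv]$; or ($S_2''$) $u_t=u_{xx}+2uu_x+2(vu)_x+2[u,vu]$, $\ v_t=-v_{xx}+2v_xv+2(vu)_x+2[v,vu]$;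 * for $S_3$: $u_t=u_{xx}+2(vu)_x$, $\ v_t=-v_{xx}+2v_xv+2u_x+2[v,u]$; * for $S_4$: ($S_4'$) $u_t=u_{xx}+2u_x(u+v)$, $\ v_t=-v_{xx}+2(u+v)v_x$; or ($S_4''$) $u_t=u_{xx}+2(u+v)u_x+2[v_x,u]-2u^2v+4uvu-2vu^2$, $\ v_t=-v_{xx}+2v_x(u+v)+2[v,u_x]+2uv^2-4vuv+2v^2u$; * for $S_5(\alpha,\beta)$ one of the following holds: * $\beta=2\alpha$ and the system is ($S_5'(1,2)$) $u_t=u_{xx}+2(uvu)_x$, $\ v_t=-v_{xx}+2(vuv)_x$; or ($S_5''(1,2)$) $u_t=u_{xx}+2u^2v_x+2u_xuv+2u_xvu+2[u^2v^2,u]$, $\ v_t=-v_{xx}+2u_xv^2+2uvv_x+2vuv_x-2[v,u^2v^2]$; * $\alpha=0$ and the system is ($S_5'(0,1)$) $u_t=u_{xx}+2uvu_x$, $\ v_t=-v_{xx}+2v_xuv$; or ($S_5''(0,1)$) $u_t=u_{xx}+2vuu_x+2[v_xu-v[v,u]u,\,u]$, $\ v_t=-v_{xx}+2v_xvu+2[v,\,vu_x+v[v,u]u]$;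 or ($S_5'''(0,1)$) $u_t=u_{xx}+2u_xvu+2[uv,u_x]+2[uv_x,u]-2u(u^2v-2uvu+vu^2)v$, $\ v_t=-v_{xx}+2vuv_x+2[v_x,uv]+2[v,u_xv]+2u(uv^2-2vuv+v^2u)v$; * $\beta=0$ and the system is ($S_5'(1,0)$) $u_t=u_{xx}+2uv_xu-2uvuvu$, $\ v_t=-v_{xx}+2vu_xv+2vuvuv$; or ($S_5''(1,0)$) $u_t=u_{xx}+2u^2v_x-2u^3v^2+2[u_x+u^2v,uv]$, $\ v_t=-v_{xx}+2u_xv^2+2u^2v^3-2[v_x-uv^2,uv]$; * for $B_2$: $u_t=u_{xx}+v_xv+vv_x+\frac{i\sqrt3}{3}[u-v_x,v]$, $\ v_t=-v_{xx}+u_x$; * for $B_3$: ($B_3'$) $u_t=u_{xx}+3(u+v)v_x+3v_x(u+v)-6(u+v)^3+i\sqrt3\,[u+v,v_x]$, $\ v_t=-v_{xx}+3(u+v)u_x+3u_x(u+v)+6(u+v)^3-i\sqrt3\,[u+v,u_x]$; or ($B_3''$) $u_t=u_{xx}+3(u+v)v_x+3v_x(u+v)-6(u^3+3uvu+uv^2+vuv+v^2u+v^3)+i\sqrt3\,([v_x,u-v]+2[u+v,u_x]+6[u^2,v]+6[u,v^2])$,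 $\ v_t=-v_{xx}+3(u+v)u_x+3u_x(u+v)+6(u^3+u^2v+uvu+vu^2+3vuv+v^3)+i\sqrt3\,([u_x,u-v]-2[u+v,v_x]-6[u^2,v]-6[u,v^2])$; * for $B_4$: ($B_4'$) $u_t=u_{xx}+vv_x+v_xv+\frac{i\sqrt3}{3}[v,u^2-v_x]-\frac13(u^2v-2uvu+vu^2)$, $\ v_t=-v_{xx}+uu_x+u_xu+\frac{i\sqrt3}{3}[u,v^2+u_x]+\frac13(uv^2-2vuv+v^2u)$; or ($B_4''$) $u_t=u_{xx}+vv_x+v_xv+u^2v-2uvu+vu^2-\frac{i\sqrt3}{3}(2[u+v,u_x]+[v-2u,v_x]+[u^2,v]+2[u,v^2])$, $\ v_t=-v_{xx}+uu_x+u_xu-uv^2+2vuv-v^2u+\frac{i\sqrt3}{3}([u-2v,u_x]+2[u+v,v_x]+2[u^2,v]+[u,v^2])$. In particular $B_1$ has no such analogs, and neither has $S_5(\alpha,\beta)$ unless $\beta=2\alpha$, $\alpha=0$ or $\beta=0$. -/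

import Mathlib

noncomputable section

namespace NonAbelian

/-! ### Differential polynomials -/

/-- The jet variables: `(0, k)` is the `k`-th `x`-derivative of `u` and `(1, k)` is the `k`-th
`x`-derivative of `v`. -/
abbrev Jet : Type := Fin 2 × ℕ

/-- Commutative (scalar) differential polynomials in `u, v` over `ℂ`. -/
abbrev Comm : Type := MvPolynomial Jet ℂ

/-- Noncommutative differential polynomials: the free associative unital algebra over `ℂ` on the
jet variables. -/
abbrev Free : Type := FreeAlgebra ℂ Jet

/-- The `k`-th derivative of `u` (for `s = 0`) or `v` (for `s = 1`) as a scalar polynomial. -/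
abbrev cvar (s : Fin 2) (k : ℕ) : Comm := MvPolynomial.X (s, k)

/-- The `k`-th derivative of `u` (for `s = 0`) or `v` (for `s = 1`) as a noncommutative
polynomial. -/
abbrev fvar (s : Fin 2) (k : ℕ) : Free := FreeAlgebra.ι ℂ (s, k)

/-- A scalar evolution system `u_t = f 0`, `v_t = f 1`. -/
abbrev CommSystem : Type := Fin 2 → Comm

/-- A non-Abelian evolution system `u_t = F 0`, `v_t = F 1`. -/
abbrev FreeSystem : Type := Fin 2 → Free

/-! ### Derivations of the free algebra -/

/-- The algebra map `a ↦ a + ε δ(a)` into the dual numbers, where `δ` is the derivation of the free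
algebra taking the generator `x` to `g x`. -/
def dualMap (g : Jet → Free) : Free →ₐ[ℂ] TrivSqZeroExt Free Free :=
  FreeAlgebra.lift ℂ fun x => TrivSqZeroExt.inl (FreeAlgebra.ι ℂ x) + TrivSqZeroExt.inr (g x)

theorem dualMap_ι (g : Jet → Free) (x : Jet) : dualMap g (FreeAlgebra.ι ℂ x) =
    TrivSqZeroExt.inl (FreeAlgebra.ι ℂ x) + TrivSqZeroExt.inr (g x) := by
  simp [dualMap]

theorem dualMap_fst (g : Jet → Free) (a : Free) : (dualMap g a).fst = a := by
  induction a using FreeAlgebra.induction with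
  | grade0 r => simp [TrivSqZeroExt.algebraMap_eq_inl']
  | grade1 x => simp [dualMap_ι]
  | mul a b ha hb => simp [ha, hb]
  | add a b ha hb => simp [ha, hb]

/-- The `ℂ`-linear derivation of the free algebra that takes each generator `x` to `g x`
(see `der_ι` and `der_mul`). -/
def der (g : Jet → Free) : Free →ₗ[ℂ] Free where
  toFun a := (dualMap g a).snd
  map_add' a b := by simp
  map_smul' c a := by simp

theorem der_ι (g : Jet → Free) (x : Jet) : der g (FreeAlgebra.ι ℂ x) = g x := by
  simp [der, dualMap_ι]

theorem der_mul (g : Jet → Free) (a b : Free) :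
    der g (a * b) = der g a * b + a * der g b := by
  simp [der, dualMap_fst, add_comm]

/-! ### Total `x`-derivative and evolutionary derivative, conserved densities -/

/-- The total `x`-derivative of scalar differential polynomials. -/
def cD : Derivation ℂ Comm Comm := MvPolynomial.mkDerivation ℂ fun x => cvar x.1 (x.2 + 1)

/-- The total `x`-derivative of noncommutative differential polynomials. -/
def fD : Free →ₗ[ℂ] Free := der fun x => fvar x.1 (x.2 + 1)

/-- The `t`-derivative of scalar differential polynomials in virtue of the system `f`. -/
def cDt (f : CommSystem) : Derivation ℂ Comm Comm :=
  MvPolynomial.mkDerivation ℂ fun x => cD^[x.2] (f x.1)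

/-- The `t`-derivative of noncommutative differential polynomials in virtue of the system `F`: the
derivation commuting with `fD` that takes `u` to `F 0` and `v` to `F 1`. -/
def fDt (F : FreeSystem) : Free →ₗ[ℂ] Free := der fun x => fD^[x.2] (F x.1)

/-- `[A, A] + Im D`. -/
def trivialDensities : Submodule ℂ Free :=
  Submodule.span ℂ {x | ∃ a b : Free, x = ⁅a, b⁆} ⊔ LinearMap.range fD

/-- `ρ` is (a representative of) a conserved density of the scalar system `f`. -/
def IsCommDensity (f : CommSystem) (ρ : Comm) : Prop := ∃ σ : Comm, cDt f ρ = cD σ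

/-- `ρ` is (a representative of) a conserved density of the non-Abelian system `F`. -/
def IsFreeDensity (F : FreeSystem) (ρ : Free) : Prop := fDt F ρ ∈ trivialDensities

/-! ### Homogeneity -/

/-- The weight of a jet variable when `x`-differentiation has weight `1` and `u, v` have weights
`ν 0, ν 1`. -/
def jetWeight (ν : Fin 2 → ℝ) (x : Jet) : ℝ := ν x.1 + x.2

/-- The noncommutative polynomials that are homogeneous of weight `d`: the linear combinations of
words of weight `d`. -/
def freeHomogeneous (ν : Fin 2 → ℝ) (d : ℝ) : Submodule ℂ Free :=
  Submodule.span ℂ {a | ∃ l : List Jet,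
    (l.map (jetWeight ν)).sum = d ∧ a = (l.map (FreeAlgebra.ι ℂ)).prod}

/-- The scalar system is homogeneous with weights `μ, ν 0, ν 1`, that is, it admits the scaling
group `(x, t, u, v) ↦ (τ⁻¹ x, τ^(-μ) t, τ^(ν 0) u, τ^(ν 1) v)`. -/
def IsCommHomogeneous (f : CommSystem) (μ : ℝ) (ν : Fin 2 → ℝ) : Prop :=
  ∀ s, MvPolynomial.IsWeightedHomogeneous (jetWeight ν) (f s) (μ + ν s)

/-- The non-Abelian system is homogeneous with weights `μ, ν 0, ν 1`. -/
def IsFreeHomogeneous (F : FreeSystem) (μ : ℝ) (ν : Fin 2 → ℝ) : Prop :=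
  ∀ s, F s ∈ freeHomogeneous ν (μ + ν s)

/-! ### Non-Abelian analogs -/

/-- Replacing the noncommuting variables by commuting ones. -/
def abelianize : Free →ₐ[ℂ] Comm := FreeAlgebra.lift ℂ MvPolynomial.X

/-- `F` is a non-Abelian analog of the scalar system `f` that inherits its conserved densities. -/
structure IsNonAbelianAnalog (f : CommSystem) (F : FreeSystem) : Prop where
  /-- `F` has the same weights of homogeneity as `f` (all of them, if the weights of `f` depend on
  an arbitrary parameter). -/
  homogeneous : ∀ (μ : ℝ) (ν : Fin 2 → ℝ), IsCommHomogeneous f μ ν → IsFreeHomogeneous F μ ν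
  /-- `F` turns into `f` when the variables commute. -/
  reduces : ∀ s, abelianize (F s) = f s
  /-- Each homogeneous conserved density of `f` is the commutative reduction of a conserved density
  of `F`, homogeneous of the same weight (the weight `d ν` being a function of the parameter, if
  the weights of `f` depend on one). -/
  lifts : ∀ (ρ : Comm) (d : (Fin 2 → ℝ) → ℝ),
    (∀ (μ : ℝ) (ν : Fin 2 → ℝ), IsCommHomogeneous f μ ν →
      MvPolynomial.IsWeightedHomogeneous (jetWeight ν) ρ (d ν)) →
    IsCommDensity f ρ →
    ∃ ρ' : Free,
      (∀ (μ : ℝ) (ν : Fin 2 → ℝ), IsCommHomogeneous f μ ν → ρ' ∈ freeHomogeneous ν (d ν)) ∧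
      IsFreeDensity F ρ' ∧ abelianize ρ' = ρ

/-! ### Equivalence -/

/-- The system satisfied by `κ 0 • u, κ 1 • v` when `u, v` satisfy the system `F`. -/
def rescale (κ : Fin 2 → ℂ) (F : FreeSystem) : FreeSystem := fun s =>
  κ s • FreeAlgebra.lift ℂ (fun x : Jet => (κ x.1)⁻¹ • FreeAlgebra.ι ℂ x) (F s)

/-- The system obtained by the `ℂ`-linear involution that fixes the variables and reverses all
products (this is Mathlib's `star` on the free algebra). -/
def involute (F : FreeSystem) : FreeSystem := fun s => star (F s)

/-- `F` is obtained from `G` by a scaling of `u, v`, possibly preceded by the involution. -/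
def Equivalent (F G : FreeSystem) : Prop :=
  ∃ κ : Fin 2 → ℂ, (∀ s, κ s ≠ 0) ∧ (F = rescale κ G ∨ F = rescale κ (involute G))

/-! ### The scalar systems -/

namespace Scalar

abbrev u : Comm := cvar 0 0
abbrev v : Comm := cvar 1 0
abbrev ux : Comm := cvar 0 1
abbrev vx : Comm := cvar 1 1
abbrev uxx : Comm := cvar 0 2
abbrev vxx : Comm := cvar 1 2

def S1 : CommSystem := ![
  uxx + 2 * u * v * u,
  -vxx - 2 * v * u * v]

def S2 : CommSystem := ![
  uxx + 2 * u * ux + 2 * v * ux + 2 * u * vx,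
  -vxx + 2 * v * vx + 2 * v * ux + 2 * u * vx]

def S3 : CommSystem := ![
  uxx + 2 * ux * v + 2 * u * vx,
  -vxx + 2 * v * vx + 2 * ux]

def S4 : CommSystem := ![
  uxx + 2 * (u + v) * ux,
  -vxx + 2 * (u + v) * vx]

open MvPolynomial (C) in
def S5 (α β : ℂ) : CommSystem := ![
  uxx + 2 * C α * u ^ 2 * vx + 2 * C β * u * v * ux + C (α * (β - 2 * α)) * u ^ 3 * v ^ 2,
  -vxx + 2 * C α * v ^ 2 * ux + 2 * C β * u * v * vx - C (α * (β - 2 * α)) * u ^ 2 * v ^ 3]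

def B1 : CommSystem := ![
  uxx + (u + v) ^ 2,
  -vxx - (u + v) ^ 2]

def B2 : CommSystem := ![
  uxx + 2 * v * vx,
  -vxx + ux]

def B3 : CommSystem := ![
  uxx + 6 * (u + v) * vx - 6 * (u + v) ^ 3,
  -vxx + 6 * (u + v) * ux + 6 * (u + v) ^ 3]

def B4 : CommSystem := ![
  uxx + 2 * v * vx,
  -vxx + 2 * u * ux]

end Scalar

/-! ### The non-Abelian systems -/

abbrev u : Free := fvar 0 0
abbrev v : Free := fvar 1 0
abbrev ux : Free := fvar 0 1
abbrev vx : Free := fvar 1 1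
abbrev uxx : Free := fvar 0 2
abbrev vxx : Free := fvar 1 2

/-- `i √3`. -/
def iSqrt3 : ℂ := Complex.I * (Real.sqrt 3 : ℝ)

def S1' : FreeSystem := ![
  uxx + 2 * u * v * u,
  -vxx - 2 * v * u * v]

def S2' : FreeSystem := ![
  uxx + 2 * ux * u + 2 * fD (v * u) + 2 * ⁅v * u, u⁆,
  -vxx + 2 * vx * v + 2 * fD (u * v) + 2 * ⁅v, u * v⁆]

def S2'' : FreeSystem := ![
  uxx + 2 * u * ux + 2 * fD (v * u) + 2 * ⁅u, v * u⁆,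
  -vxx + 2 * vx * v + 2 * fD (v * u) + 2 * ⁅v, v * u⁆]

def S3' : FreeSystem := ![
  uxx + 2 * fD (v * u),
  -vxx + 2 * vx * v + 2 * ux + 2 * ⁅v, u⁆]

def S4' : FreeSystem := ![
  uxx + 2 * ux * (u + v),
  -vxx + 2 * (u + v) * vx]

def S4'' : FreeSystem := ![
  uxx + 2 * (u + v) * ux + 2 * ⁅vx, u⁆ - 2 * u ^ 2 * v + 4 * u * v * u - 2 * v * u ^ 2,
  -vxx + 2 * vx * (u + v) + 2 * ⁅v, ux⁆ + 2 * u * v ^ 2 - 4 * v * u * v + 2 * v ^ 2 * u]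

/-- First analog of `S5 1 2`. -/
def S5_12' : FreeSystem := ![
  uxx + 2 * fD (u * v * u),
  -vxx + 2 * fD (v * u * v)]

/-- Second analog of `S5 1 2`. -/
def S5_12'' : FreeSystem := ![
  uxx + 2 * u ^ 2 * vx + 2 * ux * u * v + 2 * ux * v * u + 2 * ⁅u ^ 2 * v ^ 2, u⁆,
  -vxx + 2 * ux * v ^ 2 + 2 * u * v * vx + 2 * v * u * vx - 2 * ⁅v, u ^ 2 * v ^ 2⁆]

/-- First analog of `S5 0 1`. -/
def S5_01' : FreeSystem := ![
  uxx + 2 * u * v * ux,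
  -vxx + 2 * vx * u * v]

/-- Second analog of `S5 0 1`. -/
def S5_01'' : FreeSystem := ![
  uxx + 2 * v * u * ux + 2 * ⁅vx * u - v * ⁅v, u⁆ * u, u⁆,
  -vxx + 2 * vx * v * u + 2 * ⁅v, v * ux + v * ⁅v, u⁆ * u⁆]

/-- Third analog of `S5 0 1`. -/
def S5_01''' : FreeSystem := ![
  uxx + 2 * ux * v * u + 2 * ⁅u * v, ux⁆ + 2 * ⁅u * vx, u⁆
    - 2 * u * (u ^ 2 * v - 2 * u * v * u + v * u ^ 2) * v,
  -vxx + 2 * v * u * vx + 2 * ⁅vx, u * v⁆ + 2 * ⁅v, ux * v⁆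
    + 2 * u * (u * v ^ 2 - 2 * v * u * v + v ^ 2 * u) * v]

/-- First analog of `S5 1 0`. -/
def S5_10' : FreeSystem := ![
  uxx + 2 * u * vx * u - 2 * u * v * u * v * u,
  -vxx + 2 * v * ux * v + 2 * v * u * v * u * v]

/-- Second analog of `S5 1 0`. -/
def S5_10'' : FreeSystem := ![
  uxx + 2 * u ^ 2 * vx - 2 * u ^ 3 * v ^ 2 + 2 * ⁅ux + u ^ 2 * v, u * v⁆,
  -vxx + 2 * ux * v ^ 2 + 2 * u ^ 2 * v ^ 3 - 2 * ⁅vx - u * v ^ 2, u * v⁆]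

def B2' : FreeSystem := ![
  uxx + vx * v + v * vx + (iSqrt3 / 3) • ⁅u - vx, v⁆,
  -vxx + ux]

def B3' : FreeSystem := ![
  uxx + 3 * (u + v) * vx + 3 * vx * (u + v) - 6 * (u + v) ^ 3 + iSqrt3 • ⁅u + v, vx⁆,
  -vxx + 3 * (u + v) * ux + 3 * ux * (u + v) + 6 * (u + v) ^ 3 - iSqrt3 • ⁅u + v, ux⁆]

def B3'' : FreeSystem := ![
  uxx + 3 * (u + v) * vx + 3 * vx * (u + v)
    - 6 * (u ^ 3 + 3 * u * v * u + u * v ^ 2 + v * u * v + v ^ 2 * u + v ^ 3)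
    + iSqrt3 • (⁅vx, u - v⁆ + 2 * ⁅u + v, ux⁆ + 6 * ⁅u ^ 2, v⁆ + 6 * ⁅u, v ^ 2⁆),
  -vxx + 3 * (u + v) * ux + 3 * ux * (u + v)
    + 6 * (u ^ 3 + u ^ 2 * v + u * v * u + v * u ^ 2 + 3 * v * u * v + v ^ 3)
    + iSqrt3 • (⁅ux, u - v⁆ - 2 * ⁅u + v, vx⁆ - 6 * ⁅u ^ 2, v⁆ - 6 * ⁅u, v ^ 2⁆)]

def B4' : FreeSystem := ![
  uxx + v * vx + vx * v + (iSqrt3 / 3) • ⁅v, u ^ 2 - vx⁆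
    - (1 / 3 : ℂ) • (u ^ 2 * v - 2 * u * v * u + v * u ^ 2),
  -vxx + u * ux + ux * u + (iSqrt3 / 3) • ⁅u, v ^ 2 + ux⁆
    + (1 / 3 : ℂ) • (u * v ^ 2 - 2 * v * u * v + v ^ 2 * u)]

def B4'' : FreeSystem := ![
  uxx + v * vx + vx * v + u ^ 2 * v - 2 * u * v * u + v * u ^ 2
    - (iSqrt3 / 3) • (2 * ⁅u + v, ux⁆ + ⁅v - 2 * u, vx⁆ + ⁅u ^ 2, v⁆ + 2 * ⁅u, v ^ 2⁆),
  -vxx + u * ux + ux * u - u * v ^ 2 + 2 * v * u * v - v ^ 2 * u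
    + (iSqrt3 / 3) • (⁅u - 2 * v, ux⁆ + 2 * ⁅u + v, vx⁆ + 2 * ⁅u ^ 2, v⁆ + ⁅u, v ^ 2⁆)]

end NonAbelian

end

/-! Conditions 1 and 2 leave finitely many unknown numbers. Homogeneity allows only finitely many
words, and the commutative limit forces each right-hand side to be the sorted lift of the scalar one
plus a combination of differences "word minus its sorting" (`eq_evN_par`). A lifted density has the
same shape, and modulo $[\mathcal A,\mathcal A]+\operatorname{Im}D$ one word from each rotation
class suffices (`exists_tri_par`).

Conservation becomes a set of equations through the noncommutative calculus of variations. Rotating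
each differentiated letter to the front and integrating by parts gives $D_t\rho\equiv
P\,\delta\rho/\delta u+Q\,\delta\rho/\delta v$ modulo trivial densities (`tri_fDt`), and variational
derivatives annihilate trivial densities (`eul_trivial`). So both variational derivatives of
$P\,\delta\rho/\delta u+Q\,\delta\rho/\delta v$ vanish, and each of their coefficients is a
polynomial equation in the unknown coefficients of the system and of the density. Only necessary
conditions are wanted, so a few densities of low weight are enough.

The equations are eliminated by kernel computation. A monomial in the unknowns is a natural number,
with one prime for each unknown; the prime 2 stands for the parameter $\beta$ and the prime 3 for
$i\sqrt3$. An assignment of values is a monoid homomorphism `ℕ →* ℂ`. By `solution_sound`, an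
assignment coming from an actual analog satisfies whatever the elimination outputs, for any list of
steps, so the steps themselves need no justification. `exists_env` produces the assignment from an
analog and its densities.

A few equations remain. They factor, and their roots give the listed systems and the images of these
under the involution; for $B_1$ the remaining equation is $4=0$, and for $B_4$ a scaling by cube
roots of unity is needed as well. For $S_5$ a scaling of $u$ reduces to $\alpha=1$ or
$(\alpha,\beta)=(0,1)$ (`crescale_S5`); when $\alpha=1$, the computation splits into three branches,
each of which ends with $\beta(\beta-2)=0$. -/

noncomputable section

namespace NonAbelian

/-! ### Sparse polynomials evaluated by kernel computation -/

/-- Polynomials with rational coefficients, as lists of terms; a monomial is encoded as a product of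
primes, one for each variable. -/
abbrev Poly : Type := List (ℕ × ℚ)

/-- One step of the merge in `Poly.add`: `ih` adds the remaining terms `p`. -/
def mergeTail (m : ℕ) (c : ℚ) (p : Poly) (ih : Poly → Poly) : Poly → Poly
  | [] => (m, c) :: p
  | (n, d) :: q =>
    if m < n then (m, c) :: ih ((n, d) :: q)
    else if n < m then (n, d) :: mergeTail m c p ih q
    else if c + d = 0 then ih q else (m, c + d) :: ih q

/-- The recursion on the second argument is delegated to `mergeTail`, so both recursions are
structural and reduce well in the kernel. The lists are meant to be sorted by monomial, but `ev_add`
holds without that. -/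
def Poly.add : Poly → Poly → Poly
  | [] => fun q => q
  | (m, c) :: p => mergeTail m c p (Poly.add p)

/-- Multiplication of the codes by a positive `m` keeps their order, so sorted lists stay sorted. -/
def Poly.mulTerm (m : ℕ) (c : ℚ) : Poly → Poly
  | [] => []
  | (n, d) :: q => (m * n, c * d) :: Poly.mulTerm m c q

def Poly.mul : Poly → Poly → Poly
  | [] => fun _ => []
  | (m, c) :: p => fun q => Poly.add (Poly.mulTerm m c q) (Poly.mul p q)

/-- Divides `m` by `p` as often as possible (at most `n` times), multiplying `r` by `q` each time. -/
def pull (p : ℕ) (q : Poly) : ℕ → ℕ → Poly → ℕ × Poly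
  | 0, m, r => (m, r)
  | n + 1, m, r => if m % p = 0 then pull p q n (m / p) (Poly.mul q r) else (m, r)

/-- The substitution of polynomials for variables in a monomial. -/
def substMono : List (ℕ × Poly) → ℕ → Poly → Poly
  | [], m, r => Poly.mulTerm m 1 r
  -- At most eight powers of `p` are replaced. A higher power would merely be left in part; the
  -- value is the same for any bound.
  | (p, q) :: l, m, r => substMono l (pull p q 8 m r).1 (pull p q 8 m r).2

def Poly.subst (l : List (ℕ × Poly)) : Poly → Poly
  | [] => []
  | (m, c) :: p => Poly.add (substMono l m [(1, c)]) (Poly.subst l p)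

/-- The value of a polynomial, with monomials evaluated by `h`. -/
def ev (h : ℕ →* ℂ) : Poly → ℂ
  | [] => 0
  | (m, c) :: p => c * h m + ev h p

/-- The rules `(m, q)` hold: the monomial `m` has the value of `q`. -/
def Valid (h : ℕ →* ℂ) (l : List (ℕ × Poly)) : Prop := ∀ r ∈ l, h r.1 = ev h r.2

section ev

variable (h : ℕ →* ℂ)

@[simp] theorem ev_nil : ev h [] = 0 := rfl

@[simp] theorem ev_cons (m : ℕ) (c : ℚ) (p : Poly) : ev h ((m, c) :: p) = c * h m + ev h p := rfl

theorem ev_mergeTail (m : ℕ) (c : ℚ) (p : Poly) (ih : Poly → Poly)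
    (hih : ∀ q, ev h (ih q) = ev h p + ev h q) (q : Poly) :
    ev h (mergeTail m c p ih q) = c * h m + ev h p + ev h q := by
  induction q with
  | nil => simp [mergeTail]
  | cons t q hq =>
    obtain ⟨n, d⟩ := t
    simp only [mergeTail]
    split_ifs with h1 h2 h3
    · simp [hih]; ring
    · simp [hq]; ring
    · obtain rfl : m = n := by omega
      have : (c : ℂ) + d = 0 := by exact_mod_cast h3
      rw [hih, ev_cons]; linear_combination -(h m) * this
    · obtain rfl : m = n := by omega
      simp [hih]; ring

@[simp] theorem ev_add (p q : Poly) : ev h (p.add q) = ev h p + ev h q := by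
  induction p generalizing q with
  | nil => simp [Poly.add]
  | cons t p ih =>
    obtain ⟨m, c⟩ := t
    simp only [Poly.add]
    rw [ev_mergeTail h m c p _ ih, ev_cons]

@[simp] theorem ev_mulTerm (m : ℕ) (c : ℚ) (p : Poly) :
    ev h (p.mulTerm m c) = c * h m * ev h p := by
  induction p with
  | nil => simp [Poly.mulTerm]
  | cons t p ih => obtain ⟨n, d⟩ := t; simp [Poly.mulTerm, ih]; ring

@[simp] theorem ev_mul (p q : Poly) : ev h (p.mul q) = ev h p * ev h q := by
  induction p with
  | nil => simp [Poly.mul]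
  | cons t p ih => obtain ⟨n, d⟩ := t; simp [Poly.mul, ih]; ring

variable {h}

theorem ev_pull {p : ℕ} {q : Poly} (hp : h p = ev h q) (n m : ℕ) (r : Poly) :
    h (pull p q n m r).1 * ev h (pull p q n m r).2 = h m * ev h r := by
  induction n generalizing m r with
  | zero => rfl
  | succ n ih =>
    simp only [pull]
    split_ifs with h1
    · rw [ih]
      obtain ⟨k, rfl⟩ := Nat.dvd_of_mod_eq_zero h1
      -- A monoid homomorphism need not vanish at `0`. For `p = 0` divisibility forces the monomial
      -- to be `0`, and `h 0` is only known to be idempotent.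
      rcases Nat.eq_zero_or_pos p with rfl | h0
      · have : h 0 = h 0 * h 0 := by rw [← map_mul]
        simp only [zero_mul, Nat.zero_div, ev_mul, ← hp]
        linear_combination -ev h r * this
      · rw [Nat.mul_div_cancel_left _ h0]
        simp [hp]; ring
    · rfl

theorem ev_substMono {l : List (ℕ × Poly)} (hl : Valid h l) (m : ℕ) (r : Poly) :
    ev h (substMono l m r) = h m * ev h r := by
  induction l generalizing m r with
  | nil => simp [substMono]
  | cons t l ih =>
    obtain ⟨p, q⟩ := t
    rw [substMono, ih fun r hr => hl r (List.mem_cons_of_mem _ hr)]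
    exact ev_pull (hl (p, q) (List.mem_cons_self ..)) ..

theorem ev_subst {l : List (ℕ × Poly)} (hl : Valid h l) (p : Poly) :
    ev h (p.subst l) = ev h p := by
  induction p with
  | nil => rfl
  | cons t p ih =>
    obtain ⟨m, c⟩ := t
    simp [Poly.subst, ih, ev_substMono hl]; ring

end ev

/-! ### Words and sparse noncommutative polynomials -/

/-- The jet variables are numbered: `2 k + s` stands for the `k`-th derivative of `u` (`s = 0`) or
`v` (`s = 1`). -/
def letter (n : ℕ) : Jet := (⟨n % 2, Nat.mod_lt _ two_pos⟩, n / 2)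

def letterEquiv : ℕ ≃ Jet where
  toFun := letter
  invFun x := 2 * x.2 + x.1
  left_inv n := by simp [letter]; omega
  right_inv x := by
    obtain ⟨⟨s, hs⟩, k⟩ := x
    simp only [letter, Prod.mk.injEq, Fin.mk.injEq]
    omega

/-- The variable with number `n`. -/
def gen (n : ℕ) : Free := FreeAlgebra.ι ℂ (letter n)

/-- The product of the variables in a list. -/
def W (w : List ℕ) : Free := (w.map gen).prod

@[simp] theorem W_nil : W [] = 1 := rfl

@[simp] theorem W_cons (a : ℕ) (w : List ℕ) : W (a :: w) = gen a * W w := by simp [W]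

@[simp] theorem W_append (v w : List ℕ) : W (v ++ w) = W v * W w := by simp [W]

/-- The basis of words. -/
def wordBasis : Module.Basis (List ℕ) ℂ Free :=
  (FreeAlgebra.basisFreeMonoid ℂ Jet).reindex
    (FreeMonoid.toList.trans letterEquiv.symm.listEquivOfEquiv)

theorem equivMonoidAlgebra_W (w : List ℕ) :
    FreeAlgebra.equivMonoidAlgebraFreeMonoid (R := ℂ) (X := Jet) (W w) =
      MonoidAlgebra.single (FreeMonoid.ofList (w.map letter)) 1 := by
  induction w with
  | nil => rw [W_nil, map_one]; rfl
  | cons a w ih =>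
    rw [W_cons, map_mul, ih]
    simp [gen, FreeAlgebra.equivMonoidAlgebraFreeMonoid, MonoidAlgebra.single_mul_single]

theorem wordBasis_apply (w : List ℕ) : wordBasis w = W w := by
  rw [wordBasis, Module.Basis.reindex_apply, FreeAlgebra.basisFreeMonoid, Module.Basis.map_apply,
    Finsupp.coe_basisSingleOne, LinearEquiv.symm_apply_eq]
  simp only [LinearEquiv.trans_apply, AlgEquiv.toLinearEquiv_apply]
  rw [equivMonoidAlgebra_W]
  rfl

/-- The coefficient of a word. -/
def coef (w : List ℕ) : Free →ₗ[ℂ] ℂ := wordBasis.coord w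

theorem coef_W (w t : List ℕ) : coef w (W t) = if t = w then 1 else 0 := by
  rw [coef, ← wordBasis_apply, Module.Basis.coord_apply, Module.Basis.repr_self,
    Finsupp.single_apply]

theorem word_induction {p : Free → Prop} (hW : ∀ w, p (W w))
    (hadd : ∀ a b, p a → p b → p (a + b)) (hsmul : ∀ (c : ℂ) a, p a → p (c • a)) (a : Free) :
    p a := by
  have h : a ∈ Submodule.span ℂ (Set.range wordBasis) := by
    rw [wordBasis.span_eq]; trivial
  induction h using Submodule.span_induction with
  | mem x hx => obtain ⟨w, rfl⟩ := hx; rw [wordBasis_apply]; exact hW w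
  | zero => simpa using hsmul 0 _ (hW [])
  | add a b _ _ ha hb => exact hadd a b ha hb
  | smul c a _ ha => exact hsmul c a ha

theorem coef_nil_gen_mul (a : ℕ) (x : Free) : coef [] (gen a * x) = 0 := by
  induction x using word_induction with
  | hW w => rw [← W_cons, coef_W, if_neg (by simp)]
  | hadd x y hx hy => rw [mul_add, map_add, hx, hy, add_zero]
  | hsmul c x hx => rw [mul_smul_comm, map_smul, hx, smul_zero]

theorem coef_cons_gen_mul (a b : ℕ) (w : List ℕ) (x : Free) :
    coef (b :: w) (gen a * x) = if a = b then coef w x else 0 := by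
  induction x using word_induction with
  | hW t =>
    rw [← W_cons, coef_W, coef_W]
    simp only [List.cons.injEq, ite_and]
  | hadd x y hx hy => rw [mul_add, map_add, hx, hy]; split_ifs <;> simp
  | hsmul c x hx => rw [mul_smul_comm, map_smul, hx]; split_ifs <;> simp

/-- Noncommutative polynomials with coefficients in `Poly`, as lists of terms. -/
abbrev NC : Type := List (List ℕ × Poly)

def evN (h : ℕ →* ℂ) : NC → Free
  | [] => 0
  | (w, p) :: l => ev h p • W w + evN h l

@[simp] theorem evN_nil (h : ℕ →* ℂ) : evN h [] = 0 := rfl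

@[simp] theorem evN_cons (h : ℕ →* ℂ) (w : List ℕ) (p : Poly) (l : NC) :
    evN h ((w, p) :: l) = ev h p • W w + evN h l := rfl

@[simp] theorem evN_append (h : ℕ →* ℂ) (l l' : NC) : evN h (l ++ l') = evN h l + evN h l' := by
  induction l with
  | nil => simp
  | cons t l ih => obtain ⟨w, p⟩ := t; simp [ih, add_assoc]

/-- Substitution in all coefficients. -/
def substNC (r : List (ℕ × Poly)) : NC → NC
  | [] => []
  | (w, p) :: l => (w, p.subst r) :: substNC r l

theorem evN_substNC {h : ℕ →* ℂ} {r : List (ℕ × Poly)} (hr : Valid h r) (l : NC) :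
    evN h (substNC r l) = evN h l := by
  induction l with
  | nil => rfl
  | cons t l ih => obtain ⟨w, p⟩ := t; simp [substNC, ih, ev_subst hr]

/-! ### Prefix trees for sums and products of noncommutative polynomials -/

/-- Prefix trees without a value at the root; the children of a node form a linked list. -/
inductive Trie : Type
  | nil : Trie
  | node (a : ℕ) (val : Poly) (child sib : Trie) : Trie

namespace Trie

def single : List ℕ → Poly → Trie → Trie
  | [], _, s => s
  | [a], p, s => node a p nil s
  | a :: b :: w, p, s => node a [] (single (b :: w) p nil) s

/-- The tree has no place for the empty word, so inserting it does nothing or inserts zero; this is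
why trees are built only under the test `noConst`. -/
def insert : Trie → List ℕ → Poly → Trie
  | nil, w, p => single w p nil
  | node a v c s, [], _ => node a v c s
  | node a v c s, b :: w, p =>
    if a = b then match w with
      | [] => node a (v.add p) c s
      | d :: w => node a v (c.insert (d :: w) p) s
    else node a v c (s.insert (b :: w) p)

/-- The coefficient of a nonempty word. -/
def lookup : Trie → List ℕ → Poly
  | nil, _ => []
  | node _ _ _ _, [] => []
  | node a v c s, b :: w =>
    if a = b then (match w with
      | [] => v
      | d :: w => c.lookup (d :: w)).add (s.lookup (b :: w))
    else s.lookup (b :: w)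

/-- The coefficient of a word in the product of two noncommutative polynomials. -/
def conv (g : Trie) : Trie → List ℕ → Poly
  | nil, _ => []
  | node _ _ _ _, [] => []
  | node a v c s, b :: w =>
    if a = b then ((v.mul (g.lookup w)).add (conv g c w)).add (conv g s (b :: w))
    else conv g s (b :: w)

def isZero : Trie → Bool
  | nil => true
  | node _ v c s => v.isEmpty && c.isZero && s.isZero

def eval (h : ℕ →* ℂ) : Trie → Free
  | nil => 0
  | node a v c s => gen a * (ev h v • 1 + c.eval h) + s.eval h

variable (h : ℕ →* ℂ)

theorem eval_single {w : List ℕ} (hw : w ≠ []) (p : Poly) (s : Trie) :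
    (single w p s).eval h = ev h p • W w + s.eval h := by
  induction w, p, s using single.induct with
  | case1 => simp at hw
  | case2 => simp [single, eval]
  | case3 p s a b w ih => simp [single, eval] at ih ⊢; simp [ih]

theorem eval_insert (t : Trie) {w : List ℕ} (hw : w ≠ []) (p : Poly) :
    (t.insert w p).eval h = ev h p • W w + t.eval h := by
  induction t generalizing w with
  | nil => simp [insert, eval_single h hw, eval]
  | node a v c s ihc ihs =>
    match w with
    | [] => simp at hw
    | b :: w =>
      simp only [insert]
      split_ifs with hab
      · subst hab
        match w with
        | [] => simp [eval, add_smul, mul_add]; abel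
        | d :: w => simp only [eval]; rw [ihc (by simp)]; simp [mul_add]; abel
      · simp only [eval]; rw [ihs (by simp)]; abel

theorem coef_nil_eval (t : Trie) : coef [] (t.eval h) = 0 := by
  induction t with
  | nil => simp [eval]
  | node a v c s _ ihs => simp [eval, coef_nil_gen_mul, ihs]

theorem coef_one_cons (a : ℕ) (w : List ℕ) : coef (a :: w) 1 = 0 := by
  rw [← W_nil, coef_W, if_neg (by simp)]

theorem coef_one_nil : coef [] 1 = 1 := by
  rw [← W_nil, coef_W, if_pos rfl]

/-- No invariant on the tree is needed: siblings may carry equal letters, because `lookup` adds up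
all their contributions. -/
theorem ev_lookup (t : Trie) (w : List ℕ) : ev h (t.lookup w) = coef w (t.eval h) := by
  induction t generalizing w with
  | nil => simp [lookup, eval]
  | node a v c s ihc ihs =>
    match w with
    | [] => simp [lookup, coef_nil_eval]
    | b :: w =>
      simp only [lookup, eval, map_add, coef_cons_gen_mul, ← ihs]
      split_ifs with hab
      · match w with
        | [] => simp [coef_one_nil, coef_nil_eval]
        | d :: w => simp [coef_one_cons, ihc]
      · simp

/-- The factorisations of `w` into a word of `t` and a word of `g` are found by walking down `t`
along `w`: at every node on the way the remaining suffix is looked up in `g`. -/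
theorem ev_conv (g t : Trie) (w : List ℕ) :
    ev h (conv g t w) = coef w (t.eval h * g.eval h) := by
  induction t generalizing w with
  | nil => simp [conv, eval]
  | node a v c s ihc ihs =>
    match w with
    | [] => simp [conv, eval, add_mul, mul_assoc, coef_nil_gen_mul, ← ihs]; cases s <;> simp [conv]
    | b :: w =>
      simp only [conv, eval, add_mul, mul_assoc, map_add, coef_cons_gen_mul, ← ihs]
      split_ifs with hab
      · simp [ihc, ev_lookup]
      · simp

theorem eval_of_isZero (t : Trie) (ht : t.isZero = true) : t.eval h = 0 := by
  induction t with
  | nil => rfl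
  | node a v c s ihc ihs =>
    simp only [isZero, Bool.and_eq_true, List.isEmpty_iff] at ht
    simp [eval, ht.1.1, ihc ht.1.2, ihs ht.2]

end Trie

/-- Adds a noncommutative polynomial without constant term to a prefix tree. -/
def mkTrie : NC → Trie → Trie
  | [], t => t
  | (w, p) :: l, t => mkTrie l (t.insert w p)

/-- No constant term. -/
def noConst (l : NC) : Bool := l.all fun t => !t.1.isEmpty

theorem eval_mkTrie (h : ℕ →* ℂ) {l : NC} (hl : noConst l = true) (t : Trie) :
    (mkTrie l t).eval h = evN h l + t.eval h := by
  induction l generalizing t with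
  | nil => simp [mkTrie]
  | cons x l ih =>
    obtain ⟨w, p⟩ := x
    simp only [noConst, List.all_cons, Bool.and_eq_true] at hl
    rw [mkTrie, ih hl.2, Trie.eval_insert h t (by simpa using hl.1), evN_cons]; abel

/-- A test for a noncommutative polynomial to vanish. -/
def isZeroNC (l : NC) : Bool := noConst l && (mkTrie l .nil).isZero

theorem evN_of_isZeroNC (h : ℕ →* ℂ) {l : NC} (hl : isZeroNC l = true) : evN h l = 0 := by
  simp only [isZeroNC, Bool.and_eq_true] at hl
  have := eval_mkTrie h hl.1 .nil
  rw [Trie.eval_of_isZero h _ hl.2] at this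
  simpa [Trie.eval] using this.symm

/-! ### Derivatives of words -/

/-- The words obtained from a word by differentiating one of its letters. -/
def raise : List ℕ → List (List ℕ)
  | [] => []
  | a :: w => ((a + 2) :: w) :: (raise w).map (a :: ·)

/-- The words that yield the given word when one of their letters is differentiated. -/
def lower : List ℕ → List (List ℕ)
  | [] => []
  | a :: w => (if 2 ≤ a then [(a - 2) :: w] else []) ++ (lower w).map (a :: ·)

def raiseIter : ℕ → List (List ℕ) → List (List ℕ)
  | 0, l => l
  | n + 1, l => raiseIter n (l.flatMap raise)

/-- The rotations of a word. -/
def rots (w : List ℕ) : List (List ℕ) := (List.range w.length).map fun i => w.drop i ++ w.take i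

theorem der_one (g : Jet → Free) : der g 1 = 0 := by
  have := der_mul g 1 1
  simpa using this

theorem fD_mul (a b : Free) : fD (a * b) = fD a * b + a * fD b := der_mul ..

theorem fD_gen (a : ℕ) : fD (gen a) = gen (a + 2) := by
  rw [gen, fD, der_ι, gen]
  simp [letter, Nat.add_div_right]

theorem gen_mul_sum (a : ℕ) (l : List (List ℕ)) :
    ((l.map (a :: ·)).map W).sum = gen a * (l.map W).sum := by
  induction l with
  | nil => simp
  | cons w l ih => rw [List.map_cons, List.map_cons, List.sum_cons, ih, W_cons, List.map_cons,
      List.sum_cons, mul_add]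

theorem fD_W (w : List ℕ) : fD (W w) = ((raise w).map W).sum := by
  induction w with
  | nil => simp [raise, fD, der_one]
  | cons a w ih =>
    rw [W_cons, fD_mul, fD_gen, ih, raise, List.map_cons, List.sum_cons, gen_mul_sum, W_cons]

theorem fD_sum (l : List (List ℕ)) : fD (l.map W).sum = ((l.flatMap raise).map W).sum := by
  induction l with
  | nil => simp
  | cons w l ih => simp [ih, fD_W]

theorem fD_pow_sum (n : ℕ) (l : List (List ℕ)) :
    (fD ^ n) (l.map W).sum = ((raiseIter n l).map W).sum := by
  induction n generalizing l with
  | zero => simp [raiseIter]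
  | succ n ih => rw [pow_succ, Module.End.mul_apply, fD_sum, ih, raiseIter]

theorem coef_nil_fD (a : Free) : coef [] (fD a) = 0 := by
  induction a using word_induction with
  | hW w =>
    cases w with
    | nil => simp [fD, der_one]
    | cons a w => rw [W_cons, fD_mul, fD_gen, map_add, coef_nil_gen_mul, coef_nil_gen_mul, add_zero]
  | hadd x y hx hy => rw [map_add, map_add, hx, hy, add_zero]
  | hsmul c x hx => rw [map_smul, map_smul, hx, smul_zero]

theorem sum_coef_cons (b a : ℕ) (l : List (List ℕ)) (x : Free) :
    ((l.map (b :: ·)).map fun z => coef z (gen a * x)).sum =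
      if a = b then (l.map fun z => coef z x).sum else 0 := by
  induction l with
  | nil => simp
  | cons w l ih =>
    simp only [List.map_cons, List.sum_cons, ih, coef_cons_gen_mul]
    split_ifs <;> simp

/-- On the basis of words, `lower` is the transpose of `raise`. Coefficients of a derivative can
thus be read off without computing the derivative. -/
theorem coef_fD_W (t w : List ℕ) :
    coef t (fD (W w)) = ((lower t).map fun z => coef z (W w)).sum := by
  induction w generalizing t with
  | nil =>
    rw [W_nil, fD, der_one, map_zero]
    -- The right side has no contribution from the empty word, since `lower` never produces it.
    symm
    apply List.sum_eq_zero
    intro c hc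
    obtain ⟨z, hz, rfl⟩ := List.mem_map.1 hc
    cases z with
    | nil =>
      cases t with
      | nil => simp [lower] at hz
      | cons b t =>
        simp only [lower, List.mem_append, List.mem_map] at hz
        rcases hz with hz | ⟨_, _, hz⟩
        · split_ifs at hz <;> simp at hz
        · simp at hz
    | cons b z => exact Trie.coef_one_cons ..
  | cons a w ih =>
    cases t with
    | nil => rw [coef_nil_fD]; simp [lower]
    | cons b t =>
      rw [W_cons, fD_mul, fD_gen, map_add, coef_cons_gen_mul, coef_cons_gen_mul, ih, lower,
        List.map_append, List.sum_append, sum_coef_cons]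
      congr 1
      by_cases hb : 2 ≤ b
      · simp only [if_pos hb, List.map_singleton, List.sum_singleton, coef_cons_gen_mul]
        exact if_congr (by omega) rfl rfl
      · rw [if_neg hb, if_neg (by omega)]; simp

theorem coef_fD (t : List ℕ) (x : Free) :
    coef t (fD x) = ((lower t).map fun z => coef z x).sum := by
  induction x using word_induction with
  | hW w => exact coef_fD_W t w
  | hadd x y hx hy => simp only [map_add, hx, hy, List.sum_map_add]
  | hsmul c x hx => simp only [map_smul, hx, smul_eq_mul, List.sum_map_mul_left]

/-! ### Sums over rotations -/

section cyclic

variable {M : Type*} [AddCommGroup M]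

theorem sum_rots (g : List ℕ → M) (w : List ℕ) :
    ((rots w).map g).sum = ∑ i ∈ Finset.range w.length, g (w.rotate i) := by
  rw [rots, List.map_map]
  have : ∑ i ∈ Finset.range w.length, g (w.rotate i) =
      ((List.range w.length).map fun i => g (w.rotate i)).sum := rfl
  rw [this]
  congr 1
  apply List.map_congr_left
  intro i hi
  rw [List.mem_range] at hi
  simp [List.rotate_eq_drop_append_take hi.le]

theorem sum_rots_append_singleton (g : List ℕ → M) (a : ℕ) (w : List ℕ) :
    ((rots (w ++ [a])).map g).sum = ((rots (a :: w)).map g).sum := by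
  rw [sum_rots, sum_rots, List.length_append, List.length_singleton, List.length_cons,
    Finset.sum_range_succ, Finset.sum_range_succ']
  congr 1
  · apply Finset.sum_congr rfl
    intro i _
    rw [List.rotate_cons_succ]
  · rw [List.rotate_zero]
    congr 1
    rw [List.rotate_append_length_eq]; rfl

theorem sum_rots_append (g : List ℕ → M) (v w : List ℕ) :
    ((rots (v ++ w)).map g).sum = ((rots (w ++ v)).map g).sum := by
  induction v generalizing w with
  | nil => simp
  | cons a v ih =>
    rw [List.cons_append, ← sum_rots_append_singleton, List.append_assoc, ih, List.append_assoc,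
      List.singleton_append]

variable [Module ℂ M]

/-- The linear map that takes each word to the sum of the values of `g` at its rotations. -/
def cyc (g : List ℕ → M) : Free →ₗ[ℂ] M := wordBasis.constr ℂ fun w => ((rots w).map g).sum

theorem cyc_W (g : List ℕ → M) (w : List ℕ) : cyc g (W w) = ((rots w).map g).sum := by
  rw [cyc, ← wordBasis_apply, Module.Basis.constr_basis]

/-- A sum over all rotations is a trace, because `v ++ w` and `w ++ v` have the same rotations. -/
theorem cyc_mul_comm (g : List ℕ → M) (a b : Free) : cyc g (a * b) = cyc g (b * a) := by
  induction a using word_induction with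
  | hadd x y hx hy => simp only [add_mul, mul_add, map_add, hx, hy]
  | hsmul c x hx => simp only [smul_mul_assoc, mul_smul_comm, map_smul, hx]
  | hW v =>
    induction b using word_induction with
    | hadd x y hx hy => simp only [add_mul, mul_add, map_add, hx, hy]
    | hsmul c x hx => simp only [smul_mul_assoc, mul_smul_comm, map_smul, hx]
    | hW w => rw [← W_append, ← W_append, cyc_W, cyc_W, sum_rots_append]

theorem cyc_sum (g : List ℕ → M) (l : List (List ℕ)) :
    cyc g (l.map W).sum = (l.map fun w => ((rots w).map g).sum).sum := by
  induction l with
  | nil => simp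
  | cons w l ih => simp [ih, cyc_W]

theorem length_of_mem_raise {w z : List ℕ} (h : z ∈ raise w) : z.length = w.length := by
  induction w generalizing z with
  | nil => simp [raise] at h
  | cons a w ih =>
    simp only [raise, List.mem_cons, List.mem_map] at h
    rcases h with rfl | ⟨y, hy, rfl⟩
    · simp
    · simp [ih hy]

theorem raise_append (v w : List ℕ) :
    raise (v ++ w) = (raise v).map (· ++ w) ++ (raise w).map (v ++ ·) := by
  induction v with
  | nil => simp [raise]
  | cons a v ih => simp [raise, ih, Function.comp_def]

/-- Differentiation commutes with rotation: raising a letter and then rotating by `i` yields the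
same words as rotating by `i` and then raising. So each `i` contributes the sum of `g` over `raise`
of one rotated word, which is zero by `hg`. -/
theorem cyc_fD (g : List ℕ → M) (hg : ∀ z, ((raise z).map g).sum = 0) (x : Free) :
    cyc g (fD x) = 0 := by
  induction x using word_induction with
  | hadd x y hx hy => rw [map_add, map_add, hx, hy, add_zero]
  | hsmul c x hx => rw [map_smul, map_smul, hx, smul_zero]
  | hW w =>
    rw [fD_W, cyc_sum]
    have h1 : ((raise w).map fun z => ((rots z).map g).sum) =
        (raise w).map fun z => ∑ i ∈ Finset.range w.length, g (z.drop i ++ z.take i) := by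
      apply List.map_congr_left
      intro z hz
      rw [sum_rots, length_of_mem_raise hz]
      apply Finset.sum_congr rfl
      intro i hi
      rw [List.rotate_eq_drop_append_take]
      rw [length_of_mem_raise hz]
      exact (Finset.mem_range.1 hi).le
    have h2 : ∀ l : List (List ℕ), (l.map fun z => ∑ i ∈ Finset.range w.length,
        g (z.drop i ++ z.take i)).sum =
        ∑ i ∈ Finset.range w.length, (l.map fun z => g (z.drop i ++ z.take i)).sum := by
      intro l
      induction l with
      | nil => simp
      | cons z l ih => simp [ih, Finset.sum_add_distrib]
    rw [h1, h2]
    apply Finset.sum_eq_zero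
    intro i hi
    -- The raised letter lies either among the first `i` letters or after them; the two groups of
    -- terms are matched in the opposite order.
    rw [← hg (w.drop i ++ w.take i), raise_append]
    have hi' : (w.take i).length = i := List.length_take_of_le (Finset.mem_range.1 hi).le
    conv_lhs => rw [← List.take_append_drop i w, raise_append]
    simp only [List.map_append, List.map_map, List.sum_append, Function.comp_def]
    rw [add_comm]
    congr 2
    · apply List.map_congr_left
      intro z _
      congr 1
      rw [List.drop_append_of_le_length hi'.ge, List.take_append_of_le_length hi'.ge,
        List.drop_of_length_le hi'.le, List.take_of_length_le hi'.le, List.nil_append]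
    · apply List.map_congr_left
      intro z hz
      have := (length_of_mem_raise hz).trans hi'
      congr 1
      rw [List.drop_append_of_le_length this.ge, List.take_append_of_le_length this.ge,
        List.drop_of_length_le this.le, List.take_of_length_le this.le, List.nil_append]

end cyclic

/-! ### The noncommutative Euler operator -/

/-- The contribution of the leading letter to the variational derivative: the letter $u_k$ or $v_k$
is removed and $(-D)^k$ is applied to the rest. Summing over rotations brings every letter to the
front once. -/
def eulTerm (s : ℕ) : List ℕ → Free
  | [] => 0
  | a :: t => if a % 2 = s then (-1 : ℂ) ^ (a / 2) • (fD ^ (a / 2)) (W t) else 0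

/-- The noncommutative variational derivative with respect to `u` (`s = 0`) or `v` (`s = 1`). -/
def eul (s : ℕ) : Free →ₗ[ℂ] Free := cyc (eulTerm s)

/-- The terms cancel in pairs. If $D$ hits the leading letter of order $k$, the rest $t$ receives
$(-D)^{k+1}$; if $D$ hits the rest, it receives $(-D)^kD$. -/
theorem eul_fD (s : ℕ) (x : Free) : eul s (fD x) = 0 := by
  apply cyc_fD
  intro z
  cases z with
  | nil => rfl
  | cons a t =>
    have h : ∀ l : List (List ℕ), ((l.map (a :: ·)).map (eulTerm s)).sum =
        if a % 2 = s then (-1 : ℂ) ^ (a / 2) • (fD ^ (a / 2)) (l.map W).sum else 0 := by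
      intro l
      induction l with
      | nil => simp
      | cons w l ih => simp only [List.map_cons, List.sum_cons, ih, eulTerm]; split_ifs <;> simp
    rw [raise, List.map_cons, List.sum_cons, h, ← fD_W, eulTerm, Nat.add_mod_right,
      Nat.add_div_right _ two_pos]
    split_ifs
    · rw [pow_succ, pow_succ, Module.End.mul_apply]; simp
    · simp

/-- Commutators vanish by the trace property and total derivatives by `eul_fD`. The converse
inclusion is never needed, since only necessary conditions are extracted. -/
theorem eul_trivial (s : ℕ) {x : Free} (hx : x ∈ trivialDensities) : eul s x = 0 := by
  have : trivialDensities ≤ LinearMap.ker (eul s) := by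
    refine sup_le (Submodule.span_le.2 ?_) ?_
    · rintro _ ⟨a, b, rfl⟩
      simp only [SetLike.mem_coe, LinearMap.mem_ker]
      rw [Ring.lie_def, map_sub, eul, cyc_mul_comm, sub_self]
    · rintro _ ⟨a, rfl⟩
      exact eul_fD s a
  exact this hx

/-! ### Calculus modulo commutators and total derivatives -/

/-- Congruence modulo `trivialDensities`. -/
def Tri (a b : Free) : Prop := a - b ∈ trivialDensities

theorem Tri.refl (a : Free) : Tri a a := by simp [Tri]

theorem Tri.trans {a b c : Free} (h : Tri a b) (h' : Tri b c) : Tri a c := by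
  have := add_mem h h'
  rwa [sub_add_sub_cancel] at this

theorem Tri.add {a b c d : Free} (h : Tri a b) (h' : Tri c d) : Tri (a + c) (b + d) := by
  have := add_mem h h'
  rwa [sub_add_sub_comm] at this

theorem Tri.smul (c : ℂ) {a b : Free} (h : Tri a b) : Tri (c • a) (c • b) := by
  have := Submodule.smul_mem _ c h
  rwa [smul_sub] at this

theorem Tri.mem_iff {a b : Free} (h : Tri a b) : a ∈ trivialDensities ↔ b ∈ trivialDensities := by
  constructor <;> intro h'
  · simpa using sub_mem h' h
  · simpa using add_mem h' h

theorem tri_mul_comm (a b : Free) : Tri (a * b) (b * a) :=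
  Submodule.mem_sup_left (Submodule.subset_span ⟨a, b, (Ring.lie_def a b).symm⟩)

theorem tri_fD (a : Free) : Tri (fD a) 0 := by
  rw [Tri, sub_zero]
  exact Submodule.mem_sup_right ⟨a, rfl⟩

/-- Repeated integration by parts. -/
theorem tri_fD_pow_mul (n : ℕ) (a b : Free) :
    Tri ((fD ^ n) a * b) ((-1 : ℂ) ^ n • (a * (fD ^ n) b)) := by
  induction n generalizing b with
  | zero => simpa using Tri.refl _
  | succ n ih =>
    have h1 : Tri (fD ((fD ^ n) a) * b) (-((fD ^ n) a * fD b)) := by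
      have := tri_fD ((fD ^ n) a * b)
      rwa [fD_mul, Tri, sub_zero, ← sub_neg_eq_add] at this
    have h2 := (ih (fD b)).smul (-1)
    rw [neg_one_smul] at h2
    have h3 := h1.trans h2
    rw [smul_smul, ← pow_succ'] at h3
    have e1 : (fD ^ (n + 1)) a = fD ((fD ^ n) a) := by rw [pow_succ']; rfl
    have e2 : (fD ^ (n + 1)) b = (fD ^ n) (fD b) := by rw [pow_succ]; rfl
    rwa [e1, e2]

/-! ### The time derivative of a density through its variational derivatives -/

section fDt

variable (F : FreeSystem)

theorem fDt_gen (a : ℕ) : fDt F (gen a) = (fD ^ (a / 2)) (F (letter a).1) := by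
  rw [fDt, gen, der_ι, Module.End.pow_apply]; rfl

theorem fDt_mul (a b : Free) : fDt F (a * b) = fDt F a * b + a * fDt F b := der_mul ..

/-- Both composites satisfy the same Leibniz rule, so it is enough that they agree on the jet
variables, where it is the definition of the flow. -/
theorem fDt_fD (a : Free) : fDt F (fD a) = fD (fDt F a) := by
  induction a using word_induction with
  | hadd x y hx hy => simp only [map_add, hx, hy]
  | hsmul c x hx => simp only [map_smul, hx]
  | hW w =>
    induction w with
    | nil => simp [fD, fDt, der_one]
    | cons a w ih =>
      rw [W_cons, fD_mul, fDt_mul, map_add, fDt_mul, fDt_mul, map_add, fD_mul, fD_mul, ih, fD_gen,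
        fDt_gen, fDt_gen, Nat.add_div_right _ two_pos, pow_succ',
        Module.End.mul_apply]
      have : letter (a + 2) = ((letter a).1, (letter a).2 + 1) := by simp [letter]
      rw [this]
      abel

theorem fDt_trivial {x : Free} (hx : x ∈ trivialDensities) : fDt F x ∈ trivialDensities := by
  have : trivialDensities ≤ trivialDensities.comap (fDt F) := by
    refine sup_le (Submodule.span_le.2 ?_) ?_
    · rintro _ ⟨a, b, rfl⟩
      simp only [SetLike.mem_coe, Submodule.mem_comap]
      have h := (tri_mul_comm (fDt F a) b).add (tri_mul_comm a (fDt F b))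
      rw [Ring.lie_def, map_sub, fDt_mul, fDt_mul]
      rwa [Tri, add_comm (b * _)] at h
    · rintro _ ⟨a, rfl⟩
      rw [Submodule.mem_comap, fDt_fD]
      exact Submodule.mem_sup_right ⟨_, rfl⟩
  exact this hx

/-- Being conserved depends only on the class modulo trivial densities, which makes it legitimate to
replace a lifted density by a normal form. -/
theorem IsFreeDensity.of_tri {F : FreeSystem} {a b : Free} (h : Tri a b) (ha : IsFreeDensity F a) :
    IsFreeDensity F b := by
  have := sub_mem ha (fDt_trivial F h)
  rwa [← map_sub, sub_sub_cancel] at this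

def flowTerm : List ℕ → Free
  | [] => 0
  | a :: t => (fD ^ (a / 2)) (F (letter a).1) * W t

/-- This is the Leibniz rule with the differentiated letter rotated to the front. The right factor
`v` serves the induction: a letter split off from `w` is carried round to the end of `v`. -/
theorem tri_fDt_W_mul (w v : List ℕ) : Tri (fDt F (W w) * W v)
    (∑ i ∈ Finset.range w.length, flowTerm F ((w ++ v).rotate i)) := by
  induction w generalizing v with
  | nil => simpa [fDt, der_one] using Tri.refl 0
  | cons a w ih =>
    rw [W_cons, fDt_mul, add_mul, List.length_cons, Finset.sum_range_succ', add_comm]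
    apply Tri.add
    · rw [mul_assoc]
      refine (tri_mul_comm _ _).trans ?_
      have := ih (v ++ [a])
      rw [W_append, W_cons, W_nil, mul_one, ← mul_assoc] at this
      convert this using 3 with i
      rw [List.cons_append, List.rotate_cons_succ, List.append_assoc]
    · rw [fDt_gen, List.rotate_zero, List.cons_append, flowTerm, W_append, mul_assoc]
      exact Tri.refl _

theorem tri_flowTerm (z : List ℕ) :
    Tri (flowTerm F z) (F 0 * eulTerm 0 z + F 1 * eulTerm 1 z) := by
  cases z with
  | nil => simpa [flowTerm, eulTerm] using Tri.refl 0
  | cons a t =>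
    have h := tri_fD_pow_mul (a / 2) (F (letter a).1) (W t)
    rcases Nat.mod_two_eq_zero_or_one a with ha | ha
    · have h0 : (letter a).1 = 0 := by simp [letter, ha]
      rw [h0] at h
      simpa [flowTerm, eulTerm, ha, h0] using h
    · have h0 : (letter a).1 = 1 := by simp [letter, ha]
      rw [h0] at h
      simpa [flowTerm, eulTerm, ha, h0] using h

theorem tri_sum {ι : Type*} (s : Finset ι) (f g : ι → Free) (h : ∀ i ∈ s, Tri (f i) (g i)) :
    Tri (∑ i ∈ s, f i) (∑ i ∈ s, g i) := by
  rw [Tri, ← Finset.sum_sub_distrib]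
  exact sum_mem h

/-- Each rotation of a word contributes $D^k(F_s)\,t$, where the leading letter has order $k$ and
$t$ is the rest; integration by parts moves $D^k$ onto $t$ and leaves `eulTerm`. This identity turns
conservation into equations for coefficients. -/
theorem tri_fDt (a : Free) : Tri (fDt F a) (F 0 * eul 0 a + F 1 * eul 1 a) := by
  induction a using word_induction with
  | hadd x y hx hy =>
    have := hx.add hy
    simp only [map_add, mul_add]
    rwa [add_add_add_comm] at this
  | hsmul c x hx =>
    have := hx.smul c
    simpa only [map_smul, mul_smul_comm, smul_add] using this
  | hW w =>
    have h := tri_fDt_W_mul F w []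
    rw [W_nil, mul_one] at h
    refine h.trans ?_
    rw [eul, eul, cyc_W, cyc_W, sum_rots, sum_rots, Finset.mul_sum, Finset.mul_sum,
      ← Finset.sum_add_distrib, List.append_nil]
    exact tri_sum _ _ _ fun i _ => tri_flowTerm F _

/-- The conditions on `F` and the variational derivatives of a conserved density. -/
theorem IsFreeDensity.eul_eq_zero {F : FreeSystem} {a : Free} (h : IsFreeDensity F a) (s : ℕ) :
    eul s (F 0 * eul 0 a + F 1 * eul 1 a) = 0 :=
  eul_trivial s ((tri_fDt F a).mem_iff.1 h)

end fDt

/-! ### Computation of the equations for the coefficients -/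

def eulWord (s : ℕ) (p : Poly) : List ℕ → NC
  | [] => []
  | a :: t =>
    if a % 2 = s then
      (raiseIter (a / 2) [t]).map fun y => (y, if (a / 2) % 2 = 0 then p else p.mulTerm 1 (-1))
    else []

/-- The noncommutative variational derivative. -/
def eulNC (s : ℕ) : NC → NC
  | [] => []
  | (w, p) :: l => (rots w).flatMap (eulWord s p) ++ eulNC s l

/-- This is the transpose of `eulTerm`. At stage `k` the list holds the `k`-fold lowerings of the
target word, the sign is $(-1)^k$, and `a` is the letter of order `k` that is put back in front. The
first argument is fuel. -/
def testAux : ℕ → ℚ → ℕ → List (List ℕ) → List (ℚ × List ℕ)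
  | 0, _, _, _ => []
  | n + 1, e, a, l => l.map (fun y => (e, a :: y)) ++ testAux n (-e) (a + 2) (l.flatMap lower)

/-- The words whose coefficients add up to the coefficient of `t` in the variational derivative. -/
def test (s : ℕ) (t : List ℕ) : List (ℚ × List ℕ) :=
  -- Each lowering takes 2 off the sum of the letters, so this fuel exhausts all lowerings.
  (testAux (t.sum + 1) 1 s [t]).flatMap fun x => (rots x.2).map fun y => (x.1, y)

/-- Only those coefficients of $f_0g_0+f_1g_1$ are computed that the target word asks for; the
products are never expanded. -/
def eqnAux (g₀ g₁ f₀ f₁ : Trie) : List (ℚ × List ℕ) → Poly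
  | [] => []
  | (e, z) :: l =>
    (((g₀.conv f₀ z).add (g₁.conv f₁ z)).mulTerm 1 e).add (eqnAux g₀ g₁ f₀ f₁ l)

theorem evN_map_const (h : ℕ →* ℂ) (p : Poly) (l : List (List ℕ)) :
    evN h (l.map fun y => (y, p)) = ev h p • (l.map W).sum := by
  induction l with
  | nil => simp
  | cons w l ih => simp [ih]

theorem evN_eulWord (h : ℕ →* ℂ) (s : ℕ) (p : Poly) (z : List ℕ) :
    evN h (eulWord s p z) = ev h p • eulTerm s z := by
  cases z with
  | nil => simp [eulWord, eulTerm]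
  | cons a t =>
    simp only [eulWord, eulTerm]
    split_ifs with h1 h2
    · rw [evN_map_const, ← fD_pow_sum, (Nat.even_iff.2 h2).neg_one_pow]; simp
    · rw [evN_map_const, ← fD_pow_sum, (Nat.odd_iff.2 (Nat.mod_two_ne_zero.1 h2)).neg_one_pow]
      simp
    · simp

theorem evN_flatMap_eulWord (h : ℕ →* ℂ) (s : ℕ) (p : Poly) (l : List (List ℕ)) :
    evN h (l.flatMap (eulWord s p)) = ev h p • (l.map (eulTerm s)).sum := by
  induction l with
  | nil => simp
  | cons w l ih => simp [ih, evN_eulWord]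

theorem evN_eulNC (h : ℕ →* ℂ) (s : ℕ) (l : NC) : evN h (eulNC s l) = eul s (evN h l) := by
  induction l with
  | nil => simp [eulNC]
  | cons x l ih =>
    obtain ⟨w, p⟩ := x
    rw [eulNC, evN_append, ih, evN_cons, map_add, map_smul, evN_flatMap_eulWord, eul, cyc_W]

theorem sum_of_mem_lower {t z : List ℕ} (h : z ∈ lower t) : z.sum + 2 = t.sum := by
  induction t generalizing z with
  | nil => simp [lower] at h
  | cons b t ih =>
    simp only [lower, List.mem_append, List.mem_map] at h
    rcases h with h | ⟨y, hy, rfl⟩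
    · split_ifs at h with hb
      · rw [List.mem_singleton] at h
        subst h
        simp only [List.sum_cons]; omega
      · simp at h
    · rw [List.sum_cons, List.sum_cons, add_assoc, ih hy]

theorem sum_coef_flatMap_lower (l : List (List ℕ)) (x : Free) :
    ((l.flatMap lower).map fun z => coef z x).sum = (l.map fun z => coef z (fD x)).sum := by
  induction l with
  | nil => simp
  | cons w l ih => simp [ih, coef_fD]

/-- Among the stages only the one whose front letter equals `a` contributes. The bound on the letter
sums guarantees that the fuel lasts until that stage or that no words are left. -/
theorem sum_coef_testAux (n : ℕ) (e : ℚ) (a b : ℕ) (l : List (List ℕ))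
    (hl : ∀ z ∈ l, z.sum < n) (x : Free) :
    ((testAux n e b l).map fun y => (y.1 : ℂ) * coef y.2 (gen a * x)).sum =
      if b ≤ a ∧ a % 2 = b % 2 then
        e * (-1) ^ ((a - b) / 2) * (l.map fun z => coef z ((fD ^ ((a - b) / 2)) x)).sum
      else 0 := by
  induction n generalizing e b l with
  | zero =>
    cases l with
    | nil => simp [testAux]
    | cons w l => exact absurd (hl w (List.mem_cons_self ..)) (Nat.not_lt_zero _)
  | succ n ih =>
    have hl' : ∀ z ∈ l.flatMap lower, z.sum < n := by
      intro z hz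
      obtain ⟨y, hy, hz⟩ := List.mem_flatMap.1 hz
      have := sum_of_mem_lower hz
      have := hl y hy
      omega
    have h1 : ((l.map fun y => (e, b :: y)).map fun y => (y.1 : ℂ) * coef y.2 (gen a * x)).sum =
        if a = b then e * (l.map fun z => coef z x).sum else 0 := by
      rw [List.map_map]
      have := sum_coef_cons b a l x
      rw [List.map_map] at this
      simp only [Function.comp_def] at this ⊢
      rw [List.sum_map_mul_left, this]
      split_ifs <;> simp
    rw [testAux, List.map_append, List.sum_append, h1, ih _ _ _ hl', sum_coef_flatMap_lower]
    rcases lt_trichotomy a b with hab | rfl | hab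
    · rw [if_neg (by omega), if_neg (by omega), if_neg (by omega), add_zero]
    · simp
    · rw [if_neg (by omega), zero_add]
      refine if_ctx_congr (by omega) (fun h2 => ?_) fun _ => rfl
      have h3 : (a - b) / 2 = (a - (b + 2)) / 2 + 1 := by omega
      rw [h3, pow_succ (-1 : ℂ), pow_succ' fD]
      simp only [Module.End.mul_apply]
      push_cast
      ring

theorem coef_eulTerm {s : ℕ} (hs : s < 2) (t z : List ℕ) : coef t (eulTerm s z) =
    ((testAux (t.sum + 1) 1 s [t]).map fun y => (y.1 : ℂ) * coef y.2 (W z)).sum := by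
  cases z with
  | nil =>
    rw [eulTerm, map_zero]
    symm
    apply List.sum_eq_zero
    intro c hc
    obtain ⟨y, hy, rfl⟩ := List.mem_map.1 hc
    have : ∀ (n : ℕ) (e : ℚ) (b : ℕ) (l : List (List ℕ)), ∀ y ∈ testAux n e b l, y.2 ≠ [] := by
      intro n
      induction n with
      | zero => simp [testAux]
      | succ n ih =>
        intro e b l y hy
        rw [testAux, List.mem_append] at hy
        rcases hy with hy | hy
        · obtain ⟨z, _, rfl⟩ := List.mem_map.1 hy
          simp
        · exact ih _ _ _ _ hy
    have := this _ _ _ _ y hy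
    rw [coef_W, if_neg this.symm, mul_zero]
  | cons a z =>
    rw [W_cons, sum_coef_testAux _ _ _ _ _ (by simp), eulTerm]
    by_cases h : a % 2 = s
    · rw [if_pos h, if_pos (by omega), show (a - s) / 2 = a / 2 by omega]; simp
    · rw [if_neg h, if_neg (by omega), map_zero]

/-- Rotations by `i` and by `n - i` are mutually inverse, so the two counts agree. The index `0` is
its own partner and is split off before the reflection of the range. -/
theorem rotate_eq_iff (w z : List ℕ) :
    (∑ i ∈ Finset.range z.length, if w = z.rotate i then (1 : ℂ) else 0) =
      ∑ i ∈ Finset.range w.length, if w.rotate i = z then (1 : ℂ) else 0 := by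
  by_cases hwz : w.length = z.length
  · rw [hwz]
    have key : ∀ n, ∀ w z : List ℕ, w.length = n → z.length = n → ∀ i ≤ n,
        (w = z.rotate (n - i) ↔ w.rotate i = z) := by
      intro n w z hw hz i hi
      constructor
      · rintro rfl
        rw [List.rotate_rotate, Nat.sub_add_cancel hi, ← hz, List.rotate_length]
      · rintro rfl
        rw [List.rotate_rotate, Nat.add_sub_cancel' hi, ← hw, List.rotate_length]
    rcases Nat.eq_zero_or_pos z.length with h0 | h0
    · rw [h0]; simp
    obtain ⟨n, hn⟩ := Nat.exists_eq_succ_of_ne_zero h0.ne'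
    rw [hn, Finset.sum_range_succ', Finset.sum_range_succ']
    congr 1
    · rw [← Finset.sum_range_reflect]
      apply Finset.sum_congr rfl
      intro i hi
      rw [Finset.mem_range] at hi
      refine if_congr ?_ rfl rfl
      rw [← key (n + 1) w z (hwz.trans hn) hn (i + 1) (by omega)]
      rw [show n - 1 - i + 1 = n + 1 - (i + 1) by omega]
    · simp
  · rw [Finset.sum_eq_zero, Finset.sum_eq_zero]
    · intro i _
      rw [if_neg]
      rintro rfl
      simp at hwz
    · intro i _
      rw [if_neg]
      rintro rfl
      simp at hwz

/-- The transpose of the variational derivative: a single coefficient of `eul s x` is a short signed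
sum of coefficients of `x`. -/
theorem coef_eul {s : ℕ} (hs : s < 2) (t : List ℕ) (x : Free) :
    coef t (eul s x) = ((test s t).map fun y => (y.1 : ℂ) * coef y.2 x).sum := by
  induction x using word_induction with
  | hadd x y hx hy => simp only [map_add, hx, hy, mul_add, List.sum_map_add]
  | hsmul c x hx =>
    simp only [map_smul, hx, smul_eq_mul, mul_left_comm _ c, List.sum_map_mul_left]
  | hW w =>
    rw [eul, cyc_W, sum_rots, map_sum]
    simp only [coef_eulTerm hs, test]
    generalize testAux _ _ _ _ = l
    induction l with
    | nil => simp
    | cons y l ih =>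
      simp only [List.map_cons, List.sum_cons, List.flatMap_cons, List.map_append, List.sum_append,
        Finset.sum_add_distrib, ih, List.map_map, Function.comp_def, List.sum_map_mul_left]
      rw [← Finset.mul_sum, sum_rots]
      simp only [coef_W]
      rw [rotate_eq_iff]

theorem ev_eqnAux (h : ℕ →* ℂ) (g₀ g₁ f₀ f₁ : Trie) (l : List (ℚ × List ℕ)) :
    ev h (eqnAux g₀ g₁ f₀ f₁ l) = (l.map fun y => (y.1 : ℂ) *
      coef y.2 (f₀.eval h * g₀.eval h + f₁.eval h * g₁.eval h)).sum := by
  induction l with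
  | nil => simp [eqnAux]
  | cons y l ih => obtain ⟨e, z⟩ := y; simp [eqnAux, ih, Trie.ev_conv]

/-! ### Elimination -/

/-- A sum with variable coefficients of differences of a word and its commutative
reduction is added to `b`. -/
def par (b : NC) (l : List (ℕ × List ℕ)) : NC :=
  b ++ l.flatMap fun x => [(x.2, [(x.1, 1)]), (x.2.insertionSort (· ≤ ·), [(x.1, -1)])]

def Trie.toNC : Trie → NC
  | nil => []
  | node a v c s =>
    (if v.isEmpty then [] else [([a], v)]) ++ c.toNC.map (fun x => (a :: x.1, x.2)) ++ s.toNC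

/-- Collects equal words. -/
def normNC (l : NC) : NC := if noConst l then (mkTrie l .nil).toNC else l

theorem evN_map_cons (h : ℕ →* ℂ) (a : ℕ) (l : NC) :
    evN h (l.map fun x => (a :: x.1, x.2)) = gen a * evN h l := by
  induction l with
  | nil => simp
  | cons x l ih => obtain ⟨w, p⟩ := x; simp [ih, mul_add]

theorem Trie.evN_toNC (h : ℕ →* ℂ) (t : Trie) : evN h t.toNC = t.eval h := by
  induction t with
  | nil => rfl
  | node a v c s ihc ihs =>
    rw [toNC, evN_append, evN_append, evN_map_cons, ihc, ihs, eval]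
    split_ifs with hv
    · rw [List.isEmpty_iff] at hv; simp [hv]
    · simp [mul_add]

theorem evN_normNC (h : ℕ →* ℂ) (l : NC) : evN h (normNC l) = evN h l := by
  rw [normNC]
  split_ifs with hl
  · rw [Trie.evN_toNC, eval_mkTrie h hl]; simp [Trie.eval]
  · rfl

/-- An elimination step: a linear combination of equations, given by pairs `(s, t)` as in
`IsFreeDensity.eul_eq_zero`, and the variable to be eliminated by means of it. If the latter is `0`,
the combination is recorded. -/
abbrev Step : Type := List (ℚ × ℕ × List ℕ) × ℕ

def combine (eq : ℕ → List ℕ → Poly) : List (ℚ × ℕ × List ℕ) → Poly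
  | [] => []
  | (c, s, t) :: l => ((eq s t).mulTerm 1 c).add (combine eq l)

def coefOf (m : ℕ) : Poly → ℚ
  | [] => 0
  | (n, c) :: p => if n = m then c + coefOf m p else coefOf m p

def dropMono (m : ℕ) : Poly → Poly
  | [] => []
  | (n, c) :: p => if n = m then dropMono m p else (n, c) :: dropMono m p

/-- Solves the equation `p = 0` for the monomial `m`. -/
def solveFor (m : ℕ) (p : Poly) : List (ℕ × Poly) :=
  -- A vanishing pivot gives no rule, so an unsuitable step is harmless.
  if coefOf m p = 0 then [] else [(m, (dropMono m p).mulTerm 1 (-(coefOf m p)⁻¹))]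

def substRules (r : List (ℕ × Poly)) : List (ℕ × Poly) → List (ℕ × Poly)
  | [] => []
  | (m, p) :: l => (m, p.subst r) :: substRules r l

/-- The new rule comes from an equation already reduced by the old ones, and it is substituted into
them in turn. The rules thus stay mutually reduced and a single pass of `subst` is enough. -/
def addRules (r σ : List (ℕ × Poly)) : List (ℕ × Poly) := r ++ substRules r σ

def runSteps (eq : ℕ → List ℕ → Poly) :
    List Step → List (ℕ × Poly) × List Poly → List (ℕ × Poly) × List Poly
  | [], x => x
  | (c, 0) :: l, x => runSteps eq l (x.1, (combine eq c).subst x.1 :: x.2)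
  | (c, m + 1) :: l, x =>
    runSteps eq l (addRules (solveFor (m + 1) ((combine eq c).subst x.1)) x.1, x.2)

def eqn (g₀ g₁ f₀ f₁ : Trie) (s : ℕ) (t : List ℕ) : Poly :=
  if s < 2 then eqnAux g₀ g₁ f₀ f₁ (test s t) else []

/-- Elimination by means of the equations that a density gives. -/
def runBlock (f₀ f₁ ρ : NC) (l : List Step) (x : List (ℕ × Poly) × List Poly) :
    List (ℕ × Poly) × List Poly :=
  -- Trees lose constant terms. If there were any, the block would be skipped, which is sound.
  if noConst f₀ && noConst f₁ && noConst (eulNC 0 ρ) && noConst (eulNC 1 ρ) then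
    runSteps (eqn (mkTrie (eulNC 0 ρ) .nil) (mkTrie (eulNC 1 ρ) .nil) (mkTrie f₀ .nil)
      (mkTrie f₁ .nil)) l x
  else x

/-- Elimination by means of the equations that several densities give. -/
def run (f₀ f₁ : NC) : List (NC × List Step) → List (ℕ × Poly) × List Poly →
    List (ℕ × Poly) × List Poly
  | [], x => x
  | (ρ, l) :: b, x =>
    run f₀ f₁ b (runBlock (substNC x.1 f₀) (substNC x.1 f₁) (normNC (substNC x.1 ρ)) l x)

/-! ### Soundness of the elimination -/

section sound

variable {h : ℕ →* ℂ}

theorem ev_combine {eq : ℕ → List ℕ → Poly} (heq : ∀ s t, ev h (eq s t) = 0)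
    (l : List (ℚ × ℕ × List ℕ)) : ev h (combine eq l) = 0 := by
  induction l with
  | nil => rfl
  | cons x l ih => obtain ⟨c, s, t⟩ := x; simp [combine, ih, heq]

theorem ev_dropMono (m : ℕ) (p : Poly) : ev h p = coefOf m p * h m + ev h (dropMono m p) := by
  induction p with
  | nil => simp [coefOf, dropMono]
  | cons x p ih =>
    obtain ⟨n, c⟩ := x
    simp only [coefOf, dropMono, ev_cons, ih]
    split_ifs with hnm
    · subst hnm; push_cast; ring
    · rw [ev_cons]; ring

theorem valid_solveFor {m : ℕ} {p : Poly} (hp : ev h p = 0) : Valid h (solveFor m p) := by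
  rw [solveFor]
  split_ifs with hc
  · intro r hr; simp at hr
  · intro r hr
    rw [List.mem_singleton] at hr
    subst hr
    have hc' : (coefOf m p : ℂ) ≠ 0 := by exact_mod_cast hc
    rw [ev_dropMono m] at hp
    simp only [ev_mulTerm, map_one, mul_one]
    push_cast
    field_simp
    linear_combination hp

theorem valid_substRules {r σ : List (ℕ × Poly)} (hr : Valid h r) (hσ : Valid h σ) :
    Valid h (substRules r σ) := by
  induction σ with
  | nil => exact hσ
  | cons x σ ih =>
    obtain ⟨m, p⟩ := x
    intro y hy
    rw [substRules, List.mem_cons] at hy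
    rcases hy with rfl | hy
    · rw [ev_subst hr]; exact hσ (m, p) (List.mem_cons_self ..)
    · exact ih (fun z hz => hσ z (List.mem_cons_of_mem _ hz)) y hy

theorem valid_append {r σ : List (ℕ × Poly)} (hr : Valid h r) (hσ : Valid h σ) :
    Valid h (r ++ σ) := by
  intro y hy
  rcases List.mem_append.1 hy with hy | hy
  · exact hr y hy
  · exact hσ y hy

/-- The list of steps is arbitrary: a badly chosen step may lose information but can never produce a
false rule. The long lists of steps in the data are therefore mere guidance. -/
theorem runSteps_sound {eq : ℕ → List ℕ → Poly} (heq : ∀ s t, ev h (eq s t) = 0)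
    (l : List Step) (x : List (ℕ × Poly) × List Poly) (hx : Valid h x.1)
    (hx' : ∀ p ∈ x.2, ev h p = 0) :
    Valid h (runSteps eq l x).1 ∧ ∀ p ∈ (runSteps eq l x).2, ev h p = 0 := by
  induction l generalizing x with
  | nil => exact ⟨hx, hx'⟩
  | cons y l ih =>
    obtain ⟨c, _ | m⟩ := y
    · refine ih (x.1, (combine eq c).subst x.1 :: x.2) hx ?_
      intro p hp
      rcases List.mem_cons.1 hp with rfl | hp
      · rw [ev_subst hx, ev_combine heq]
      · exact hx' p hp
    · refine ih _ ?_ hx'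
      have hr : Valid h (solveFor (m + 1) ((combine eq c).subst x.1)) :=
        valid_solveFor (by rw [ev_subst hx, ev_combine heq])
      exact valid_append hr (valid_substRules hr hx)

/-- The computed polynomial is the coefficient of the word `t` in an element that vanishes by
`IsFreeDensity.eul_eq_zero`. -/
theorem ev_eqn_of_isFreeDensity {f₀ f₁ ρ : NC} {F : FreeSystem} (hF0 : F 0 = evN h f₀)
    (hF1 : F 1 = evN h f₁) (hρ : IsFreeDensity F (evN h ρ)) (h0 : noConst f₀ = true)
    (h1 : noConst f₁ = true) (h2 : noConst (eulNC 0 ρ) = true) (h3 : noConst (eulNC 1 ρ) = true)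
    (s : ℕ) (t : List ℕ) :
    ev h (eqn (mkTrie (eulNC 0 ρ) .nil) (mkTrie (eulNC 1 ρ) .nil) (mkTrie f₀ .nil)
      (mkTrie f₁ .nil) s t) = 0 := by
  rw [eqn]
  split_ifs with hs
  · rw [ev_eqnAux, eval_mkTrie h h0, eval_mkTrie h h1, eval_mkTrie h h2, eval_mkTrie h h3,
      evN_eulNC, evN_eulNC, ← hF0, ← hF1, ← coef_eul hs]
    simp only [Trie.eval, add_zero]
    rw [hρ.eul_eq_zero, map_zero]
  · rfl

theorem runBlock_sound {f₀ f₁ ρ : NC} {F : FreeSystem} (hF0 : F 0 = evN h f₀)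
    (hF1 : F 1 = evN h f₁) (hρ : IsFreeDensity F (evN h ρ)) (l : List Step)
    (x : List (ℕ × Poly) × List Poly) (hx : Valid h x.1) (hx' : ∀ p ∈ x.2, ev h p = 0) :
    Valid h (runBlock f₀ f₁ ρ l x).1 ∧ ∀ p ∈ (runBlock f₀ f₁ ρ l x).2, ev h p = 0 := by
  rw [runBlock]
  split_ifs with hc
  · simp only [Bool.and_eq_true] at hc
    exact runSteps_sound
      (ev_eqn_of_isFreeDensity hF0 hF1 hρ hc.1.1.1 hc.1.1.2 hc.1.2 hc.2) l x hx hx'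
  · exact ⟨hx, hx'⟩

theorem run_sound {f₀ f₁ : NC} {F : FreeSystem} (hF0 : F 0 = evN h f₀) (hF1 : F 1 = evN h f₁)
    (b : List (NC × List Step)) (hb : ∀ y ∈ b, IsFreeDensity F (evN h y.1))
    (x : List (ℕ × Poly) × List Poly) (hx : Valid h x.1) (hx' : ∀ p ∈ x.2, ev h p = 0) :
    Valid h (run f₀ f₁ b x).1 ∧ ∀ p ∈ (run f₀ f₁ b x).2, ev h p = 0 := by
  induction b generalizing x with
  | nil => exact ⟨hx, hx'⟩
  | cons y b ih =>
    obtain ⟨ρ, l⟩ := y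
    have hy : IsFreeDensity F (evN h (normNC (substNC x.1 ρ))) := by
      rw [evN_normNC, evN_substNC hx]; exact hb (ρ, l) (List.mem_cons_self ..)
    have := runBlock_sound (by rw [evN_substNC hx, hF0]) (by rw [evN_substNC hx, hF1]) hy l x hx hx'
    exact ih (fun z hz => hb z (List.mem_cons_of_mem _ hz)) _ this.1 this.2

end sound

/-- The coefficients after elimination, and the equations that remain. -/
def solution (f₀ f₁ : NC) (b : List (NC × List Step)) (σ : List (ℕ × Poly)) :
    NC × NC × List Poly :=
  let r := run f₀ f₁ b (σ, [])
  (normNC (substNC r.1 f₀), normNC (substNC r.1 f₁), r.2)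

theorem solution_sound {h : ℕ →* ℂ} {f₀ f₁ : NC} {F : FreeSystem} (hF0 : F 0 = evN h f₀)
    (hF1 : F 1 = evN h f₁) {b : List (NC × List Step)}
    (hb : ∀ y ∈ b, IsFreeDensity F (evN h y.1)) {σ : List (ℕ × Poly)} (hσ : Valid h σ)
    {x : NC × NC × List Poly} (hx : solution f₀ f₁ b σ = x) :
    F 0 = evN h x.1 ∧ F 1 = evN h x.2.1 ∧ ∀ p ∈ x.2.2, ev h p = 0 := by
  subst hx
  have := run_sound hF0 hF1 b hb (σ, []) hσ (by simp)
  exact ⟨by rw [solution, evN_normNC, evN_substNC this.1, hF0],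
    by rw [solution, evN_normNC, evN_substNC this.1, hF1], this.2⟩

/-! ### Operations on sparse noncommutative polynomials -/

def negNC (l : NC) : NC := l.map fun x => (x.1, x.2.mulTerm 1 (-1))

def mulNC : NC → NC → NC
  | [], _ => []
  | (w, p) :: l, k => k.map (fun x => (w ++ x.1, p.mul x.2)) ++ mulNC l k

def derNC (l : NC) : NC := l.flatMap fun x => (raise x.1).map fun y => (y, x.2)

def sortNC (l : NC) : NC := l.map fun x => (x.1.insertionSort (· ≤ ·), x.2)

section

variable (h : ℕ →* ℂ)

@[simp] theorem evN_negNC (l : NC) : evN h (negNC l) = -evN h l := by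
  rw [negNC]
  induction l with
  | nil => simp
  | cons x l ih => obtain ⟨w, p⟩ := x; simp [ih, add_comm]

@[simp] theorem evN_mulNC (l k : NC) : evN h (mulNC l k) = evN h l * evN h k := by
  induction l with
  | nil => simp [mulNC]
  | cons x l ih =>
    obtain ⟨w, p⟩ := x
    have : ∀ k : NC, evN h (k.map fun x => (w ++ x.1, p.mul x.2)) = (ev h p • W w) * evN h k := by
      intro k
      induction k with
      | nil => simp
      | cons y k ih => obtain ⟨z, q⟩ := y; simp [ih, mul_add, smul_smul, mul_comm]
    simp [mulNC, ih, this, add_mul]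

@[simp] theorem evN_derNC (l : NC) : evN h (derNC l) = fD (evN h l) := by
  rw [derNC]
  induction l with
  | nil => simp
  | cons x l ih =>
    obtain ⟨w, p⟩ := x
    rw [List.flatMap_cons, evN_append, ih, evN_map_const, ← fD_W]; simp

end

/-! ### Commutative reduction -/

theorem abelianize_gen (a : ℕ) : abelianize (gen a) = MvPolynomial.X (letter a) := by
  simp [abelianize, gen]

theorem abelianize_W (w : List ℕ) :
    abelianize (W w) = (w.map fun a => (MvPolynomial.X (letter a) : Comm)).prod := by
  induction w with
  | nil => simp
  | cons a w ih => simp [ih, abelianize_gen]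

theorem abelianize_W_perm {v w : List ℕ} (h : v.Perm w) : abelianize (W v) = abelianize (W w) := by
  rw [abelianize_W, abelianize_W]
  exact (h.map _).prod_eq

theorem abelianize_sortNC (h : ℕ →* ℂ) (l : NC) :
    abelianize (evN h (sortNC l)) = abelianize (evN h l) := by
  rw [sortNC]
  induction l with
  | nil => simp
  | cons x l ih =>
    obtain ⟨w, p⟩ := x
    simp [ih, abelianize_W_perm (List.perm_insertionSort (· ≤ ·) w)]

theorem abelianize_eq_of_isZeroNC {h : ℕ →* ℂ} {l : NC} (hl : isZeroNC (sortNC l) = true) :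
    abelianize (evN h l) = 0 := by
  rw [← abelianize_sortNC, evN_of_isZeroNC h hl, map_zero]

/-! ### Sorted words as a linear section of the commutative reduction -/

/-- The sorted word of a commutative monomial. -/
def sortedWord (m : Jet →₀ ℕ) : List ℕ :=
  ((Finsupp.toMultiset m).map letterEquiv.symm).sort (· ≤ ·)

/-- The linear map that takes each commutative monomial to its sorted word. -/
def sec : Comm →ₗ[ℂ] Free :=
  (MvPolynomial.basisMonomials Jet ℂ).constr ℂ fun m => W (sortedWord m)

theorem sec_monomial (m : Jet →₀ ℕ) (c : ℂ) :
    sec (MvPolynomial.monomial m c) = c • W (sortedWord m) := by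
  have : MvPolynomial.monomial m c = c • MvPolynomial.basisMonomials Jet ℂ m := by
    simp [MvPolynomial.smul_monomial]
  rw [this, map_smul, sec, Module.Basis.constr_basis]

/-- The exponents of a word. -/
def expo (w : List ℕ) : Jet →₀ ℕ := Multiset.toFinsupp ((w : Multiset ℕ).map letter)

theorem abelianize_W_eq_monomial (w : List ℕ) :
    abelianize (W w) = MvPolynomial.monomial (expo w) 1 := by
  induction w with
  | nil => simp [expo]
  | cons a w ih =>
    rw [W_cons, map_mul, abelianize_gen, ih, MvPolynomial.X, MvPolynomial.monomial_mul, one_mul]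
    congr 1
    rw [expo, expo, ← Multiset.cons_coe, Multiset.map_cons, ← Multiset.singleton_add, map_add,
      Multiset.toFinsupp_singleton]

theorem sortedWord_expo (w : List ℕ) : sortedWord (expo w) = w.insertionSort (· ≤ ·) := by
  rw [sortedWord, expo, Multiset.toFinsupp_toMultiset, Multiset.map_map]
  have : ((w : Multiset ℕ).map (letterEquiv.symm ∘ letter)) = (w : Multiset ℕ) := by
    conv_rhs => rw [← Multiset.map_id (w : Multiset ℕ)]
    exact Multiset.map_congr rfl fun a _ => letterEquiv.symm_apply_apply a
  rw [this]
  apply List.Perm.eq_of_pairwise' (r := (· ≤ ·))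
  · exact Multiset.pairwise_sort ..
  · exact List.pairwise_insertionSort ..
  · refine List.Perm.trans ?_ (List.perm_insertionSort _ _).symm
    rw [← Multiset.coe_eq_coe, Multiset.sort_eq]

theorem sec_abelianize_W (w : List ℕ) :
    sec (abelianize (W w)) = W (w.insertionSort (· ≤ ·)) := by
  rw [abelianize_W_eq_monomial, sec_monomial, one_smul, sortedWord_expo]

theorem sec_abelianize_evN (h : ℕ →* ℂ) (l : NC) :
    sec (abelianize (evN h l)) = evN h (sortNC l) := by
  rw [sortNC]
  induction l with
  | nil => simp
  | cons x l ih => obtain ⟨w, p⟩ := x; simp [ih, sec_abelianize_W]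

/-- The difference between a word and its sorting. -/
def unsort (w : List ℕ) : Free := W w - W (w.insertionSort (· ≤ ·))

/-- Applying `sec` after `abelianize` sorts every word. Since `a` and the sorted `b` have the same
commutative image, sorting `a` word by word gives `b`. -/
theorem sub_eq_sum_unsort {h : ℕ →* ℂ} {a : Free} {b : NC}
    (hab : abelianize a = abelianize (evN h b)) (hb : sortNC b = b) :
    a - evN h b = ∑ w ∈ (wordBasis.repr a).support, coef w a • unsort w := by
  have h1 : ∑ w ∈ (wordBasis.repr a).support, coef w a • W w = a := by
    conv_rhs => rw [← wordBasis.linearCombination_repr a, Finsupp.linearCombination_apply]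
    simp only [wordBasis_apply]
    rfl
  have h2 := congrArg sec hab
  rw [sec_abelianize_evN, hb] at h2
  nth_rewrite 1 [← h1] at h2
  simp only [map_sum, map_smul, sec_abelianize_W] at h2
  simp only [unsort, smul_sub, Finset.sum_sub_distrib, h1, h2]

theorem evN_par (h : ℕ →* ℂ) (b : NC) (l : List (ℕ × List ℕ)) :
    evN h (par b l) = evN h b + (l.map fun x => h x.1 • unsort x.2).sum := by
  rw [par, evN_append]
  congr 1
  induction l with
  | nil => simp
  | cons x l ih => simp [ih, unsort, smul_sub]; abel

/-- A sorted word contributes zero to the sum of `unsort` terms, so only unsorted words need named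
coefficients. -/
theorem eq_evN_par {h : ℕ →* ℂ} {a : Free} {b : NC} {l : List (ℕ × List ℕ)}
    (hab : abelianize a = abelianize (evN h b)) (hb : sortNC b = b)
    (hl : (l.map Prod.snd).Nodup) (hc : ∀ x ∈ l, h x.1 = coef x.2 a)
    (hs : ∀ w, coef w a ≠ 0 → w.insertionSort (· ≤ ·) = w ∨ w ∈ l.map Prod.snd) :
    a = evN h (par b l) := by
  rw [evN_par, ← sub_eq_iff_eq_add', sub_eq_sum_unsort hab hb]
  have h1 : (l.map fun x => h x.1 • unsort x.2).sum =
      ∑ w ∈ (l.map Prod.snd).toFinset, coef w a • unsort w := by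
    rw [List.sum_toFinset _ hl, List.map_map]
    congr 1
    exact List.map_congr_left fun x hx => by rw [hc x hx]; rfl
  rw [h1]
  refine (Finset.sum_subset (Finset.subset_union_left (s₂ := (l.map Prod.snd).toFinset)) ?_).trans
    (Finset.sum_subset Finset.subset_union_right ?_).symm
  · intro w _ hw
    have : coef w a = 0 := by
      rw [coef, Module.Basis.coord_apply]
      exact Finsupp.notMem_support_iff.1 hw
    rw [this, zero_smul]
  · intro w _ hw
    by_cases h0 : coef w a = 0
    · rw [h0, zero_smul]
    · rcases hs w h0 with hw' | hw'
      · rw [unsort, hw', sub_self, smul_zero]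
      · exact absurd (List.mem_toFinset.2 hw') hw

theorem perm_of_mem_rots {w z : List ℕ} (hz : z ∈ rots w) : z.Perm w := by
  obtain ⟨i, _, rfl⟩ := List.mem_map.1 hz
  exact List.perm_append_comm.trans (by rw [List.take_append_drop])

theorem tri_of_mem_rots {w z : List ℕ} (hz : z ∈ rots w) : Tri (W w) (W z) := by
  obtain ⟨i, _, rfl⟩ := List.mem_map.1 hz
  conv_lhs => rw [← List.take_append_drop i w]
  rw [W_append, W_append]
  exact tri_mul_comm _ _

theorem insertionSort_eq_of_perm {w z : List ℕ} (h : z.Perm w) :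
    z.insertionSort (· ≤ ·) = w.insertionSort (· ≤ ·) := by
  apply List.Perm.eq_of_pairwise' (r := (· ≤ ·))
  · exact List.pairwise_insertionSort ..
  · exact List.pairwise_insertionSort ..
  · exact (List.perm_insertionSort _ _).trans (h.trans (List.perm_insertionSort _ _).symm)

theorem tri_unsort_of_mem_rots {w z : List ℕ} (hz : z ∈ rots w) : Tri (unsort w) (unsort z) := by
  have := (tri_of_mem_rots hz).add (Tri.refl (-W (w.insertionSort (· ≤ ·))))
  rwa [← sub_eq_add_neg, ← sub_eq_add_neg, ← unsort, ← insertionSort_eq_of_perm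
    (perm_of_mem_rots hz), ← unsort] at this

/-- Each word of `L` is a rotation of its sorting or of a word in `l`. -/
def coversRots (l : List (ℕ × List ℕ)) (L : List (List ℕ)) : Bool :=
  L.all fun w => (rots w).any fun z => z == w.insertionSort (· ≤ ·) || l.any fun x => x.2 == z

theorem sum_ite_of_nodup {l : List (ℕ × List ℕ)} (hl : (l.map Prod.fst).Nodup) {x : ℕ × List ℕ}
    (hx : x ∈ l) :
    (l.map fun y => (if y.1 = x.1 then (1 : ℂ) else 0) • unsort y.2).sum = unsort x.2 := by
  induction l with
  | nil => simp at hx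
  | cons y l ih =>
    simp only [List.map_cons, List.nodup_cons] at hl
    rw [List.map_cons, List.sum_cons]
    rcases List.mem_cons.1 hx with rfl | hx
    · rw [if_pos rfl, one_smul, List.sum_eq_zero, add_zero]
      intro z hz
      obtain ⟨y, hy, rfl⟩ := List.mem_map.1 hz
      rw [if_neg, zero_smul]
      intro hyx
      exact hl.1 (hyx ▸ List.mem_map_of_mem hy)
    · rw [ih hl.2 hx, if_neg, zero_smul, zero_add]
      intro hyx
      exact hl.1 (hyx ▸ List.mem_map_of_mem hx)

/-- Modulo commutators `unsort` is constant on rotation classes and vanishes on classes containing a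
sorted word, so one name for each remaining class is enough. The values `r` are fixed before `h`, so
that the values for different densities can afterwards be joined into one assignment. -/
theorem exists_tri_par {a : Free} {b : NC} {l : List (ℕ × List ℕ)} {L : List (List ℕ)}
    (hb : sortNC b = b) (hl : (l.map Prod.fst).Nodup) (hL : coversRots l L = true)
    (hs : ∀ w, coef w a ≠ 0 → w ∈ L) :
    ∃ r : ℕ → ℂ, ∀ h : ℕ →* ℂ, abelianize a = abelianize (evN h b) →
      (∀ x ∈ l, h x.1 = r x.1) → Tri a (evN h (par b l)) := by
  have key : ∀ S : Finset (List ℕ), (∀ w ∈ S, w ∈ L) → ∀ c : List ℕ → ℂ,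
      ∃ r : ℕ → ℂ, Tri (∑ w ∈ S, c w • unsort w) (l.map fun x => r x.1 • unsort x.2).sum := by
    intro S hS c
    induction S using Finset.induction_on with
    | empty => exact ⟨0, by simp [Tri]⟩
    | insert w S hw ih =>
      obtain ⟨r, hr⟩ := ih fun z hz => hS z (Finset.mem_insert_of_mem hz)
      have h1 := List.all_eq_true.1 hL w (hS w (Finset.mem_insert_self ..))
      obtain ⟨z, hz, h2⟩ := List.any_eq_true.1 h1
      have h3 := tri_unsort_of_mem_rots hz
      rw [Finset.sum_insert hw]
      rw [Bool.or_eq_true, beq_iff_eq, List.any_eq_true] at h2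
      rcases h2 with h2 | ⟨x, hx, h2⟩
      · refine ⟨r, ?_⟩
        have h4 : unsort z = 0 := by
          rw [unsort, insertionSort_eq_of_perm (perm_of_mem_rots hz), ← h2, sub_self]
        rw [h4] at h3
        simpa using (h3.smul (c w)).add hr
      · rw [beq_iff_eq] at h2
        -- The coefficient of `w` is credited to the name `x.1` of the representative of its class.
        refine ⟨fun p => c w * (if p = x.1 then 1 else 0) + r p, ?_⟩
        rw [← h2] at h3
        convert (h3.smul (c w)).add hr using 1
        rw [← sum_ite_of_nodup hl hx, List.smul_sum, List.map_map, ← List.sum_map_add]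
        simp only [add_smul, mul_smul, Function.comp_def]
  obtain ⟨r, hr⟩ := key (wordBasis.repr a).support (fun w hw => hs w (by
    rw [coef, Module.Basis.coord_apply]; exact Finsupp.mem_support_iff.1 hw)) fun w => coef w a
  refine ⟨r, fun h hab hh => ?_⟩
  rw [← sub_eq_sum_unsort hab hb] at hr
  have := (Tri.refl (evN h b)).add hr
  rw [add_sub_cancel] at this
  rwa [evN_par, List.map_congr_left (g := fun x => r x.1 • unsort x.2)
    fun x hx => by rw [hh x hx]]

/-! ### Weights of words -/

def wt (ν : Fin 2 → ℝ) (w : List ℕ) : ℝ := (w.map fun a => jetWeight ν (letter a)).sum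

theorem coef_of_mem_freeHomogeneous {ν : Fin 2 → ℝ} {d : ℝ} {a : Free}
    (ha : a ∈ freeHomogeneous ν d) {w : List ℕ} (hw : coef w a ≠ 0) : wt ν w = d := by
  by_contra hd
  apply hw
  have : freeHomogeneous ν d ≤ LinearMap.ker (coef w) := by
    refine Submodule.span_le.2 ?_
    rintro _ ⟨l, hl, rfl⟩
    have h1 : (l.map (FreeAlgebra.ι ℂ)).prod = W (l.map letterEquiv.symm) := by
      rw [W, List.map_map]
      congr 1
      apply List.map_congr_left
      intro x _
      exact congrArg _ (letterEquiv.apply_symm_apply x).symm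
    rw [SetLike.mem_coe, LinearMap.mem_ker, h1, coef_W, if_neg]
    rintro rfl
    apply hd
    rw [← hl, wt, List.map_map]
    congr 1
    apply List.map_congr_left
    intro x _
    exact congrArg _ (letterEquiv.apply_symm_apply x)
  exact this ha

theorem weight_expo (ν : Fin 2 → ℝ) (w : List ℕ) :
    Finsupp.weight (jetWeight ν) (expo w) = wt ν w := by
  induction w with
  | nil => simp [expo, wt]
  | cons a w ih =>
    rw [wt, List.map_cons, List.sum_cons, ← wt, ← ih, expo, expo, ← Multiset.cons_coe,
      Multiset.map_cons, ← Multiset.singleton_add, map_add, Multiset.toFinsupp_singleton, map_add,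
      Finsupp.weight_single, one_smul]

theorem isWeightedHomogeneous_abelianize (ν : Fin 2 → ℝ) (h : ℕ →* ℂ) {b : NC} {d : ℝ}
    (hb : ∀ x ∈ b, wt ν x.1 = d) :
    MvPolynomial.IsWeightedHomogeneous (jetWeight ν) (abelianize (evN h b)) d := by
  induction b with
  | nil => simpa using MvPolynomial.isWeightedHomogeneous_zero ..
  | cons x b ih =>
    obtain ⟨w, p⟩ := x
    rw [evN_cons, map_add, map_smul]
    refine MvPolynomial.IsWeightedHomogeneous.add ?_ (ih fun y hy => hb y (List.mem_cons_of_mem _ hy))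
    rw [abelianize_W_eq_monomial, MvPolynomial.smul_monomial]
    apply MvPolynomial.isWeightedHomogeneous_monomial
    rw [weight_expo, hb (w, p) (List.mem_cons_self ..)]

/-- A sorted polynomial is recovered from its commutative image by `sec`, so each of its words with
nonzero coefficient comes from a monomial of that image. -/
theorem wt_of_isWeightedHomogeneous {ν : Fin 2 → ℝ} {h : ℕ →* ℂ} {b : NC} (hb : sortNC b = b)
    {d : ℝ} (hd : MvPolynomial.IsWeightedHomogeneous (jetWeight ν) (abelianize (evN h b)) d)
    {w : List ℕ} (hw : coef w (evN h b) ≠ 0) : wt ν w = d := by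
  have h1 := sec_abelianize_evN h b
  rw [hb] at h1
  rw [← h1] at hw
  rw [(abelianize (evN h b)).as_sum, map_sum, map_sum] at hw
  obtain ⟨m, _, hm⟩ := Finset.exists_ne_zero_of_sum_ne_zero hw
  rw [sec_monomial, map_smul, coef_W] at hm
  have h2 : sortedWord m = w := by
    by_contra hne
    simp [hne] at hm
  have h3 : (abelianize (evN h b)).coeff m ≠ 0 := by
    intro h0
    simp [h0] at hm
  rw [← hd h3, ← weight_expo]
  congr 1
  rw [← h2, expo, sortedWord, Multiset.sort_eq, Multiset.map_map]
  have : ((Finsupp.toMultiset m).map (letter ∘ letterEquiv.symm)) = Finsupp.toMultiset m := by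
    conv_rhs => rw [← Multiset.map_id (Finsupp.toMultiset m)]
    exact Multiset.map_congr rfl fun a _ => letterEquiv.apply_symm_apply a
  rw [this, Finsupp.toMultiset_toFinsupp]

/-! ### Enumeration of the words of given weights -/

/-- The weight of a variable for natural weights `g.1`, `g.2` of `u`, `v`. -/
def letterWt (g : ℕ × ℕ) (a : ℕ) : ℕ := (if a % 2 = 0 then g.1 else g.2) + a / 2

def wtN (g : ℕ × ℕ) (w : List ℕ) : ℕ := (w.map (letterWt g)).sum

/-- Natural weights as real weights. -/
def toReal (g : ℕ × ℕ) : Fin 2 → ℝ := ![(g.1 : ℝ), (g.2 : ℝ)]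

theorem jetWeight_letter (ν : Fin 2 → ℝ) (a : ℕ) :
    jetWeight ν (letter a) = (if a % 2 = 0 then ν 0 else ν 1) + (a / 2 : ℕ) := by
  rcases Nat.mod_two_eq_zero_or_one a with h | h <;> simp [jetWeight, letter, h]

theorem wt_toReal (g : ℕ × ℕ) (w : List ℕ) : wt (toReal g) w = wtN g w := by
  rw [wt, wtN]
  induction w with
  | nil => simp
  | cons a w ih =>
    rw [List.map_cons, List.sum_cons, List.map_cons, List.sum_cons, ih, jetWeight_letter, letterWt]
    split_ifs <;> simp [toReal]

/-- A word contains as many letters `u` as letters `v` (with all derivatives). -/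
def balanced (w : List ℕ) : Bool :=
  (w.filter fun a => a % 2 = 0).length == (w.filter fun a => a % 2 = 1).length

theorem wt_eq (ν : Fin 2 → ℝ) (w : List ℕ) :
    wt ν w = (w.filter fun a => a % 2 = 0).length * ν 0 +
      (w.filter fun a => a % 2 = 1).length * ν 1 + (w.map fun a => ((a / 2 : ℕ) : ℝ)).sum := by
  rw [wt]
  induction w with
  | nil => simp
  | cons a w ih =>
    rw [List.map_cons, List.sum_cons, ih, jetWeight_letter]
    rcases Nat.mod_two_eq_zero_or_one a with h | h <;> simp [h] <;> ring

/-- Some scalar systems fix only the sum of the two weights. A density made of balanced words then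
has a weight that does not depend on the free parameter. -/
theorem wt_eq_of_balanced {ν ν' : Fin 2 → ℝ} (hν : ν 0 + ν 1 = ν' 0 + ν' 1) {w : List ℕ}
    (hw : balanced w = true) : wt ν w = wt ν' w := by
  rw [balanced, beq_iff_eq] at hw
  rw [wt_eq, wt_eq, hw]
  linear_combination (((w.filter fun a => a % 2 = 1).length : ℕ) : ℝ) * hν

/-- The words of weights `d`, `e` with respect to `g`, `k`, of length at most the first argument. -/
def wordsOf (g k : ℕ × ℕ) : ℕ → ℕ → ℕ → List (List ℕ)
  | 0, d, e => if d = 0 ∧ e = 0 then [[]] else []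
  | n + 1, d, e => (if d = 0 ∧ e = 0 then [[]] else []) ++
    -- A letter `a` weighs at least `a / 2`, so only letters below `2 * d + 2` fit.
    (List.range (2 * d + 2)).flatMap fun a =>
      if letterWt g a ≤ d ∧ letterWt k a ≤ e then
        (wordsOf g k n (d - letterWt g a) (e - letterWt k a)).map (a :: ·)
      else []

theorem mem_wordsOf {g k : ℕ × ℕ} {n : ℕ} {w : List ℕ} (hn : w.length ≤ n) :
    w ∈ wordsOf g k n (wtN g w) (wtN k w) := by
  induction w generalizing n with
  | nil => cases n <;> simp [wordsOf, wtN]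
  | cons a w ih =>
    obtain ⟨n, rfl⟩ : ∃ m, n = m + 1 := ⟨n - 1, by simp at hn; omega⟩
    have h1 : wtN g (a :: w) = letterWt g a + wtN g w := by simp [wtN]
    have h2 : wtN k (a :: w) = letterWt k a + wtN k w := by simp [wtN]
    rw [wordsOf, h1, h2, List.mem_append]
    right
    rw [List.mem_flatMap]
    refine ⟨a, ?_, ?_⟩
    · rw [List.mem_range, letterWt]; omega
    · rw [if_pos ⟨Nat.le_add_right .., Nat.le_add_right ..⟩, Nat.add_sub_cancel_left,
        Nat.add_sub_cancel_left]
      exact List.mem_map_of_mem (ih (by simpa using hn))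

/-- This is why two systems of weights are used. For one such as $(1,0)$ the letter $v$ weighs
nothing, and words of a given weight can be arbitrarily long; with both together every letter
counts. -/
theorem length_le_wtN {g k : ℕ × ℕ} (h0 : 0 < g.1 + k.1) (h1 : 0 < g.2 + k.2) (w : List ℕ) :
    w.length ≤ wtN g w + wtN k w := by
  induction w with
  | nil => simp
  | cons a w ih =>
    have h1 : wtN g (a :: w) = letterWt g a + wtN g w := by simp [wtN]
    have h2 : wtN k (a :: w) = letterWt k a + wtN k w := by simp [wtN]
    have h3 : 1 ≤ letterWt g a + letterWt k a := by
      simp only [letterWt]; split_ifs <;> omega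
    rw [h1, h2, List.length_cons]
    omega

/-! ### Values of the variables -/

/-- The evaluation of monomials that takes each prime `p` to `x p`. -/
def envHom (x : ℕ → ℂ) : ℕ →* ℂ where
  toFun n := if n = 0 then 0 else (n.primeFactorsList.map x).prod
  map_one' := by simp
  map_mul' m n := by
    rcases eq_or_ne m 0 with rfl | hm
    · simp
    rcases eq_or_ne n 0 with rfl | hn
    · simp
    rw [if_neg (mul_ne_zero hm hn), if_neg hm, if_neg hn, ← List.prod_append, ← List.map_append]
    exact ((Nat.perm_primeFactorsList_mul hm hn).map x).prod_eq

theorem envHom_prime (x : ℕ → ℂ) {p : ℕ} (hp : p.Prime) : envHom x p = x p := by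
  change (if p = 0 then 0 else (p.primeFactorsList.map x).prod) = x p
  rw [if_neg hp.ne_zero, Nat.primeFactorsList_prime hp]
  simp

/-- Trial division by $2,\dots,39$ is enough below $40^2=1600$. -/
def isPrime (p : ℕ) : Bool :=
  1 < p && p < 1600 && (List.range 38).all fun i => p % (i + 2) != 0 || p ≤ i + 2

theorem prime_of_isPrime {p : ℕ} (h : isPrime p = true) : p.Prime := by
  simp only [isPrime, Bool.and_eq_true, decide_eq_true_eq, List.all_eq_true, List.mem_range,
    Bool.or_eq_true, bne_iff_ne] at h
  obtain ⟨⟨h1, h2⟩, h3⟩ := h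
  by_contra hp
  have h4 := Nat.minFac_sq_le_self (by omega) hp
  have h5 := (Nat.minFac_prime (n := p) (by omega)).two_le
  have h6 : p.minFac < 40 := by nlinarith
  rcases h3 (p.minFac - 2) (by omega) with h7 | h7
  · rw [Nat.sub_add_cancel h5] at h7
    exact h7 (Nat.mod_eq_zero_of_dvd (Nat.minFac_dvd p))
  · rw [Nat.sub_add_cancel h5] at h7
    have := (Nat.not_prime_iff_minFac_lt (by omega)).1 hp
    omega

/-- No variable but the one with number `2` occurs. -/
def onlyTwo (l : NC) : Bool := l.all fun x => x.2.all fun t => t.1 == 2 ^ Nat.log2 t.1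

theorem evN_congr {h h' : ℕ →* ℂ} (h2 : h 2 = h' 2) {l : NC} (hl : onlyTwo l = true) :
    evN h l = evN h' l := by
  have key : ∀ p : Poly, (p.all fun t => t.1 == 2 ^ Nat.log2 t.1) = true → ev h p = ev h' p := by
    intro p hp
    induction p with
    | nil => rfl
    | cons t p ih =>
      obtain ⟨m, c⟩ := t
      rw [List.all_cons, Bool.and_eq_true, beq_iff_eq] at hp
      have hm : m = 2 ^ Nat.log2 m := hp.1
      rw [ev_cons, ev_cons, ih hp.2, hm, map_pow, map_pow, h2]
  rw [onlyTwo] at hl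
  induction l with
  | nil => rfl
  | cons x l ih =>
    obtain ⟨w, p⟩ := x
    rw [List.all_cons, Bool.and_eq_true] at hl
    rw [evN_cons, evN_cons, ih hl.2, key p hl.1]

/-- Conditions on the values of disjoint sets of variables can be met simultaneously. -/
theorem exists_values {Y : Type*} [Zero Y] (l : List (List ℕ × ((ℕ → Y) → Prop)))
    (hl : (l.map Prod.fst).flatten.Nodup)
    (hcongr : ∀ i ∈ l, ∀ x x' : ℕ → Y, (∀ p ∈ i.1, x p = x' p) → i.2 x → i.2 x')
    (hex : ∀ i ∈ l, ∃ x, i.2 x) : ∃ x, ∀ i ∈ l, i.2 x := by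
  induction l with
  | nil => exact ⟨0, by simp⟩
  | cons i l ih =>
    rw [List.map_cons, List.flatten_cons, List.nodup_append] at hl
    obtain ⟨x, hx⟩ := ih hl.2.1 (fun j hj => hcongr j (List.mem_cons_of_mem _ hj))
      fun j hj => hex j (List.mem_cons_of_mem _ hj)
    obtain ⟨y, hy⟩ := hex i (List.mem_cons_self ..)
    refine ⟨fun p => if p ∈ i.1 then y p else x p, ?_⟩
    intro j hj
    rcases List.mem_cons.1 hj with rfl | hj'
    · exact hcongr j hj y _ (fun p hp => by rw [if_pos hp]) hy
    · refine hcongr j hj x _ (fun p hp => ?_) (hx j hj')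
      rw [if_neg]
      intro hp'
      exact hl.2.2 _ hp' _ (List.mem_flatten.2 ⟨j.1, List.mem_map_of_mem hj', hp⟩) rfl

/-! ### Conservation laws of scalar systems -/

theorem abelianize_fD (a : Free) : abelianize (fD a) = cD (abelianize a) := by
  induction a using word_induction with
  | hadd x y hx hy => simp only [map_add, hx, hy]
  | hsmul c x hx => rw [map_smul, map_smul, hx, map_smul, Derivation.map_smul]
  | hW w =>
    induction w with
    | nil => simp [fD, der_one]
    | cons a w ih =>
      rw [W_cons, fD_mul, fD_gen, map_add, map_mul, map_mul, map_mul, ih, Derivation.leibniz,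
        abelianize_gen, abelianize_gen, cD, MvPolynomial.mkDerivation_X]
      have : letter (a + 2) = ((letter a).1, (letter a).2 + 1) := by
        simp [letter, Nat.add_div_right]
      rw [this, smul_eq_mul, smul_eq_mul]
      ring

theorem abelianize_fD_pow (n : ℕ) (a : Free) :
    abelianize ((fD ^ n) a) = cD^[n] (abelianize a) := by
  induction n with
  | zero => rfl
  | succ n ih => rw [pow_succ', Module.End.mul_apply, abelianize_fD, ih, Function.iterate_succ_apply']

theorem abelianize_fDt {f : CommSystem} {F : FreeSystem} (hF : ∀ s, abelianize (F s) = f s)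
    (a : Free) : abelianize (fDt F a) = cDt f (abelianize a) := by
  induction a using word_induction with
  | hadd x y hx hy => simp only [map_add, hx, hy]
  | hsmul c x hx => rw [map_smul, map_smul, hx, map_smul, Derivation.map_smul]
  | hW w =>
    induction w with
    | nil => simp [fDt, der_one]
    | cons a w ih =>
      rw [W_cons, fDt_mul, fDt_gen, map_add, map_mul, map_mul, map_mul, ih, Derivation.leibniz,
        abelianize_fD_pow, hF, abelianize_gen, cDt, MvPolynomial.mkDerivation_X, smul_eq_mul,
        smul_eq_mul]
      rw [mul_comm, add_comm]
      rfl

theorem exists_cD_of_trivial {a : Free} (ha : a ∈ trivialDensities) :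
    ∃ σ, abelianize a = cD σ := by
  have : trivialDensities ≤
      (LinearMap.range (cD : Comm →ₗ[ℂ] Comm)).comap abelianize.toLinearMap := by
    refine sup_le (Submodule.span_le.2 ?_) ?_
    · rintro _ ⟨a, b, rfl⟩
      refine ⟨0, ?_⟩
      simp [Ring.lie_def, mul_comm]
    · rintro _ ⟨a, rfl⟩
      exact ⟨abelianize a, (abelianize_fD a).symm⟩
  obtain ⟨σ, hσ⟩ := this ha
  exact ⟨σ, hσ.symm⟩

/-- The noncommutative identity `tri_fDt` is reused for sorted lifts: commutative reduction turns
trivial densities into total derivatives. It then suffices that the commutative image of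
$P\,\delta\rho/\delta u+Q\,\delta\rho/\delta v-D\sigma$ vanishes. -/
theorem isCommDensity_of_isZeroNC {h : ℕ →* ℂ} {f : CommSystem} {b₀ b₁ ρ σ : NC}
    (h0 : abelianize (evN h b₀) = f 0) (h1 : abelianize (evN h b₁) = f 1)
    (hρ : isZeroNC (sortNC (mulNC b₀ (eulNC 0 ρ) ++ (mulNC b₁ (eulNC 1 ρ) ++ negNC (derNC σ)))) =
      true) : IsCommDensity f (abelianize (evN h ρ)) := by
  have h2 := abelianize_eq_of_isZeroNC (h := h) hρ
  simp only [evN_append, evN_mulNC, evN_negNC, evN_derNC, evN_eulNC] at h2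
  obtain ⟨τ, hτ⟩ := exists_cD_of_trivial (tri_fDt ![evN h b₀, evN h b₁] (evN h ρ))
  rw [map_sub, abelianize_fDt (f := f) (fun s => by fin_cases s <;> assumption)] at hτ
  -- The flux is the given `σ` together with the term `τ` left over by the integrations by parts.
  refine ⟨τ + abelianize (evN h σ), ?_⟩
  rw [← add_assoc, ← sub_eq_add_neg, map_sub, abelianize_fD] at h2
  rw [map_add, ← hτ, ← sub_eq_zero.1 h2]
  simp

/-! ### Analogs in terms of the coefficients -/

/-- A scalar system with weights `g`, `k` and names for the coefficients of its non-Abelian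
analogs. -/
structure System where
  b₀ : NC
  b₁ : NC
  l₀ : List (ℕ × List ℕ)
  l₁ : List (ℕ × List ℕ)
  g : ℕ × ℕ
  k : ℕ × ℕ
  /-- whether the system is homogeneous with all weights of a given sum -/
  bal : Bool

/-- A conserved density of weight `d` with its flux (modulo integrations by parts), names for the
coefficients of its non-Abelian analogs, and instructions for elimination. -/
structure Density where
  d : ℕ
  ρ : NC
  σ : NC
  l : List (ℕ × List ℕ)
  steps : List Step

/-- The last clause says that every word of both weights is sorted or has a name, so that no
admissible term of an analog is overlooked. -/
def checkEq (g k : ℕ × ℕ) (d e : ℕ) (b : NC) (l : List (ℕ × List ℕ)) : Bool :=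
  sortNC b == b && onlyTwo b && (b.all fun x => wtN g x.1 == d && wtN k x.1 == e) &&
  decide (l.map Prod.snd).Nodup &&
  (wordsOf g k (d + e) d e).all fun w =>
    w.insertionSort (· ≤ ·) == w || l.any fun x => x.2 == w

def System.check (S : System) : Bool :=
  -- All systems have $\mu=2$, because of the terms $u_{xx}$ and $v_{xx}$.
  checkEq S.g S.k (2 + S.g.1) (2 + S.k.1) S.b₀ S.l₀ &&
  checkEq S.g S.k (2 + S.g.2) (2 + S.k.2) S.b₁ S.l₁ &&
  0 < S.g.1 + S.k.1 && 0 < S.g.2 + S.k.2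

def Density.check (S : System) (D : Density) : Bool :=
  sortNC D.ρ == D.ρ && onlyTwo D.ρ &&
  (D.ρ.all fun x => wtN S.g x.1 == D.d && wtN S.k x.1 == D.d && (!S.bal || balanced x.1)) &&
  coversRots D.l (wordsOf S.g S.k (D.d + D.d) D.d D.d) &&
  isZeroNC (sortNC (mulNC S.b₀ (eulNC 0 D.ρ) ++
    (mulNC S.b₁ (eulNC 1 D.ρ) ++ negNC (derNC D.σ))))

/-- The primes 2 and 3 are reserved for $\beta$ and $i\sqrt3$. Distinct primes for everything else
make the values of all unknowns independent. -/
def keys (S : System) (Ds : List Density) : List (List ℕ) :=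
  [2] :: [3] :: S.l₀.map Prod.fst :: S.l₁.map Prod.fst :: Ds.map fun D => D.l.map Prod.fst

def checkAll (S : System) (Ds : List Density) : Bool :=
  S.check && Ds.all (Density.check S) && decide (keys S Ds).flatten.Nodup &&
  (keys S Ds).flatten.all isPrime

def blocks (Ds : List Density) : List (NC × List Step) := Ds.map fun D => (par D.ρ D.l, D.steps)

theorem mem_wordsOf_of_mem {g k : ℕ × ℕ} {d e : ℕ} (h1 : 0 < g.1 + k.1) (h2 : 0 < g.2 + k.2)
    {a : Free} (hg : a ∈ freeHomogeneous (toReal g) d) (hk : a ∈ freeHomogeneous (toReal k) e)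
    {w : List ℕ} (hw : coef w a ≠ 0) : w ∈ wordsOf g k (d + e) d e := by
  have h3 := coef_of_mem_freeHomogeneous hg hw
  have h4 := coef_of_mem_freeHomogeneous hk hw
  rw [wt_toReal] at h3 h4
  have h5 : wtN g w = d := by exact_mod_cast h3
  have h6 : wtN k w = e := by exact_mod_cast h4
  rw [← h5, ← h6]
  exact mem_wordsOf (length_le_wtN h1 h2 w)

section analog

variable {f : CommSystem} {F : FreeSystem} {S : System} {β : ℂ}

theorem isWeightedHomogeneous_of_checkEq {g k : ℕ × ℕ} {d e : ℕ} {b : NC} {l : List (ℕ × List ℕ)}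
    (h : checkEq g k d e b l = true) (h' : ℕ →* ℂ) :
    MvPolynomial.IsWeightedHomogeneous (jetWeight (toReal g)) (abelianize (evN h' b)) d ∧
      MvPolynomial.IsWeightedHomogeneous (jetWeight (toReal k)) (abelianize (evN h' b)) e := by
  simp only [checkEq, Bool.and_eq_true, List.all_eq_true, beq_iff_eq] at h
  constructor <;> apply isWeightedHomogeneous_abelianize <;> intro x hx <;> rw [wt_toReal]
  · rw [(h.1.1.2 x hx).1]
  · rw [(h.1.1.2 x hx).2]

theorem isCommHomogeneous_of_check (hS : S.check = true) {h' : ℕ →* ℂ}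
    (h0 : f 0 = abelianize (evN h' S.b₀)) (h1 : f 1 = abelianize (evN h' S.b₁)) :
    IsCommHomogeneous f 2 (toReal S.g) ∧ IsCommHomogeneous f 2 (toReal S.k) := by
  simp only [System.check, Bool.and_eq_true] at hS
  have ha := isWeightedHomogeneous_of_checkEq hS.1.1.1 h'
  have hb := isWeightedHomogeneous_of_checkEq hS.1.1.2 h'
  rw [← h0] at ha
  rw [← h1] at hb
  push_cast at ha hb
  constructor <;> intro s <;> fin_cases s
  exacts [ha.1, hb.1, ha.2, hb.2]

theorem eq_evN_par_of_checkEq {g k : ℕ × ℕ} {d e : ℕ} {b : NC} {l : List (ℕ × List ℕ)}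
    (hc : checkEq g k d e b l = true) (h1 : 0 < g.1 + k.1) (h2 : 0 < g.2 + k.2) {a : Free}
    (hg : a ∈ freeHomogeneous (toReal g) d) (hk : a ∈ freeHomogeneous (toReal k) e)
    {h : ℕ →* ℂ} (hab : abelianize a = abelianize (evN h b))
    (hl : ∀ x ∈ l, h x.1 = coef x.2 a) : a = evN h (par b l) := by
  simp only [checkEq, Bool.and_eq_true, List.all_eq_true, beq_iff_eq, decide_eq_true_eq] at hc
  refine eq_evN_par hab hc.1.1.1.1 hc.1.2 hl fun w hw => ?_
  have := hc.2 w (mem_wordsOf_of_mem h1 h2 hg hk hw)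
  rw [Bool.or_eq_true, beq_iff_eq, List.any_eq_true] at this
  refine this.imp_right ?_
  rintro ⟨x, hx, hxw⟩
  rw [beq_iff_eq] at hxw
  exact hxw ▸ List.mem_map_of_mem hx

/-- The lift provided by condition 3 is replaced by a congruent density of the shape `par`. Only the
values `r` of its named coefficients are returned, because they have yet to be merged with those of
other densities. -/
theorem exists_density {D : Density} (hF : IsNonAbelianAnalog f F) (hS : S.check = true)
    (hD : D.check S = true) (hl : (D.l.map Prod.fst).Nodup)
    (h0 : f 0 = abelianize (evN (envHom fun _ => β) S.b₀))
    (h1 : f 1 = abelianize (evN (envHom fun _ => β) S.b₁))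
    (hν : ∀ μ ν, IsCommHomogeneous f μ ν →
      if S.bal then ν 0 + ν 1 = S.g.1 + S.g.2 else ν = toReal S.g) :
    ∃ r : ℕ → ℂ, ∀ h : ℕ →* ℂ, h 2 = β → (∀ x ∈ D.l, h x.1 = r x.1) →
      IsFreeDensity F (evN h (par D.ρ D.l)) := by
  obtain ⟨hom1, hom2⟩ := isCommHomogeneous_of_check hS h0 h1
  simp only [System.check, Bool.and_eq_true, decide_eq_true_eq] at hS
  simp only [Density.check, Bool.and_eq_true, beq_iff_eq] at hD
  obtain ⟨⟨⟨⟨hD1, hD2⟩, hD3⟩, hD4⟩, hD5⟩ := hD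
  rw [List.all_eq_true] at hD3
  have hcons := isCommDensity_of_isZeroNC h0.symm h1.symm hD5
  -- The weight may be taken as a constant function: either the weights of the system are unique, or
  -- the density is balanced and only the sum of the weights enters.
  obtain ⟨ρ', hρ1, hρ2, hρ3⟩ := hF.lifts _ (fun _ => D.d) (fun μ ν hμ => by
    apply isWeightedHomogeneous_abelianize
    intro x hx
    have h2 := hD3 x hx
    simp only [Bool.and_eq_true, beq_iff_eq, Bool.or_eq_true, Bool.not_eq_true'] at h2
    have h3 := hν μ ν hμ
    rw [← h2.1.1, ← wt_toReal]
    rcases h2.2 with h4 | h4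
    · rw [h4, if_neg (by simp)] at h3
      rw [h3]
    · split_ifs at h3
      · exact wt_eq_of_balanced (by simpa [toReal] using h3) h4
      · rw [h3]) hcons
  obtain ⟨r, hr⟩ := exists_tri_par (a := ρ') hD1 hl hD4
    fun w hw => mem_wordsOf_of_mem hS.1.2 hS.2 (hρ1 _ _ hom1) (hρ1 _ _ hom2) hw
  refine ⟨r, fun h h2 hh => ?_⟩
  refine hρ2.of_tri (hr h ?_ hh)
  rw [hρ3]
  congr 1
  refine evN_congr ?_ hD2
  rw [h2, envHom_prime _ Nat.prime_two]

/-- The coefficients of the system and of each density are determined separately; as their names are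
distinct primes, one multiplicative assignment carries all these values at once. -/
theorem exists_env {Ds : List Density} (hF : IsNonAbelianAnalog f F)
    (hc : checkAll S Ds = true)
    (h0 : f 0 = abelianize (evN (envHom fun _ => β) S.b₀))
    (h1 : f 1 = abelianize (evN (envHom fun _ => β) S.b₁))
    (hν : ∀ μ ν, IsCommHomogeneous f μ ν →
      if S.bal then ν 0 + ν 1 = S.g.1 + S.g.2 else ν = toReal S.g) :
    ∃ h : ℕ →* ℂ, h 2 = β ∧ h 3 = iSqrt3 ∧ F 0 = evN h (par S.b₀ S.l₀) ∧
      F 1 = evN h (par S.b₁ S.l₁) ∧ ∀ y ∈ blocks Ds, IsFreeDensity F (evN h y.1) := by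
  simp only [checkAll, Bool.and_eq_true, decide_eq_true_eq] at hc
  obtain ⟨⟨⟨hS, hDs⟩, hk⟩, hp⟩ := hc
  obtain ⟨hom1, hom2⟩ := isCommHomogeneous_of_check hS h0 h1
  have hprime : ∀ l ∈ keys S Ds, ∀ p ∈ l, p.Prime := fun l hl p hpl =>
    prime_of_isPrime (List.all_eq_true.1 hp p (List.mem_flatten.2 ⟨l, hl, hpl⟩))
  -- Each item pairs a set of names with the condition on their values; the conditions involve
  -- disjoint sets, as `exists_values` requires.
  let items : List (List ℕ × ((ℕ → ℂ) → Prop)) :=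
    ([2], fun x => x 2 = β) :: ([3], fun x => x 3 = iSqrt3) ::
    (S.l₀.map Prod.fst, fun x => ∀ y ∈ S.l₀, x y.1 = coef y.2 (F 0)) ::
    (S.l₁.map Prod.fst, fun x => ∀ y ∈ S.l₁, x y.1 = coef y.2 (F 1)) ::
    Ds.map fun D => (D.l.map Prod.fst, fun x => ∀ h : ℕ →* ℂ, h 2 = β →
      (∀ y ∈ D.l, h y.1 = x y.1) → IsFreeDensity F (evN h (par D.ρ D.l)))
  have hitems : items.map Prod.fst = keys S Ds := by
    simp [items, keys, Function.comp_def]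
  have hvals : ∀ (l : List (ℕ × List ℕ)) (a : Free), (l.map Prod.fst).Nodup →
      ∃ x : ℕ → ℂ, ∀ y ∈ l, x y.1 = coef y.2 a := by
    intro l a hl
    induction l with
    | nil => exact ⟨0, by simp⟩
    | cons z l ih =>
      rw [List.map_cons, List.nodup_cons] at hl
      obtain ⟨x, hx⟩ := ih hl.2
      refine ⟨Function.update x z.1 (coef z.2 a), ?_⟩
      intro y hy
      rcases List.mem_cons.1 hy with rfl | hy
      · simp
      · rw [Function.update_of_ne, hx y hy]
        intro hyz
        exact hl.1 (hyz ▸ List.mem_map_of_mem hy)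
  have hnd : ∀ l ∈ keys S Ds, l.Nodup := (List.nodup_flatten.1 hk).1
  obtain ⟨x, hx⟩ := exists_values items (hitems ▸ hk) (by
    intro i hi x x' hxx hix
    simp only [items, List.mem_cons, List.mem_map] at hi
    rcases hi with rfl | rfl | rfl | rfl | ⟨D, _, rfl⟩
    · exact (hxx 2 (by simp)).symm.trans hix
    · exact (hxx 3 (by simp)).symm.trans hix
    · exact fun y hy => by rw [← hxx y.1 (List.mem_map_of_mem hy)]; exact hix y hy
    · exact fun y hy => by rw [← hxx y.1 (List.mem_map_of_mem hy)]; exact hix y hy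
    · exact fun h h2 hh => hix h h2 fun y hy => by
        rw [hh y hy, hxx y.1 (List.mem_map_of_mem hy)]) (by
    intro i hi
    simp only [items, List.mem_cons, List.mem_map] at hi
    rcases hi with rfl | rfl | rfl | rfl | ⟨D, hD, rfl⟩
    · exact ⟨fun _ => β, rfl⟩
    · exact ⟨fun _ => iSqrt3, rfl⟩
    · exact hvals _ _ (hnd _ (by simp [keys]))
    · exact hvals _ _ (hnd _ (by simp [keys]))
    · exact exists_density hF hS (List.all_eq_true.1 hDs D hD)
        (hnd _ (by simp only [keys, List.mem_cons, List.mem_map]; tauto)) h0 h1 hν)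
  have hx' : ∀ l ∈ keys S Ds, ∀ p ∈ l, envHom x p = x p := fun l hl p hpl =>
    envHom_prime x (hprime l hl p hpl)
  have h2 : envHom x 2 = β :=
    (hx' [2] (by simp [keys]) 2 (by simp)).trans (hx ([2], fun x => x 2 = β) (by simp [items]))
  have h3 : envHom x 3 = iSqrt3 :=
    (hx' [3] (by simp [keys]) 3 (by simp)).trans
      (hx ([3], fun x => x 3 = iSqrt3) (by simp [items]))
  have hS' := hS
  simp only [System.check, Bool.and_eq_true, decide_eq_true_eq] at hS
  have only : ∀ {d e : ℕ} {b : NC} {l : List (ℕ × List ℕ)},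
      checkEq S.g S.k d e b l = true → evN (envHom fun _ => β) b = evN (envHom x) b := by
    intro d e b l hb
    simp only [checkEq, Bool.and_eq_true] at hb
    exact evN_congr (by rw [h2, envHom_prime _ Nat.prime_two]) hb.1.1.1.2
  refine ⟨envHom x, h2, h3, ?_, ?_, ?_⟩
  · refine eq_evN_par_of_checkEq hS.1.1.1 hS.1.2 hS.2 ?_ ?_ ?_ ?_
    · have := hF.homogeneous _ _ hom1 0
      push_cast; exact this
    · have := hF.homogeneous _ _ hom2 0
      push_cast; exact this
    · rw [hF.reduces, h0, only hS.1.1.1]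
    · intro y hy
      rw [hx' _ (by simp only [keys, List.mem_cons]; tauto) _ (List.mem_map_of_mem hy)]
      exact hx _ (List.mem_cons_of_mem _ (List.mem_cons_of_mem _ (List.mem_cons_self ..))) y hy
  · refine eq_evN_par_of_checkEq hS.1.1.2 hS.1.2 hS.2 ?_ ?_ ?_ ?_
    · have := hF.homogeneous _ _ hom1 1
      push_cast; exact this
    · have := hF.homogeneous _ _ hom2 1
      push_cast; exact this
    · rw [hF.reduces, h1, only hS.1.1.2]
    · intro y hy
      rw [hx' _ (by simp only [keys, List.mem_cons]; tauto) _ (List.mem_map_of_mem hy)]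
      exact hx _ (List.mem_cons_of_mem _ (List.mem_cons_of_mem _ (List.mem_cons_of_mem _
        (List.mem_cons_self ..)))) y hy
  · intro y hy
    obtain ⟨D, hD, rfl⟩ := List.mem_map.1 hy
    refine hx (D.l.map Prod.fst, _) (List.mem_cons_of_mem _ (List.mem_cons_of_mem _
      (List.mem_cons_of_mem _ (List.mem_cons_of_mem _ (List.mem_map_of_mem hD))))) (envHom x) h2 ?_
    intro z hz
    exact hx' (D.l.map Prod.fst) (by simp only [keys, List.mem_cons, List.mem_map]; tauto) _
      (List.mem_map_of_mem hz)

/-- The restriction on the weights of a scalar system by one of its terms. -/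
theorem wt_of_isCommHomogeneous {b : NC} {h' : ℕ →* ℂ} {s : Fin 2}
    (hs : f s = abelianize (evN h' b)) (hb : (sortNC b == b && noConst b) = true) {μ : ℝ}
    {ν : Fin 2 → ℝ} (hν : IsCommHomogeneous f μ ν) {w : List ℕ} {c : ℚ} (hc : c ≠ 0)
    (hw : ((mkTrie b .nil).lookup w == [(1, c)]) = true) : wt ν w = μ + ν s := by
  rw [Bool.and_eq_true, beq_iff_eq] at hb
  rw [beq_iff_eq] at hw
  have := hν s
  rw [hs] at this
  apply wt_of_isWeightedHomogeneous hb.1 this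
  have h1 := eval_mkTrie h' hb.2 .nil
  rw [Trie.eval, add_zero] at h1
  rw [← h1, ← Trie.ev_lookup, hw]
  simpa using hc

end analog

/-! ### Comparison with given systems -/

/-- Noncommutative polynomials with arithmetic operations. -/
structure NPoly where
  l : NC

namespace NPoly

instance : Add NPoly := ⟨fun a b => ⟨a.l ++ b.l⟩⟩
instance : Neg NPoly := ⟨fun a => ⟨negNC a.l⟩⟩
instance : Sub NPoly := ⟨fun a b => ⟨a.l ++ negNC b.l⟩⟩
instance : Mul NPoly := ⟨fun a b => ⟨mulNC a.l b.l⟩⟩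
instance : Bracket NPoly NPoly := ⟨fun a b => a * b - b * a⟩
instance (n : ℕ) : OfNat NPoly n := ⟨⟨[([], [(1, (n : ℚ))])]⟩⟩
instance : SMul Poly NPoly := ⟨fun p a => ⟨mulNC [([], p)] a.l⟩⟩

def npow (a : NPoly) : ℕ → NPoly
  | 0 => 1
  | n + 1 => npow a n * a

instance : Pow NPoly ℕ := ⟨npow⟩

def D (a : NPoly) : NPoly := ⟨derNC a.l⟩

/-- The variable with number `n`. -/
def var (n : ℕ) : NPoly := ⟨[([n], [(1, 1)])]⟩

def val (h : ℕ →* ℂ) (a : NPoly) : Free := evN h a.l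

variable (h : ℕ →* ℂ) (a b : NPoly)

@[simp] theorem val_add : (a + b).val h = a.val h + b.val h := evN_append ..
@[simp] theorem val_neg : (-a).val h = -a.val h := evN_negNC ..
@[simp] theorem val_sub : (a - b).val h = a.val h - b.val h := by
  rw [sub_eq_add_neg, val, val, val, ← evN_negNC, ← evN_append]; rfl
@[simp] theorem val_mul : (a * b).val h = a.val h * b.val h := evN_mulNC ..
@[simp] theorem val_lie : (⁅a, b⁆).val h = ⁅a.val h, b.val h⁆ := by
  rw [Ring.lie_def, ← val_mul, ← val_mul, ← val_sub]; rfl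
@[simp] theorem val_ofNat (n : ℕ) [n.AtLeastTwo] :
    (ofNat(n) : NPoly).val h = OfNat.ofNat n := by
  have : (OfNat.ofNat n : NPoly).val h = ev h [(1, (n : ℚ))] • 1 + 0 := rfl
  rw [this]
  simp [Algebra.smul_def]
  exact Nat.cast_ofNat
@[simp] theorem val_one : (1 : NPoly).val h = 1 := by
  have : (1 : NPoly).val h = ev h [(1, ((1 : ℕ) : ℚ))] • 1 + 0 := rfl
  rw [this]
  simp
@[simp] theorem val_smul (p : Poly) : (p • a).val h = ev h p • a.val h := by
  have : (p • a).val h = evN h (mulNC [([], p)] a.l) := rfl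
  rw [this]
  simp [val]
@[simp] theorem val_pow (n : ℕ) : (a ^ n).val h = a.val h ^ n := by
  induction n with
  | zero => rw [pow_zero]; exact val_one h
  | succ n ih => rw [pow_succ, ← ih, ← val_mul]; rfl
@[simp] theorem val_D : a.D.val h = fD (a.val h) := evN_derNC ..
@[simp] theorem val_var (n : ℕ) : (var n).val h = gen n := by
  simp [val, var]

end NPoly

/-! ### Comparison up to the involution -/

theorem star_gen (a : ℕ) : star (gen a) = gen a := by simp [gen]

theorem star_W (w : List ℕ) : star (W w) = W w.reverse := by
  induction w with
  | nil => simp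
  | cons a w ih => simp [ih, star_gen]

theorem star_smul_free (c : ℂ) (a : Free) : star (c • a) = c • star a := by
  rw [Algebra.smul_def, Algebra.smul_def, star_mul, FreeAlgebra.star_algebraMap,
    (Algebra.commutes c (star a))]

theorem star_evN (h : ℕ →* ℂ) (l : NC) :
    star (evN h l) = evN h (l.map fun x => (x.1.reverse, x.2)) := by
  induction l with
  | nil => simp
  | cons x l ih => obtain ⟨w, p⟩ := x; simp [ih, star_W, star_smul_free]

/-- Equality of two noncommutative polynomials by virtue of given rules. -/
def agree (r : List (ℕ × Poly)) (a b : NC) : Bool :=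
  -- The number 9 is the code of the square of $i\sqrt3$.
  isZeroNC (substNC [(9, [(1, -3)])] (substNC r (a ++ negNC b)))

theorem h_nine {h : ℕ →* ℂ} (h3 : h 3 = iSqrt3) : h 9 = -3 := by
  rw [show (9 : ℕ) = 3 * 3 from rfl, map_mul, h3, iSqrt3]
  have h1 : ((Real.sqrt 3 : ℝ) : ℂ) * (Real.sqrt 3 : ℝ) = 3 := by
    rw [← Complex.ofReal_mul, Real.mul_self_sqrt (by norm_num)]; norm_num
  linear_combination (Complex.I * Complex.I) * h1 + 3 * Complex.I_mul_I

theorem evN_eq_of_agree {h : ℕ →* ℂ} (h3 : h 3 = iSqrt3) {r : List (ℕ × Poly)} (hr : Valid h r)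
    {a b : NC} (hab : agree r a b = true) : evN h a = evN h b := by
  have h9 : Valid h [(9, [(1, -3)])] := by
    intro x hx
    rw [List.mem_singleton] at hx
    subst hx
    simp [h_nine h3]
  have := evN_of_isZeroNC h hab
  rw [evN_substNC h9, evN_substNC hr, evN_append, evN_negNC] at this
  rwa [← sub_eq_add_neg, sub_eq_zero] at this

theorem rescale_one (F : FreeSystem) : rescale (fun _ => 1) F = F := by
  funext s
  have : FreeAlgebra.lift ℂ (fun x : Jet => (1 : ℂ)⁻¹ • FreeAlgebra.ι ℂ x) = AlgHom.id ℂ Free := by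
    ext x
    simp
  rw [rescale, this]
  simp

theorem equivalent_of_eq {F G : FreeSystem} (h0 : F 0 = G 0) (h1 : F 1 = G 1) :
    Equivalent F G := by
  refine ⟨fun _ => 1, fun _ => one_ne_zero, Or.inl ?_⟩
  rw [rescale_one]
  funext s
  fin_cases s
  exacts [h0, h1]

theorem equivalent_of_eq_star {F G : FreeSystem} (h0 : F 0 = star (G 0)) (h1 : F 1 = star (G 1)) :
    Equivalent F G := by
  refine ⟨fun _ => 1, fun _ => one_ne_zero, Or.inr ?_⟩
  rw [rescale_one]
  funext s
  fin_cases s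
  exacts [h0, h1]

section

variable {h : ℕ →* ℂ} {F G : FreeSystem} {a b : NC} {T : NPoly × NPoly}

theorem equivalent_of_agree (h3 : h 3 = iSqrt3) (hF0 : F 0 = evN h a) (hF1 : F 1 = evN h b)
    (hG : G 0 = T.1.val h ∧ G 1 = T.2.val h) (r : List (ℕ × Poly)) (hr : Valid h r)
    (hab : (agree r a T.1.l && agree r b T.2.l) = true) : Equivalent F G := by
  rw [Bool.and_eq_true] at hab
  apply equivalent_of_eq
  · rw [hF0, hG.1, NPoly.val, evN_eq_of_agree h3 hr hab.1]
  · rw [hF1, hG.2, NPoly.val, evN_eq_of_agree h3 hr hab.2]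

theorem equivalent_of_agree_star (h3 : h 3 = iSqrt3) (hF0 : F 0 = evN h a) (hF1 : F 1 = evN h b)
    (hG : G 0 = T.1.val h ∧ G 1 = T.2.val h) (r : List (ℕ × Poly)) (hr : Valid h r)
    (hab : (agree r a (T.1.l.map fun x => (x.1.reverse, x.2)) &&
      agree r b (T.2.l.map fun x => (x.1.reverse, x.2))) = true) : Equivalent F G := by
  rw [Bool.and_eq_true] at hab
  apply equivalent_of_eq_star
  · rw [hF0, hG.1, NPoly.val, star_evN, evN_eq_of_agree h3 hr hab.1]
  · rw [hF1, hG.2, NPoly.val, star_evN, evN_eq_of_agree h3 hr hab.2]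

end

/-! ### Expressions of the systems -/

namespace Expr

open NPoly

def u : NPoly := var 0
def v : NPoly := var 1
def ux : NPoly := var 2
def vx : NPoly := var 3
def uxx : NPoly := var 4
def vxx : NPoly := var 5
def i : Poly := [(3, 1)]
def i3 : Poly := [(3, 1 / 3)]
def third : Poly := [(1, 1 / 3)]

def S1' : NPoly × NPoly := (
  uxx + 2 * u * v * u,
  -vxx - 2 * v * u * v)

def S2' : NPoly × NPoly := (
  uxx + 2 * ux * u + 2 * D (v * u) + 2 * ⁅v * u, u⁆,
  -vxx + 2 * vx * v + 2 * D (u * v) + 2 * ⁅v, u * v⁆)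

def S2'' : NPoly × NPoly := (
  uxx + 2 * u * ux + 2 * D (v * u) + 2 * ⁅u, v * u⁆,
  -vxx + 2 * vx * v + 2 * D (v * u) + 2 * ⁅v, v * u⁆)

def S3' : NPoly × NPoly := (
  uxx + 2 * D (v * u),
  -vxx + 2 * vx * v + 2 * ux + 2 * ⁅v, u⁆)

def S4' : NPoly × NPoly := (
  uxx + 2 * ux * (u + v),
  -vxx + 2 * (u + v) * vx)

def S4'' : NPoly × NPoly := (
  uxx + 2 * (u + v) * ux + 2 * ⁅vx, u⁆ - 2 * u ^ 2 * v + 4 * u * v * u - 2 * v * u ^ 2,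
  -vxx + 2 * vx * (u + v) + 2 * ⁅v, ux⁆ + 2 * u * v ^ 2 - 4 * v * u * v + 2 * v ^ 2 * u)

def S5_12' : NPoly × NPoly := (
  uxx + 2 * D (u * v * u),
  -vxx + 2 * D (v * u * v))

def S5_12'' : NPoly × NPoly := (
  uxx + 2 * u ^ 2 * vx + 2 * ux * u * v + 2 * ux * v * u + 2 * ⁅u ^ 2 * v ^ 2, u⁆,
  -vxx + 2 * ux * v ^ 2 + 2 * u * v * vx + 2 * v * u * vx - 2 * ⁅v, u ^ 2 * v ^ 2⁆)

def S5_01' : NPoly × NPoly := (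
  uxx + 2 * u * v * ux,
  -vxx + 2 * vx * u * v)

def S5_01'' : NPoly × NPoly := (
  uxx + 2 * v * u * ux + 2 * ⁅vx * u - v * ⁅v, u⁆ * u, u⁆,
  -vxx + 2 * vx * v * u + 2 * ⁅v, v * ux + v * ⁅v, u⁆ * u⁆)

def S5_01''' : NPoly × NPoly := (
  uxx + 2 * ux * v * u + 2 * ⁅u * v, ux⁆ + 2 * ⁅u * vx, u⁆
    - 2 * u * (u ^ 2 * v - 2 * u * v * u + v * u ^ 2) * v,
  -vxx + 2 * v * u * vx + 2 * ⁅vx, u * v⁆ + 2 * ⁅v, ux * v⁆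
    + 2 * u * (u * v ^ 2 - 2 * v * u * v + v ^ 2 * u) * v)

def S5_10' : NPoly × NPoly := (
  uxx + 2 * u * vx * u - 2 * u * v * u * v * u,
  -vxx + 2 * v * ux * v + 2 * v * u * v * u * v)

def S5_10'' : NPoly × NPoly := (
  uxx + 2 * u ^ 2 * vx - 2 * u ^ 3 * v ^ 2 + 2 * ⁅ux + u ^ 2 * v, u * v⁆,
  -vxx + 2 * ux * v ^ 2 + 2 * u ^ 2 * v ^ 3 - 2 * ⁅vx - u * v ^ 2, u * v⁆)

def B2' : NPoly × NPoly := (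
  uxx + vx * v + v * vx + i3 • ⁅u - vx, v⁆,
  -vxx + ux)

def B3' : NPoly × NPoly := (
  uxx + 3 * (u + v) * vx + 3 * vx * (u + v) - 6 * (u + v) ^ 3 + i • ⁅u + v, vx⁆,
  -vxx + 3 * (u + v) * ux + 3 * ux * (u + v) + 6 * (u + v) ^ 3 - i • ⁅u + v, ux⁆)

def B3'' : NPoly × NPoly := (
  uxx + 3 * (u + v) * vx + 3 * vx * (u + v)
    - 6 * (u ^ 3 + 3 * u * v * u + u * v ^ 2 + v * u * v + v ^ 2 * u + v ^ 3)
    + i • (⁅vx, u - v⁆ + 2 * ⁅u + v, ux⁆ + 6 * ⁅u ^ 2, v⁆ + 6 * ⁅u, v ^ 2⁆),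
  -vxx + 3 * (u + v) * ux + 3 * ux * (u + v)
    + 6 * (u ^ 3 + u ^ 2 * v + u * v * u + v * u ^ 2 + 3 * v * u * v + v ^ 3)
    + i • (⁅ux, u - v⁆ - 2 * ⁅u + v, vx⁆ - 6 * ⁅u ^ 2, v⁆ - 6 * ⁅u, v ^ 2⁆))

def B4' : NPoly × NPoly := (
  uxx + v * vx + vx * v + i3 • ⁅v, u ^ 2 - vx⁆
    - third • (u ^ 2 * v - 2 * u * v * u + v * u ^ 2),
  -vxx + u * ux + ux * u + i3 • ⁅u, v ^ 2 + ux⁆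
    + third • (u * v ^ 2 - 2 * v * u * v + v ^ 2 * u))

def B4'' : NPoly × NPoly := (
  uxx + v * vx + vx * v + u ^ 2 * v - 2 * u * v * u + v * u ^ 2
    - i3 • (2 * ⁅u + v, ux⁆ + ⁅v - 2 * u, vx⁆ + ⁅u ^ 2, v⁆ + 2 * ⁅u, v ^ 2⁆),
  -vxx + u * ux + ux * u - u * v ^ 2 + 2 * v * u * v - v ^ 2 * u
    + i3 • (⁅u - 2 * v, ux⁆ + 2 * ⁅u + v, vx⁆ + 2 * ⁅u ^ 2, v⁆ + ⁅u, v ^ 2⁆))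

end Expr

section

variable (h : ℕ →* ℂ)

@[simp] theorem val_u : Expr.u.val h = u := NPoly.val_var h 0
@[simp] theorem val_v : Expr.v.val h = v := NPoly.val_var h 1
@[simp] theorem val_ux : Expr.ux.val h = ux := NPoly.val_var h 2
@[simp] theorem val_vx : Expr.vx.val h = vx := NPoly.val_var h 3
@[simp] theorem val_uxx : Expr.uxx.val h = uxx := NPoly.val_var h 4
@[simp] theorem val_vxx : Expr.vxx.val h = vxx := NPoly.val_var h 5
@[simp] theorem ev_i : ev h Expr.i = h 3 := by simp [Expr.i]
@[simp] theorem ev_i3 : ev h Expr.i3 = h 3 / 3 := by simp [Expr.i3]; ring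
@[simp] theorem ev_third : ev h Expr.third = 1 / 3 := by simp [Expr.third]

theorem val_S1' : S1' 0 = Expr.S1'.1.val h ∧ S1' 1 = Expr.S1'.2.val h := by
  simp [S1', Expr.S1']

theorem val_S2' : S2' 0 = Expr.S2'.1.val h ∧ S2' 1 = Expr.S2'.2.val h := by
  simp [S2', Expr.S2']

theorem val_S2'' : S2'' 0 = Expr.S2''.1.val h ∧ S2'' 1 = Expr.S2''.2.val h := by
  simp [S2'', Expr.S2'']

theorem val_S3' : S3' 0 = Expr.S3'.1.val h ∧ S3' 1 = Expr.S3'.2.val h := by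
  simp [S3', Expr.S3']

theorem val_S4' : S4' 0 = Expr.S4'.1.val h ∧ S4' 1 = Expr.S4'.2.val h := by
  simp [S4', Expr.S4']

theorem val_S4'' : S4'' 0 = Expr.S4''.1.val h ∧ S4'' 1 = Expr.S4''.2.val h := by
  simp [S4'', Expr.S4'']

theorem val_S5_12' : S5_12' 0 = Expr.S5_12'.1.val h ∧ S5_12' 1 = Expr.S5_12'.2.val h := by
  simp [S5_12', Expr.S5_12']

theorem val_S5_12'' : S5_12'' 0 = Expr.S5_12''.1.val h ∧ S5_12'' 1 = Expr.S5_12''.2.val h := by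
  simp [S5_12'', Expr.S5_12'']

theorem val_S5_01' : S5_01' 0 = Expr.S5_01'.1.val h ∧ S5_01' 1 = Expr.S5_01'.2.val h := by
  simp [S5_01', Expr.S5_01']

theorem val_S5_01'' : S5_01'' 0 = Expr.S5_01''.1.val h ∧ S5_01'' 1 = Expr.S5_01''.2.val h := by
  simp [S5_01'', Expr.S5_01'']

theorem val_S5_01''' : S5_01''' 0 = Expr.S5_01'''.1.val h ∧ S5_01''' 1 = Expr.S5_01'''.2.val h := by
  simp [S5_01''', Expr.S5_01''']

theorem val_S5_10' : S5_10' 0 = Expr.S5_10'.1.val h ∧ S5_10' 1 = Expr.S5_10'.2.val h := by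
  simp [S5_10', Expr.S5_10']

theorem val_S5_10'' : S5_10'' 0 = Expr.S5_10''.1.val h ∧ S5_10'' 1 = Expr.S5_10''.2.val h := by
  simp [S5_10'', Expr.S5_10'']

variable {h}

theorem val_B2' (h3 : h 3 = iSqrt3) :
    B2' 0 = Expr.B2'.1.val h ∧ B2' 1 = Expr.B2'.2.val h := by
  simp [B2', Expr.B2', h3]

theorem val_B3' (h3 : h 3 = iSqrt3) :
    B3' 0 = Expr.B3'.1.val h ∧ B3' 1 = Expr.B3'.2.val h := by
  simp [B3', Expr.B3', h3]

theorem val_B3'' (h3 : h 3 = iSqrt3) :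
    B3'' 0 = Expr.B3''.1.val h ∧ B3'' 1 = Expr.B3''.2.val h := by
  simp [B3'', Expr.B3'', h3]

theorem val_B4' (h3 : h 3 = iSqrt3) :
    B4' 0 = Expr.B4'.1.val h ∧ B4' 1 = Expr.B4'.2.val h := by
  simp [B4', Expr.B4', h3]

theorem val_B4'' (h3 : h 3 = iSqrt3) :
    B4'' 0 = Expr.B4''.1.val h ∧ B4'' 1 = Expr.B4''.2.val h := by
  simp [B4'', Expr.B4'', h3]

end

/-! ### Conserved densities and elimination for the separate scalar systems -/

/-- The weights $(1,1)$ and $(2,0)$ belong to the family $\nu_1+\nu_2=2$. Together they fix the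
surplus of letters $u$ over letters $v$ in each equation. -/
def s1 : System where
  b₀ := [([0, 0, 1], [(1, 2)]), ([4], [(1, 1)])]
  b₁ := [([0, 1, 1], [(1, -2)]), ([5], [(1, -1)])]
  l₀ := [(5, [0, 1, 0]), (7, [1, 0, 0])]
  l₁ := [(11, [1, 0, 1]), (13, [1, 1, 0])]
  g := (1, 1)
  k := (2, 0)
  bal := true

def s1Density2 : Density where
  d := 2
  ρ := [([0, 1], [(1, 1)])]
  σ := [([0, 3], [(1, -1)]), ([1, 2], [(1, 1)])]
  l := []
  steps := [([(1, 0, [0, 1, 1])], 5)]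

def s1Density3 : Density where
  d := 3
  ρ := [([0, 3], [(1, 1)])]
  σ := [([0, 0, 1, 1], [(1, 1)]), ([2, 3], [(1, 1)])]
  l := []
  steps := [([(1, 0, [0, 1, 3])], 7), ([(1, 0, [1, 3, 0])], 11)]

def s1Density5 : Density where
  d := 5
  ρ := [([0, 0, 1, 3], [(1, 3)]), ([0, 7], [(1, 1)])]
  σ := [([0, 0, 0, 1, 1, 1], [(1, 4)]), ([0, 0, 1, 5], [(1, 2)]), ([0, 0, 3, 3], [(1, -1)]),
    ([0, 1, 1, 4], [(1, 2)]), ([0, 1, 2, 3], [(1, 2)]), ([1, 1, 2, 2], [(1, -1)]), ([4, 5],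
    [(1, 1)])]
  l := [(17, [0, 0, 3, 1]), (19, [0, 2, 1, 1]), (23, [0, 1, 0, 3]), (29, [0, 1, 2, 1])]
  steps := [([(1, 0, [6, 1, 1])], 19), ([(1, 0, [0, 5, 3])], 17), ([(1, 0, [4, 1, 3])], 23),
    ([(1, 0, [1, 0, 1, 3, 0])], 0), ([(1, 0, [1, 3, 0, 0, 1])], 0)]

def s1Densities : List Density :=
  [s1Density2, s1Density3, s1Density5]

def s1Solution : NC × NC × List Poly := (
  [([0, 0, 1], [(13, -1)]), ([0, 1, 0], [(1, 2), (13, 2)]), ([4], [(1, 1)]), ([1, 0, 0],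
  [(13, -1)])], [([0, 1, 1], [(13, 1)]), ([5], [(1, -1)]), ([1, 0, 1], [(1, -2), (13, -2)]),
  ([1, 1, 0], [(13, 1)])], [[(169, 3/2)], [(13, 3), (169, 3)]])

theorem solution_s1 :
    solution (par s1.b₀ s1.l₀) (par s1.b₁ s1.l₁) (blocks s1Densities) [] = s1Solution := by
  decide +kernel

theorem check_s1 : checkAll s1 s1Densities = true := by
  decide +kernel

def s2 : System where
  b₀ := [([0, 2], [(1, 2)]), ([0, 3], [(1, 2)]), ([1, 2], [(1, 2)]), ([4], [(1, 1)])]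
  b₁ := [([0, 3], [(1, 2)]), ([1, 2], [(1, 2)]), ([1, 3], [(1, 2)]), ([5], [(1, -1)])]
  l₀ := [(5, [0, 1, 0]), (7, [2, 0]), (11, [2, 1]), (13, [1, 0, 0]), (17, [1, 0, 1]), (19, [1, 1, 0]),
    (23, [3, 0]), (29, [3, 1])]
  l₁ := [(31, [0, 1, 0]), (37, [2, 0]), (41, [2, 1]), (43, [1, 0, 0]), (47, [1, 0, 1]),
    (53, [1, 1, 0]), (59, [3, 0]), (61, [3, 1])]
  g := (1, 1)
  k := (1, 1)
  bal := false

def s2Density2 : Density where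
  d := 2
  ρ := [([0, 1], [(1, 1)])]
  σ := [([0, 0, 1], [(1, 2)]), ([0, 1, 1], [(1, 2)]), ([0, 3], [(1, -1)]), ([1, 2], [(1, 1)])]
  l := []
  steps := [([(1, 0, [2, 1])], 7), ([(1, 0, [3, 1])], 23), ([(1, 0, [1, 0, 1])], 5)]

def s2Density3 : Density where
  d := 3
  ρ := [([0, 0, 1], [(1, -1)]), ([0, 1, 1], [(1, -1)]), ([0, 3], [(1, 1)])]
  σ := [([0, 0, 0, 1], [(1, -2)]), ([0, 0, 1, 1], [(1, -5)]), ([0, 0, 3], [(1, 1)]), ([0, 1, 1, 1],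
    [(1, -2)]), ([0, 1, 2], [(1, -2)]), ([0, 1, 3], [(1, 2)]), ([1, 1, 2], [(1, -1)]), ([2, 3],
    [(1, 1)])]
  l := []
  steps := [([(1, 0, [1, 3, 1])], 17), ([(1, 0, [0, 3, 0])], 31), ([(1, 0, [3, 1, 1])], 19),
    ([(1, 0, [2, 0, 1])], 37), ([(1, 0, [5, 1])], 11), ([(1, 0, [2, 3])], 41),
    ([(1, 0, [3, 1, 0])], 13), ([(1, 0, [2, 1, 1])], 47)]

def s2Density4 : Density where
  d := 4
  ρ := [([0, 0, 0, 1], [(1, 2)]), ([0, 0, 1, 1], [(1, 6)]), ([0, 0, 3], [(1, -3)]), ([0, 1, 1, 1],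
    [(1, 2)]), ([0, 1, 3], [(1, -6)]), ([0, 5], [(1, 2)])]
  σ := [([0, 0, 0, 0, 1], [(1, 4)]), ([0, 0, 0, 1, 1], [(1, 20)]), ([0, 0, 0, 3], [(1, -2)]),
    ([0, 0, 1, 1, 1], [(1, 20)]), ([0, 0, 1, 2], [(1, 6)]), ([0, 0, 1, 3], [(1, -12)]),
    ([0, 1, 1, 1, 1], [(1, 4)]), ([0, 1, 1, 2], [(1, 12)]), ([0, 1, 1, 3], [(1, -6)]), ([0, 2, 3],
    [(1, -2)]), ([0, 3, 3], [(1, 2)]), ([1, 1, 1, 2], [(1, 2)]), ([1, 2, 2], [(1, 2)]),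
    ([1, 2, 3], [(1, -2)])]
  l := [(67, [0, 2, 1]), (71, [0, 1, 0, 1]), (73, [0, 3, 1])]
  steps := [([(1, 1, [5, 3])], 29), ([(1, 0, [6, 0])], 43), ([(1, 0, [4, 3])], 67), ([(1, 0, [5, 3])],
    73), ([(1, 0, [3, 1, 0, 1])], 59), ([(1, 0, [1, 0, 1, 3])], 71), ([(1, 0, [3, 3, 1])], 0),
    ([(1, 0, [0, 2, 1, 1])], 0)]

def s2Densities : List Density :=
  [s2Density2, s2Density3, s2Density4]

def s2Solution : NC × NC × List Poly := (
  [([0, 2], [(53, -1), (61, 3), (3233, 1), (3721, -5/2), (226981, 1/2)]), ([0, 3], [(1, 2),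
  (61, -1)]), ([0, 1, 0], [(1, 2), (53, 2), (61, -2)]), ([0, 0, 1], [(1, -2), (53, -2), (61, 4),
  (3233, 1), (3721, -5/2), (226981, 1/2)]), ([1, 2], [(61, 1)]), ([1, 0, 0], [(61, -2),
  (3233, -1), (3721, 5/2), (226981, -1/2)]), ([4], [(1, 1)]), ([2, 0], [(1, 2), (53, 1), (61, -3),
  (3233, -1), (3721, 5/2), (226981, -1/2)]), ([2, 1], [(1, 2), (61, -1)]), ([3, 0], [(61, 1)])],
  [([0, 3], [(1, 2), (53, 1), (61, -3), (3233, -1), (3721, 5/2), (226981, -1/2)]), ([0, 1, 1],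
  [(1, 2), (53, 1), (61, -2)]), ([1, 2], [(53, -1), (61, 3), (3233, 1), (3721, -5/2),
  (226981, 1/2)]), ([1, 3], [(1, 2), (61, -1)]), ([1, 0, 1], [(1, -2), (53, -2), (61, 2)]),
  ([1, 1, 0], [(53, 1)]), ([5], [(1, -1)]), ([2, 1], [(1, 2), (53, 1), (61, -3), (3233, -1),
  (3721, 5/2), (226981, -1/2)]), ([3, 0], [(53, -1), (61, 3), (3233, 1), (3721, -5/2),
  (226981, 1/2)]), ([3, 1], [(61, 1)])], [[(53, 4), (61, -6), (2809, 2), (3233, -10), (3721, 11),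
  (171349, -2), (197213, 7), (226981, -6), (12029993, -1), (13845841, 1)], [(61, 2), (3721, -1)]])

theorem solution_s2 :
    solution (par s2.b₀ s2.l₀) (par s2.b₁ s2.l₁) (blocks s2Densities) [] = s2Solution := by
  decide +kernel

theorem check_s2 : checkAll s2 s2Densities = true := by
  decide +kernel

def s3 : System where
  b₀ := [([0, 3], [(1, 2)]), ([1, 2], [(1, 2)]), ([4], [(1, 1)])]
  b₁ := [([1, 3], [(1, 2)]), ([2], [(1, 2)]), ([5], [(1, -1)])]
  l₀ := [(5, [2, 1]), (7, [1, 0, 1]), (11, [1, 1, 0]), (13, [1, 3, 1]), (17, [3, 0]), (19, [3, 1, 1]),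
    (23, [5, 1])]
  l₁ := [(29, [1, 0]), (31, [3, 1])]
  g := (2, 1)
  k := (2, 1)
  bal := false

def s3Density3 : Density where
  d := 3
  ρ := [([0, 1], [(1, 1)])]
  σ := [([0, 0], [(1, 1)]), ([0, 1, 1], [(1, 2)]), ([0, 3], [(1, -1)]), ([1, 2], [(1, 1)])]
  l := []
  steps := [([(1, 0, [3, 1])], 17)]

def s3Density4 : Density where
  d := 4
  ρ := [([0, 0], [(1, -1)]), ([0, 1, 1], [(1, -1)]), ([0, 3], [(1, 1)])]
  σ := [([0, 0, 1], [(1, -4)]), ([0, 1, 1, 1], [(1, -2)]), ([0, 1, 3], [(1, 2)]), ([0, 2],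
    [(1, -2)]), ([1, 1, 2], [(1, -1)]), ([2, 3], [(1, 1)])]
  l := []
  steps := [([(1, 1, [7, 1])], 23), ([(1, 0, [1, 0, 1])], 7), ([(1, 0, [1, 3, 1])], 13),
    ([(1, 0, [3, 1, 1])], 11), ([(1, 0, [1, 2])], 5), ([(1, 0, [5, 1])], 29)]

def s3Density5 : Density where
  d := 5
  ρ := [([0, 0, 1], [(1, 3)]), ([0, 1, 1, 1], [(1, 1)]), ([0, 1, 3], [(1, -3)]), ([0, 5], [(1, 1)])]
  σ := [([0, 0, 0], [(1, 2)]), ([0, 0, 1, 1], [(1, 9)]), ([0, 0, 3], [(1, -3)]), ([0, 1, 1, 1, 1],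
    [(1, 2)]), ([0, 1, 1, 3], [(1, -3)]), ([0, 1, 2], [(1, 6)]), ([0, 3, 3], [(1, 1)]),
    ([1, 1, 1, 2], [(1, 1)]), ([1, 2, 3], [(1, -1)]), ([2, 2], [(1, 1)])]
  l := [(37, [0, 3, 1])]
  steps := [([(1, 0, [5, 1, 1])], 19), ([(1, 0, [2, 3])], 37), ([(1, 0, [1, 0, 3])], 0)]

def s3Densities : List Density :=
  [s3Density3, s3Density4, s3Density5]

def s3Solution : NC × NC × List Poly := (
  [([0, 3], [(1, 2), (31, -1)]), ([1, 2], [(31, 1)]), ([4], [(1, 1)]), ([2, 1], [(1, 2),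
  (31, -1)]), ([3, 0], [(31, 1)])], [([1, 3], [(1, 2), (31, -1)]), ([1, 0], [(1, -2), (31, 2)]),
  ([2], [(1, 2)]), ([5], [(1, -1)]), ([0, 1], [(1, 2), (31, -2)]), ([3, 1], [(31, 1)])],
  [[(31, -4), (961, 2)]])

theorem solution_s3 :
    solution (par s3.b₀ s3.l₀) (par s3.b₁ s3.l₁) (blocks s3Densities) [] = s3Solution := by
  decide +kernel

theorem check_s3 : checkAll s3 s3Densities = true := by
  decide +kernel

def s4 : System where
  b₀ := [([0, 2], [(1, 2)]), ([1, 2], [(1, 2)]), ([4], [(1, 1)])]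
  b₁ := [([0, 3], [(1, 2)]), ([1, 3], [(1, 2)]), ([5], [(1, -1)])]
  l₀ := [(5, [0, 1, 0]), (7, [2, 0]), (11, [2, 1]), (13, [1, 0, 0]), (17, [1, 0, 1]), (19, [1, 1, 0]),
    (23, [3, 0]), (29, [3, 1])]
  l₁ := [(31, [0, 1, 0]), (37, [2, 0]), (41, [2, 1]), (43, [1, 0, 0]), (47, [1, 0, 1]),
    (53, [1, 1, 0]), (59, [3, 0]), (61, [3, 1])]
  g := (1, 1)
  k := (1, 1)
  bal := false

def s4Density3 : Density where
  d := 3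
  ρ := [([0, 3], [(1, 1)])]
  σ := [([2, 3], [(1, 1)])]
  l := []
  steps := [([(1, 0, [1, 3, 1])], 17), ([(1, 0, [1, 1, 3])], 19), ([(1, 0, [0, 3, 0])], 31),
    ([(1, 0, [2, 0, 1])], 43), ([(1, 0, [1, 0, 3])], 5), ([(1, 0, [0, 1, 3])], 13),
    ([(1, 0, [1, 3, 0])], 47), ([(1, 0, [2, 3])], 7), ([(1, 0, [5, 1])], 11)]

def s4Density4 : Density where
  d := 4
  ρ := [([0, 0, 3], [(1, -1)]), ([0, 1, 3], [(1, -2)]), ([0, 5], [(1, 1)])]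
  σ := []
  l := [(67, [0, 2, 1]), (71, [0, 1, 0, 1]), (73, [0, 3, 1])]
  steps := [([(1, 1, [5, 3])], 29), ([(1, 0, [6, 0])], 37), ([(1, 0, [4, 3])], 67), ([(1, 0, [3, 5])],
    73), ([(1, 0, [1, 4, 1])], 71), ([(1, 0, [3, 2, 1])], 23)]

def s4Density5 : Density where
  d := 5
  ρ := [([0, 0, 0, 3], [(1, 2)]), ([0, 0, 1, 3], [(1, 6)]), ([0, 0, 5], [(1, -3)]), ([0, 1, 1, 3],
    [(1, 6)]), ([0, 1, 5], [(1, -6)]), ([0, 3, 3], [(1, -6)]), ([0, 7], [(1, 2)])]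
  σ := [([0, 0, 2, 3], [(1, -6)]), ([0, 1, 2, 3], [(1, -12)]), ([0, 2, 5], [(1, 4)]), ([0, 3, 4],
    [(1, -4)]), ([1, 1, 2, 3], [(1, -6)]), ([1, 2, 5], [(1, 4)]), ([1, 3, 4], [(1, -4)]),
    ([2, 2, 3], [(1, 2)]), ([2, 3, 3], [(1, -2)]), ([4, 5], [(1, 2)])]
  l := [(79, [0, 0, 2, 1]), (83, [0, 0, 1, 0, 1]), (89, [0, 0, 3, 1]), (97, [0, 2, 0, 1]),
    (101, [0, 2, 1, 1]), (103, [0, 4, 1]), (107, [0, 1, 0, 1, 1]), (109, [0, 1, 0, 3]),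
    (113, [0, 1, 2, 1]), (127, [0, 1, 3, 1]), (131, [0, 3, 2]), (137, [0, 3, 1, 1]),
    (139, [0, 5, 1]), (149, [2, 1, 3])]
  steps := [([(1, 0, [1, 0, 1, 0, 3])], 83), ([(1, 0, [0, 6, 1])], 79), ([(1, 0, [6, 1, 1])], 101),
    ([(1, 0, [7, 2])], 103), ([(1, 1, [0, 0, 7])], 89), ([(1, 0, [0, 4, 1, 1])], 107),
    ([(1, 0, [4, 0, 1, 0])], 97), ([(1, 0, [4, 1, 0, 1])], 53), ([(1, 0, [5, 3, 0])], 109),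
    ([(1, 0, [0, 3, 5])], 59), ([(1, 0, [2, 0, 5])], 0), ([(1, 0, [4, 2, 1])], 0)]

def s4Densities : List Density :=
  [s4Density3, s4Density4, s4Density5]

def s4Solution : NC × NC × List Poly := (
  [([0, 2], [(61, 1)]), ([0, 1, 0], [(41, 2), (2501, -2)]), ([0, 0, 1], [(41, -1), (2501, 1)]),
  ([0, 3], [(41, 1)]), ([1, 2], [(61, 1)]), ([1, 0, 0], [(41, -1), (2501, 1)]), ([4], [(1, 1)]),
  ([2, 0], [(1, 2), (61, -1)]), ([2, 1], [(1, 2), (61, -1)]), ([3, 0], [(41, -1)])], [([0, 3],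
  [(1, 2), (61, -1)]), ([0, 1, 1], [(41, 1), (2501, -1)]), ([1, 3], [(1, 2), (61, -1)]), ([1, 2],
  [(41, -1)]), ([1, 0, 1], [(41, -2), (2501, 2)]), ([1, 1, 0], [(41, 1), (2501, -1)]), ([5],
  [(1, -1)]), ([2, 1], [(41, 1)]), ([3, 0], [(61, 1)]), ([3, 1], [(61, 1)])], [[(41, 2),
  (1681, -1), (2501, -2)], [(61, 2), (3721, -1)]])

theorem solution_s4 :
    solution (par s4.b₀ s4.l₀) (par s4.b₁ s4.l₁) (blocks s4Densities) [] = s4Solution := by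
  decide +kernel

theorem check_s4 : checkAll s4 s4Densities = true := by
  decide +kernel

def b1 : System where
  b₀ := [([0, 0], [(1, 1)]), ([0, 1], [(1, 2)]), ([1, 1], [(1, 1)]), ([4], [(1, 1)])]
  b₁ := [([0, 0], [(1, -1)]), ([0, 1], [(1, -2)]), ([1, 1], [(1, -1)]), ([5], [(1, -1)])]
  l₀ := [(5, [1, 0])]
  l₁ := [(7, [1, 0])]
  g := (2, 2)
  k := (2, 2)
  bal := false

def b1Density5 : Density where
  d := 5
  ρ := [([0, 3], [(1, 1)])]
  σ := [([0, 0, 0], [(1, 1/3)]), ([0, 0, 1], [(1, 1)]), ([0, 1, 1], [(1, 1)]), ([1, 1, 1],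
    [(1, 1/3)]), ([2, 3], [(1, 1)])]
  l := []
  steps := [([(1, 0, [1, 3])], 5), ([(1, 0, [0, 3])], 7)]

def b1Density8 : Density where
  d := 8
  ρ := [([0, 0, 0, 0], [(1, 2)]), ([0, 0, 0, 1], [(1, 8)]), ([0, 0, 1, 1], [(1, 12)]), ([0, 0, 4],
    [(1, 3)]), ([0, 0, 5], [(1, 9)]), ([0, 1, 1, 1], [(1, 8)]), ([0, 1, 4], [(1, 6)]), ([0, 1, 5],
    [(1, 24)]), ([0, 3, 3], [(1, 18)]), ([0, 9], [(1, 6)]), ([1, 1, 1, 1], [(1, 2)]), ([1, 1, 5],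
    [(1, 3)])]
  σ := [([0, 0, 0, 2], [(1, -4)]), ([0, 0, 0, 3], [(1, 4)]), ([0, 0, 1, 2], [(1, -12)]),
    ([0, 0, 1, 3], [(1, 12)]), ([0, 0, 6], [(1, -6)]), ([0, 0, 7], [(1, 6)]), ([0, 1, 1, 2],
    [(1, -12)]), ([0, 1, 1, 3], [(1, 12)]), ([0, 1, 6], [(1, -12)]), ([0, 1, 7], [(1, 12)]),
    ([0, 2, 4], [(1, 12)]), ([0, 2, 5], [(1, -12)]), ([0, 3, 4], [(1, 12)]), ([0, 3, 5],
    [(1, -12)]), ([1, 1, 1, 2], [(1, -4)]), ([1, 1, 1, 3], [(1, 4)]), ([1, 1, 6], [(1, -6)]),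
    ([1, 1, 7], [(1, 6)]), ([1, 2, 4], [(1, 12)]), ([1, 2, 5], [(1, -12)]), ([1, 3, 4],
    [(1, 12)]), ([1, 3, 5], [(1, -12)]), ([2, 2, 2], [(1, -2)]), ([2, 2, 3], [(1, -6)]),
    ([2, 3, 3], [(1, 6)]), ([3, 3, 3], [(1, 2)]), ([4, 7], [(1, 6)]), ([5, 6], [(1, -6)])]
  l := [(11, [0, 4, 1]), (13, [0, 1, 0, 1]), (17, [0, 3, 2]), (19, [0, 5, 1]), (23, [2, 1, 3])]
  steps := [([(1, 0, [6, 3])], 11), ([(1, 0, [7, 3])], 19), ([(1, 0, [3, 3, 1])], 0)]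

def b1Densities : List Density :=
  [b1Density5, b1Density8]

/-- Elimination leaves the contradictory equation $4=0$. -/
def b1Solution : NC × NC × List Poly := (
  [([0, 0], [(1, 1)]), ([0, 1], [(1, 1)]), ([1, 1], [(1, 1)]), ([1, 0], [(1, 1)]), ([4],
  [(1, 1)])], [([0, 0], [(1, -1)]), ([0, 1], [(1, -1)]), ([1, 1], [(1, -1)]), ([1, 0], [(1, -1)]),
  ([5], [(1, -1)])], [[(1, 4)]])

theorem solution_b1 :
    solution (par b1.b₀ b1.l₀) (par b1.b₁ b1.l₁) (blocks b1Densities) [] = b1Solution := by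
  decide +kernel

theorem check_b1 : checkAll b1 b1Densities = true := by
  decide +kernel

def b2 : System where
  b₀ := [([1, 3], [(1, 2)]), ([4], [(1, 1)])]
  b₁ := [([2], [(1, 1)]), ([5], [(1, -1)])]
  l₀ := [(5, [1, 0]), (7, [3, 1])]
  l₁ := []
  g := (3, 2)
  k := (3, 2)
  bal := false

def b2Density6 : Density where
  d := 6
  ρ := [([0, 0], [(1, 3)]), ([0, 3], [(1, -6)]), ([1, 1, 1], [(1, 2)])]
  σ := [([0, 1, 1], [(1, 6)]), ([0, 2], [(1, 6)]), ([1, 1, 3], [(1, -6)]), ([2, 3], [(1, -6)])]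
  l := []
  steps := [([(1, 0, [1, 3])], 5)]

def b2Density8 : Density where
  d := 8
  ρ := [([0, 0, 1], [(1, 3)]), ([0, 1, 3], [(1, -6)]), ([0, 4], [(1, 3)]), ([0, 7], [(1, -6)]),
    ([1, 1, 1, 1], [(1, 1)]), ([1, 1, 5], [(1, 3)])]
  σ := [([0, 0, 0], [(1, 1)]), ([0, 0, 3], [(1, -3)]), ([0, 1, 1, 1], [(1, 4)]), ([0, 1, 2],
    [(1, 6)]), ([1, 1, 1, 3], [(1, -4)]), ([1, 2, 3], [(1, 6)]), ([1, 3, 5], [(1, -12)]), ([2, 4],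
    [(1, 6)]), ([3, 3, 3], [(1, 2)]), ([4, 5], [(1, -6)])]
  l := [(11, [0, 3, 1])]
  steps := [([(1, 0, [2, 3])], 11), ([(1, 0, [1, 1, 3])], 0)]

def b2Densities : List Density :=
  [b2Density6, b2Density8]

def b2Solution : NC × NC × List Poly := (
  [([1, 3], [(1, 2), (7, -1)]), ([1, 0], [(1, -1), (7, 1)]), ([4], [(1, 1)]), ([0, 1], [(1, 1),
  (7, -1)]), ([3, 1], [(7, 1)])], [([2], [(1, 1)]), ([5], [(1, -1)])], [[(1, -4), (7, 6),
  (49, -3)]])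

theorem solution_b2 :
    solution (par b2.b₀ b2.l₀) (par b2.b₁ b2.l₁) (blocks b2Densities) [] = b2Solution := by
  decide +kernel

theorem check_b2 : checkAll b2 b2Densities = true := by
  decide +kernel

def b3 : System where
  b₀ := [([0, 0, 0], [(1, -6)]), ([0, 0, 1], [(1, -18)]), ([0, 1, 1], [(1, -18)]), ([0, 3], [(1, 6)]),
    ([1, 1, 1], [(1, -6)]), ([1, 3], [(1, 6)]), ([4], [(1, 1)])]
  b₁ := [([0, 0, 0], [(1, 6)]), ([0, 0, 1], [(1, 18)]), ([0, 1, 1], [(1, 18)]), ([0, 2], [(1, 6)]),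
    ([1, 1, 1], [(1, 6)]), ([1, 2], [(1, 6)]), ([5], [(1, -1)])]
  l₀ := [(5, [0, 1, 0]), (7, [2, 0]), (11, [2, 1]), (13, [1, 0, 0]), (17, [1, 0, 1]), (19, [1, 1, 0]),
    (23, [3, 0]), (29, [3, 1])]
  l₁ := [(31, [0, 1, 0]), (37, [2, 0]), (41, [2, 1]), (43, [1, 0, 0]), (47, [1, 0, 1]),
    (53, [1, 1, 0]), (59, [3, 0]), (61, [3, 1])]
  g := (1, 1)
  k := (1, 1)
  bal := false

def b3Density3 : Density where
  d := 3
  ρ := [([0, 0, 0], [(1, 1)]), ([0, 0, 1], [(1, 3)]), ([0, 1, 1], [(1, 3)]), ([0, 3], [(1, -1)]),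
    ([1, 1, 1], [(1, 1)])]
  σ := [([0, 0, 0, 0], [(1, 6)]), ([0, 0, 0, 1], [(1, 24)]), ([0, 0, 1, 1], [(1, 36)]), ([0, 0, 2],
    [(1, 3)]), ([0, 0, 3], [(1, -3)]), ([0, 1, 1, 1], [(1, 24)]), ([0, 1, 2], [(1, 6)]),
    ([0, 1, 3], [(1, -6)]), ([1, 1, 1, 1], [(1, 6)]), ([1, 1, 2], [(1, 3)]), ([1, 1, 3],
    [(1, -3)]), ([2, 3], [(1, -1)])]
  l := []
  steps := [([(1, 0, [2, 3])], 7), ([(1, 0, [1, 5])], 11), ([(1, 0, [1, 0, 3])], 5),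
    ([(1, 0, [1, 3, 1])], 17), ([(1, 0, [0, 3, 0])], 31), ([(1, 0, [3, 1, 1])], 19),
    ([(1, 0, [0, 0, 3])], 37), ([(1, 0, [1, 1, 2])], 43), ([(1, 0, [0, 3, 1])], 13)]

def b3Density5 : Density where
  d := 5
  ρ := [([0, 0, 0, 3], [(1, 6)]), ([0, 0, 1, 3], [(1, 18)]), ([0, 0, 4], [(1, 3)]), ([0, 1, 1, 3],
    [(1, 18)]), ([0, 1, 4], [(1, 6)]), ([0, 1, 5], [(1, 6)]), ([0, 7], [(1, -2)]), ([1, 1, 5],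
    [(1, 3)])]
  σ := [([0, 0, 0, 0, 0, 0], [(1, -18)]), ([0, 0, 0, 0, 0, 1], [(1, -108)]), ([0, 0, 0, 0, 1, 1],
    [(1, -270)]), ([0, 0, 0, 0, 2], [(1, -36)]), ([0, 0, 0, 0, 3], [(1, 36)]),
    ([0, 0, 0, 1, 1, 1], [(1, -360)]), ([0, 0, 0, 1, 2], [(1, -144)]), ([0, 0, 0, 1, 3],
    [(1, 144)]), ([0, 0, 0, 4], [(1, 12)]), ([0, 0, 0, 5], [(1, 12)]), ([0, 0, 1, 1, 1, 1],
    [(1, -270)]), ([0, 0, 1, 1, 2], [(1, -216)]), ([0, 0, 1, 1, 3], [(1, 216)]), ([0, 0, 1, 4],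
    [(1, 36)]), ([0, 0, 1, 5], [(1, 36)]), ([0, 0, 2, 3], [(1, 54)]), ([0, 1, 1, 1, 1, 1],
    [(1, -108)]), ([0, 1, 1, 1, 2], [(1, -144)]), ([0, 1, 1, 1, 3], [(1, 144)]), ([0, 1, 1, 4],
    [(1, 36)]), ([0, 1, 1, 5], [(1, 36)]), ([0, 1, 2, 3], [(1, 108)]), ([0, 2, 4], [(1, 12)]),
    ([0, 3, 5], [(1, -12)]), ([1, 1, 1, 1, 1, 1], [(1, -18)]), ([1, 1, 1, 1, 2], [(1, -36)]),
    ([1, 1, 1, 1, 3], [(1, 36)]), ([1, 1, 1, 4], [(1, 12)]), ([1, 1, 1, 5], [(1, 12)]),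
    ([1, 1, 2, 3], [(1, 54)]), ([1, 2, 4], [(1, 12)]), ([1, 3, 5], [(1, -12)]), ([2, 2, 2],
    [(1, -2)]), ([3, 3, 3], [(1, 2)]), ([4, 5], [(1, -2)])]
  l := [(67, [0, 0, 2, 1]), (71, [0, 0, 1, 0, 1]), (73, [0, 0, 3, 1]), (79, [0, 2, 0, 1]),
    (83, [0, 2, 1, 1]), (89, [0, 4, 1]), (97, [0, 1, 0, 1, 1]), (101, [0, 1, 0, 3]),
    (103, [0, 1, 2, 1]), (107, [0, 1, 3, 1]), (109, [0, 3, 2]), (113, [0, 3, 1, 1]),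
    (127, [0, 5, 1]), (131, [2, 1, 3])]
  steps := [([(1, 0, [0, 0, 0, 1, 0, 1])], 71), ([(1, 0, [1, 0, 1, 0, 3])], 79), ([(1, 0, [3, 7])], 127),
    ([(1, 1, [5, 3, 1])], 23), ([(1, 0, [1, 1, 7])], 29), ([(1, 0, [6, 3])], 89),
    ([(1, 0, [6, 0, 0])], 47), ([(1, 0, [6, 1, 1])], 83), ([(1, 0, [0, 6, 1])], 67),
    ([(1, 1, [0, 0, 7])], 73), ([(1, 1, [0, 7, 1])], 107), ([(1, 0, [1, 1, 3, 1, 1])], 97),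
    ([(1, 0, [0, 0, 5, 1])], 53), ([(1, 0, [5, 1, 1, 1])], 59), ([(1, 0, [3, 0, 0, 3])], 113),
    ([(1, 0, [1, 3, 5])], 0), ([(1, 0, [4, 2, 1])], 0)]

def b3Densities : List Density :=
  [b3Density3, b3Density5]

def b3Solution : NC × NC × List Poly := (
  [([0, 0, 0], [(1, -6)]), ([0, 0, 1], [(1, -6), (2501, 1)]), ([0, 1, 1], [(1, -6), (61, 3)]),
  ([0, 1, 0], [(1, -6), (61, 6), (2501, -2)]), ([0, 3], [(41, 1)]), ([0, 2], [(61, 1)]),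
  ([1, 1, 1], [(1, -6)]), ([1, 1, 0], [(1, -6), (61, -3)]), ([1, 3], [(41, 1), (61, 1)]), ([1, 2],
  [(61, 1)]), ([1, 0, 0], [(1, -6), (61, -6), (2501, 1)]), ([1, 0, 1], [(1, -6)]), ([4],
  [(1, 1)]), ([2, 0], [(61, -1)]), ([2, 1], [(61, -1)]), ([3, 0], [(1, 6), (41, -1)]), ([3, 1],
  [(1, 6), (41, -1), (61, -1)])], [([0, 0, 0], [(1, 6)]), ([0, 0, 1], [(1, 6), (61, -3)]),
  ([0, 1, 1], [(1, 6), (2501, -1)]), ([0, 1, 0], [(1, 6)]), ([0, 2], [(1, 6), (41, -1),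
  (61, -1)]), ([0, 3], [(61, -1)]), ([1, 1, 1], [(1, 6)]), ([1, 1, 0], [(1, 6), (61, 6),
  (2501, -1)]), ([1, 2], [(1, 6), (41, -1)]), ([1, 0, 0], [(1, 6), (61, 3)]), ([1, 0, 1], [(1, 6),
  (61, -6), (2501, 2)]), ([1, 3], [(61, -1)]), ([5], [(1, -1)]), ([2, 0], [(41, 1), (61, 1)]),
  ([2, 1], [(41, 1)]), ([3, 0], [(61, 1)]), ([3, 1], [(61, 1)])], [[(61, -6), (2501, 2),
  (3721, 1)], [(1, 12), (41, -6), (1681, 1)]])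

theorem solution_b3 :
    solution (par b3.b₀ b3.l₀) (par b3.b₁ b3.l₁) (blocks b3Densities) [] = b3Solution := by
  decide +kernel

theorem check_b3 : checkAll b3 b3Densities = true := by
  decide +kernel

def b4 : System where
  b₀ := [([1, 3], [(1, 2)]), ([4], [(1, 1)])]
  b₁ := [([0, 2], [(1, 2)]), ([5], [(1, -1)])]
  l₀ := [(5, [0, 1, 0]), (7, [2, 0]), (11, [2, 1]), (13, [1, 0, 0]), (17, [1, 0, 1]), (19, [1, 1, 0]),
    (23, [3, 0]), (29, [3, 1])]
  l₁ := [(31, [0, 1, 0]), (37, [2, 0]), (41, [2, 1]), (43, [1, 0, 0]), (47, [1, 0, 1]),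
    (53, [1, 1, 0]), (59, [3, 0]), (61, [3, 1])]
  g := (1, 1)
  k := (1, 1)
  bal := false

def b4Density2 : Density where
  d := 2
  ρ := [([0, 1], [(1, 1)])]
  σ := [([0, 0, 0], [(1, 2/3)]), ([0, 3], [(1, -1)]), ([1, 1, 1], [(1, 2/3)]), ([1, 2], [(1, 1)])]
  l := []
  steps := [([(1, 0, [1, 2])], 7), ([(1, 0, [1, 3])], 23), ([(1, 0, [1, 0, 1])], 5)]

def b4Density3 : Density where
  d := 3
  ρ := [([0, 0, 0], [(1, 1)]), ([0, 3], [(1, -3)]), ([1, 1, 1], [(1, 1)])]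
  σ := [([0, 0, 1, 1], [(1, 3)]), ([0, 0, 2], [(1, 3)]), ([1, 1, 3], [(1, -3)]), ([2, 3], [(1, -3)])]
  l := []
  steps := [([(1, 0, [1, 3, 1])], 17), ([(1, 0, [0, 3, 0])], 31), ([(1, 0, [1, 5])], 11),
    ([(1, 0, [3, 2])], 41), ([(1, 0, [1, 1, 3])], 19), ([(1, 0, [0, 2, 1])], 43),
    ([(1, 1, [0, 0, 3])], 13), ([(1, 0, [0, 1, 3])], 37)]

def b4Density5 : Density where
  d := 5
  ρ := [([0, 0, 0, 0, 1], [(1, 2)]), ([0, 0, 1, 3], [(1, -6)]), ([0, 0, 4], [(1, 3)]),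
    ([0, 1, 1, 1, 1], [(1, 2)]), ([0, 7], [(1, -6)]), ([1, 1, 5], [(1, 3)])]
  σ := [([0, 0, 0, 0, 0, 0], [(1, 2/3)]), ([0, 0, 0, 0, 3], [(1, -2)]), ([0, 0, 0, 1, 1, 1],
    [(1, 16/3)]), ([0, 0, 0, 1, 2], [(1, 8)]), ([0, 1, 1, 1, 3], [(1, -8)]), ([0, 1, 2, 3],
    [(1, 12)]), ([0, 2, 4], [(1, 12)]), ([1, 1, 1, 1, 1, 1], [(1, 2/3)]), ([1, 1, 1, 1, 2],
    [(1, 2)]), ([1, 3, 5], [(1, -12)]), ([2, 2, 2], [(1, -2)]), ([3, 3, 3], [(1, 2)]), ([4, 5],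
    [(1, -6)])]
  l := [(67, [0, 0, 2, 1]), (71, [0, 0, 1, 0, 1]), (73, [0, 0, 3, 1]), (79, [0, 2, 0, 1]),
    (83, [0, 2, 1, 1]), (89, [0, 4, 1]), (97, [0, 1, 0, 1, 1]), (101, [0, 1, 0, 3]),
    (103, [0, 1, 2, 1]), (107, [0, 1, 3, 1]), (109, [0, 3, 2]), (113, [0, 3, 1, 1]),
    (127, [0, 5, 1]), (131, [2, 1, 3])]
  steps := [([(1, 0, [7, 2])], 89), ([(1, 0, [7, 3])], 127), ([(1, 0, [0, 6, 1])], 67),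
    ([(1, 1, [0, 0, 7])], 73), ([(1, 1, [0, 7, 1])], 107), ([(1, 0, [6, 1, 1])], 83),
    ([(1, 0, [4, 0, 3])], 79), ([(1, 0, [3, 5, 1])], 113), ([(1, 0, [4, 1, 0, 1])], 71),
    ([(1, 0, [1, 4, 1, 1])], 97), ([(1, 0, [4, 1, 3])], 101), ([(1, 0, [3, 3, 1, 1])], 53),
    ([(1, 0, [1, 1, 3, 3])], 47), ([(1, 0, [3, 2, 1, 1])], 61), ([(1, 0, [5, 1, 1, 1])], 0),
    ([(1, 1, [0, 3, 2, 0])], 0)]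

def b4Densities : List Density :=
  [b4Density2, b4Density3, b4Density5]

def b4Solution : NC × NC × List Poly := (
  [([1, 3], [(1, 2), (29, -1)]), ([1, 2], [(3481, -3/2), (100949, 3/2)]), ([1, 0, 0], [(1, -4/3),
  (29, 1), (205379, 3/2), (5955991, -3/2)]), ([1, 1, 0], [(59, -1)]), ([4], [(1, 1)]), ([0, 1, 0],
  [(1, 2/3), (205379, -3), (5955991, 3)]), ([0, 1, 1], [(59, 1)]), ([0, 0, 1], [(1, 2/3),
  (29, -1), (205379, 3/2), (5955991, -3/2)]), ([0, 2], [(59, 1)]), ([0, 3], [(3481, 3/2),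
  (100949, -3/2)]), ([2, 0], [(59, -1)]), ([2, 1], [(3481, 3/2), (100949, -3/2)]), ([3, 0],
  [(3481, -3/2), (100949, 3/2)]), ([3, 1], [(29, 1)])], [([0, 2], [(29, 1)]), ([0, 1, 1],
  [(1, -2/3), (29, 1), (205379, -3/2), (5955991, 3/2)]), ([0, 0, 1], [(3481, 3/2),
  (100949, -3/2)]), ([0, 3], [(59, -1)]), ([5], [(1, -1)]), ([2, 0], [(1, 2), (29, -1)]), ([2, 1],
  [(59, -1)]), ([1, 2], [(59, 1)]), ([1, 0, 0], [(3481, -3/2), (100949, 3/2)]), ([1, 0, 1],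
  [(1, -2/3), (205379, 3), (5955991, -3)]), ([1, 1, 0], [(1, 4/3), (29, -1), (205379, -3/2),
  (5955991, 3/2)]), ([1, 3], [(3481, 3/2), (100949, -3/2)]), ([3, 0], [(59, 1)]), ([3, 1],
  [(3481, -3/2), (100949, 3/2)])], [[(59, 8), (12117361, -9), (351403469, 9)], [(1, 8), (29, -12),
  (841, 6)]])

theorem solution_b4 :
    solution (par b4.b₀ b4.l₀) (par b4.b₁ b4.l₁) (blocks b4Densities) [] = b4Solution := by
  decide +kernel

theorem check_b4 : checkAll b4 b4Densities = true := by
  decide +kernel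

/-! ### Scaling -/

/-- The substitution of `κ⁻¹ u`, `κ⁻¹ v` for `u`, `v`. -/
def fscale (κ : Fin 2 → ℂ) : Free →ₐ[ℂ] Free :=
  FreeAlgebra.lift ℂ fun x : Jet => (κ x.1)⁻¹ • FreeAlgebra.ι ℂ x

theorem rescale_apply (κ : Fin 2 → ℂ) (F : FreeSystem) (s : Fin 2) :
    rescale κ F s = κ s • fscale κ (F s) := rfl

def cscale (κ : Fin 2 → ℂ) : Comm →ₐ[ℂ] Comm :=
  MvPolynomial.aeval fun x : Jet => (κ x.1)⁻¹ • MvPolynomial.X x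

/-- The commutative version of `rescale`. -/
def crescale (κ : Fin 2 → ℂ) (f : CommSystem) : CommSystem := fun s => κ s • cscale κ (f s)

section

variable (κ : Fin 2 → ℂ)

@[simp] theorem fscale_ι (x : Jet) :
    fscale κ (FreeAlgebra.ι ℂ x) = (κ x.1)⁻¹ • FreeAlgebra.ι ℂ x := by
  simp [fscale]

theorem fscale_gen (a : ℕ) : fscale κ (gen a) = (κ (letter a).1)⁻¹ • gen a := by
  simp [gen]

@[simp] theorem cscale_X (x : Jet) :
    cscale κ (MvPolynomial.X x) = (κ x.1)⁻¹ • MvPolynomial.X x := by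
  simp [cscale]

theorem abelianize_fscale (a : Free) :
    abelianize (fscale κ a) = cscale κ (abelianize a) := by
  have : abelianize.comp (fscale κ) = (cscale κ).comp abelianize := by
    ext x
    simp [abelianize]
  exact congrArg (fun φ : Free →ₐ[ℂ] Comm => φ a) this

theorem fscale_fscale (κ' : Fin 2 → ℂ) (a : Free) :
    fscale κ (fscale κ' a) = fscale (fun s => κ s * κ' s) a := by
  have : (fscale κ).comp (fscale κ') = fscale fun s => κ s * κ' s := by
    ext x
    simp [smul_smul, mul_comm]
  exact congrArg (fun φ : Free →ₐ[ℂ] Free => φ a) this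

theorem cscale_cscale (κ' : Fin 2 → ℂ) (a : Comm) :
    cscale κ (cscale κ' a) = cscale (fun s => κ s * κ' s) a := by
  have : (cscale κ).comp (cscale κ') = cscale fun s => κ s * κ' s := by
    ext x : 1
    simp [smul_smul, mul_comm]
  exact congrArg (fun φ : Comm →ₐ[ℂ] Comm => φ a) this

theorem cscale_one (a : Comm) : cscale (fun _ => 1) a = a := by
  have : cscale (fun _ => 1) = AlgHom.id ℂ Comm := by
    ext x : 1
    simp
  rw [this, AlgHom.id_apply]

theorem fD_fscale (a : Free) : fD (fscale κ a) = fscale κ (fD a) := by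
  induction a using word_induction with
  | hadd x y hx hy => simp only [map_add, hx, hy]
  | hsmul c x hx => simp only [map_smul, hx]
  | hW w =>
    induction w with
    | nil => simp [fD, der_one]
    | cons a w ih =>
      rw [W_cons, map_mul, fD_mul, fD_mul, map_add, map_mul, map_mul, ih, fscale_gen, map_smul,
        fD_gen, fscale_gen]
      simp [letter]

theorem fD_iterate_fscale (n : ℕ) (a : Free) : fD^[n] (fscale κ a) = fscale κ (fD^[n] a) := by
  induction n with
  | zero => rfl
  | succ n ih => rw [Function.iterate_succ_apply', ih, fD_fscale, Function.iterate_succ_apply']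

theorem cD_cscale (a : Comm) : cD (cscale κ a) = cscale κ (cD a) := by
  induction a using MvPolynomial.induction_on with
  | C r => simp [cscale, MvPolynomial.algebraMap_eq]
  | add p q hp hq => simp only [map_add, hp, hq]
  | mul_X p x hp =>
    simp only [map_mul, Derivation.leibniz, hp, cscale_X, smul_eq_mul, Derivation.map_smul,
      map_add]
    simp [cD, MvPolynomial.mkDerivation_X]

theorem cD_iterate_cscale (n : ℕ) (a : Comm) : cD^[n] (cscale κ a) = cscale κ (cD^[n] a) := by
  induction n with
  | zero => rfl
  | succ n ih => rw [Function.iterate_succ_apply', ih, cD_cscale, Function.iterate_succ_apply']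

theorem fD_iterate_smul (n : ℕ) (c : ℂ) (a : Free) : fD^[n] (c • a) = c • fD^[n] a := by
  rw [← Module.End.pow_apply, ← Module.End.pow_apply, map_smul]

theorem cD_iterate_smul (n : ℕ) (c : ℂ) (a : Comm) : cD^[n] (c • a) = c • cD^[n] a := by
  induction n with
  | zero => rfl
  | succ n ih =>
    rw [Function.iterate_succ_apply', ih, Derivation.map_smul, Function.iterate_succ_apply']

variable {κ}

/-- Scaling conjugates the two flows. The factor `κ s` in `rescale` cancels the inverse factor that
the substitution gives to a generator. -/
theorem fDt_fscale (hκ : ∀ s, κ s ≠ 0) (F : FreeSystem) (a : Free) :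
    fDt (rescale κ F) (fscale κ a) = fscale κ (fDt F a) := by
  induction a using word_induction with
  | hadd x y hx hy => simp only [map_add, hx, hy]
  | hsmul c x hx => simp only [map_smul, hx]
  | hW w =>
    induction w with
    | nil => simp [fDt, der_one]
    | cons a w ih =>
      have : fDt (rescale κ F) (fscale κ (gen a)) = fscale κ (fDt F (gen a)) := by
        rw [fscale_gen, map_smul, fDt, fDt, gen, der_ι, der_ι, rescale_apply, fD_iterate_smul,
          fD_iterate_fscale, inv_smul_smul₀ (hκ _)]
      rw [W_cons, map_mul, fDt_mul, fDt_mul, map_add, map_mul, map_mul, ih, this]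

theorem cDt_cscale (hκ : ∀ s, κ s ≠ 0) (f : CommSystem) (a : Comm) :
    cDt (crescale κ f) (cscale κ a) = cscale κ (cDt f a) := by
  induction a using MvPolynomial.induction_on with
  | C r => simp [cscale, MvPolynomial.algebraMap_eq]
  | add p q hp hq => simp only [map_add, hp, hq]
  | mul_X p x hp =>
    simp only [map_mul, Derivation.leibniz, hp, cscale_X, smul_eq_mul, Derivation.map_smul,
      map_add]
    rw [cDt, cDt, MvPolynomial.mkDerivation_X, MvPolynomial.mkDerivation_X, crescale,
      cD_iterate_smul, cD_iterate_cscale, inv_smul_smul₀ (hκ _)]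

theorem fscale_mem_trivialDensities {a : Free} (ha : a ∈ trivialDensities) :
    fscale κ a ∈ trivialDensities := by
  have : trivialDensities ≤ trivialDensities.comap (fscale κ).toLinearMap := by
    refine sup_le (Submodule.span_le.2 ?_) ?_
    · rintro _ ⟨a, b, rfl⟩
      refine Submodule.mem_sup_left (Submodule.subset_span ⟨fscale κ a, fscale κ b, ?_⟩)
      simp [Ring.lie_def]
    · rintro _ ⟨a, rfl⟩
      exact Submodule.mem_sup_right ⟨fscale κ a, fD_fscale κ a⟩
  exact this ha

theorem fscale_mem_freeHomogeneous {ν : Fin 2 → ℝ} {d : ℝ} {a : Free}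
    (ha : a ∈ freeHomogeneous ν d) : fscale κ a ∈ freeHomogeneous ν d := by
  have : freeHomogeneous ν d ≤ (freeHomogeneous ν d).comap (fscale κ).toLinearMap := by
    refine Submodule.span_le.2 ?_
    rintro _ ⟨l, hl, rfl⟩
    have key : ∀ l : List Jet, fscale κ (l.map (FreeAlgebra.ι ℂ)).prod =
        (l.map fun x => (κ x.1)⁻¹).prod • (l.map (FreeAlgebra.ι ℂ)).prod := by
      intro l
      induction l with
      | nil => simp
      | cons x l ih => simp [ih, smul_smul, mul_comm]
    change fscale κ _ ∈ freeHomogeneous ν d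
    rw [key]
    exact Submodule.smul_mem _ _ (Submodule.subset_span ⟨l, hl, rfl⟩)
  exact this ha

theorem isWeightedHomogeneous_cscale {ν : Fin 2 → ℝ} {d : ℝ} {a : Comm}
    (ha : MvPolynomial.IsWeightedHomogeneous (jetWeight ν) a d) :
    MvPolynomial.IsWeightedHomogeneous (jetWeight ν) (cscale κ a) d := by
  have key : ∀ m : Jet →₀ ℕ, ∃ c : ℂ, ∀ r, cscale κ (MvPolynomial.monomial m r) =
      MvPolynomial.monomial m (c * r) := by
    intro m
    refine ⟨m.prod fun x k => (κ x.1)⁻¹ ^ k, fun r => ?_⟩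
    rw [cscale, MvPolynomial.aeval_monomial, MvPolynomial.monomial_eq, MvPolynomial.algebraMap_eq]
    simp only [MvPolynomial.smul_eq_C_mul, mul_pow, Finsupp.prod_mul, map_mul]
    rw [Finsupp.prod, Finsupp.prod, Finsupp.prod, map_prod]
    simp only [map_pow]
    ring
  choose c hc using key
  have hcoeff : ∀ (p : Comm) m, (cscale κ p).coeff m = c m * p.coeff m := by
    intro p m
    induction p using MvPolynomial.induction_on' with
    | monomial m' r =>
      rw [hc, MvPolynomial.coeff_monomial, MvPolynomial.coeff_monomial]
      split_ifs with h
      · rw [h]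
      · simp
    | add p q hp hq => rw [map_add, MvPolynomial.coeff_add, hp, hq, MvPolynomial.coeff_add, mul_add]
  intro m hm
  rw [hcoeff] at hm
  exact ha (right_ne_zero_of_mul hm)

theorem isCommHomogeneous_crescale {f : CommSystem} {μ : ℝ} {ν : Fin 2 → ℝ}
    (hf : IsCommHomogeneous f μ ν) : IsCommHomogeneous (crescale κ f) μ ν := fun s => by
  rw [crescale, MvPolynomial.smul_eq_C_mul]
  simpa using (MvPolynomial.isWeightedHomogeneous_C (jetWeight ν) (κ s)).mul
    (isWeightedHomogeneous_cscale (κ := κ) (hf s))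

theorem IsCommDensity.cscale {f : CommSystem} {ρ : Comm} (hκ : ∀ s, κ s ≠ 0)
    (hρ : IsCommDensity f ρ) : IsCommDensity (crescale κ f) (cscale κ ρ) := by
  obtain ⟨σ, hσ⟩ := hρ
  exact ⟨NonAbelian.cscale κ σ, by rw [cDt_cscale hκ, hσ, cD_cscale]⟩

theorem IsFreeDensity.fscale {F : FreeSystem} {ρ : Free} (hκ : ∀ s, κ s ≠ 0)
    (hρ : IsFreeDensity F ρ) : IsFreeDensity (rescale κ F) (fscale κ ρ) := by
  rw [IsFreeDensity, fDt_fscale hκ]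
  exact fscale_mem_trivialDensities hρ

theorem cscale_inv_cscale (hκ : ∀ s, κ s ≠ 0) (a : Comm) :
    cscale (fun s => (κ s)⁻¹) (cscale κ a) = a := by
  rw [cscale_cscale]
  simp [inv_mul_cancel₀ (hκ _), cscale_one]

theorem cscale_cscale_inv (hκ : ∀ s, κ s ≠ 0) (a : Comm) :
    cscale κ (cscale (fun s => (κ s)⁻¹) a) = a := by
  rw [cscale_cscale]
  simp [mul_inv_cancel₀ (hκ _), cscale_one]

theorem crescale_inv_crescale (hκ : ∀ s, κ s ≠ 0) (f : CommSystem) :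
    crescale (fun s => (κ s)⁻¹) (crescale κ f) = f := by
  funext s
  rw [crescale, crescale, map_smul, inv_smul_smul₀ (hκ s), cscale_inv_cscale hκ]

/-- Scaling preserves weights, commutative reduction and conservation. A density of the scaled
system is pulled back by the inverse scaling, lifted there, and scaled forward again. This serves to
normalise the parameters of $S_5$. -/
theorem IsNonAbelianAnalog.rescale {f : CommSystem} {F : FreeSystem} (hκ : ∀ s, κ s ≠ 0)
    (hF : IsNonAbelianAnalog f F) : IsNonAbelianAnalog (crescale κ f) (rescale κ F) := by
  have hom : ∀ μ ν, IsCommHomogeneous (crescale κ f) μ ν ↔ IsCommHomogeneous f μ ν :=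
    fun μ ν => ⟨fun h => crescale_inv_crescale hκ f ▸ isCommHomogeneous_crescale h,
      isCommHomogeneous_crescale⟩
  refine ⟨fun μ ν h s => ?_, fun s => ?_, fun ρ d hρ hρ' => ?_⟩
  · exact Submodule.smul_mem _ _ (fscale_mem_freeHomogeneous (hF.homogeneous μ ν ((hom μ ν).1 h) s))
  · rw [rescale_apply, map_smul, abelianize_fscale, hF.reduces, crescale]
  · simp only [hom] at hρ ⊢
    obtain ⟨ρ', h1, h2, h3⟩ := hF.lifts (NonAbelian.cscale (fun s => (κ s)⁻¹) ρ) d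
      (fun μ ν h => isWeightedHomogeneous_cscale (hρ μ ν h))
      (crescale_inv_crescale hκ f ▸ hρ'.cscale fun s => inv_ne_zero (hκ s))
    refine ⟨NonAbelian.fscale κ ρ', fun μ ν h => fscale_mem_freeHomogeneous (h1 μ ν h),
      h2.fscale hκ, ?_⟩
    rw [abelianize_fscale, h3, cscale_cscale_inv hκ]

theorem rescale_rescale (κ' : Fin 2 → ℂ) (F : FreeSystem) :
    NonAbelian.rescale κ (NonAbelian.rescale κ' F) =
      NonAbelian.rescale (fun s => κ s * κ' s) F := by
  funext s
  rw [rescale_apply, rescale_apply, rescale_apply, map_smul, fscale_fscale, smul_smul]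

theorem Equivalent.of_rescale {F G : FreeSystem} (hκ : ∀ s, κ s ≠ 0)
    (h : Equivalent (NonAbelian.rescale κ F) G) : Equivalent F G := by
  obtain ⟨κ', hκ', h⟩ := h
  have hF : F = NonAbelian.rescale (fun s => (κ s)⁻¹) (NonAbelian.rescale κ F) := by
    rw [rescale_rescale]
    simp [inv_mul_cancel₀ (hκ _), rescale_one]
  refine ⟨fun s => (κ s)⁻¹ * κ' s, fun s => mul_ne_zero (inv_ne_zero (hκ s)) (hκ' s), ?_⟩
  rw [← rescale_rescale, ← rescale_rescale]
  rcases h with h | h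
  · exact Or.inl (hF.trans (congrArg _ h))
  · exact Or.inr (hF.trans (congrArg _ h))

end

/-! ### Comparison up to scaling -/

def scaleCoeff (q : Poly × Poly) (w : List ℕ) (p : Poly) : Poly :=
  w.foldr (fun a r => Poly.mul (if a % 2 = 0 then q.1 else q.2) r) p

/-- Scaling by factors with values `p` and `1 / q`. -/
def scaleNC (p : Poly) (q : Poly × Poly) (l : NC) : NC :=
  l.map fun x => (x.1, scaleCoeff q x.1 (Poly.mul p x.2))

theorem evN_scaleNC {h : ℕ →* ℂ} {κ : Fin 2 → ℂ} {q : Poly × Poly} (h0 : ev h q.1 = (κ 0)⁻¹)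
    (h1 : ev h q.2 = (κ 1)⁻¹) (p : Poly) (l : NC) :
    evN h (scaleNC p q l) = ev h p • fscale κ (evN h l) := by
  have key : ∀ (w : List ℕ) (r : Poly),
      ev h (scaleCoeff q w r) • W w = ev h r • fscale κ (W w) := by
    intro w r
    induction w with
    | nil => simp [scaleCoeff]
    | cons a w ih =>
      have ha : ev h (if a % 2 = 0 then q.1 else q.2) = (κ (letter a).1)⁻¹ := by
        split_ifs with h2
        · rw [h0]; simp [letter, h2]
        · rw [h1]
          congr 2
          apply Fin.ext
          simp [letter]
          omega
      have ih' := congrArg (fun z => (κ (letter a).1)⁻¹ • (gen a * z)) ih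
      simp only [mul_smul_comm] at ih'
      rw [scaleCoeff, List.foldr_cons, ev_mul, ha, ← scaleCoeff, W_cons, map_mul, fscale_gen,
        mul_smul, ih', smul_mul_assoc, smul_comm]
  induction l with
  | nil => simp [scaleNC]
  | cons x l ih =>
    obtain ⟨w, r⟩ := x
    rw [scaleNC, List.map_cons, ← scaleNC, evN_cons, ih, evN_cons, key, ev_mul, map_add, map_smul,
      smul_add, mul_smul]

section

variable {h : ℕ →* ℂ} {F G : FreeSystem} {a b : NC} {T : NPoly × NPoly}

theorem equivalent_of_agree_scale (h3 : h 3 = iSqrt3) (hF0 : F 0 = evN h a) (hF1 : F 1 = evN h b)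
    (hG : G 0 = T.1.val h ∧ G 1 = T.2.val h) {p q : Poly × Poly} (h0 : ev h p.1 * ev h q.1 = 1)
    (h1 : ev h p.2 * ev h q.2 = 1) (r : List (ℕ × Poly)) (hr : Valid h r)
    (hab : (agree r a (scaleNC p.1 q T.1.l) && agree r b (scaleNC p.2 q T.2.l)) = true) :
    Equivalent F G := by
  rw [Bool.and_eq_true] at hab
  refine ⟨![ev h p.1, ev h p.2], ?_, Or.inl ?_⟩
  · intro s
    fin_cases s
    exacts [left_ne_zero_of_mul_eq_one h0, left_ne_zero_of_mul_eq_one h1]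
  have e0 : ev h q.1 = (![ev h p.1, ev h p.2] 0)⁻¹ := eq_inv_of_mul_eq_one_right h0
  have e1 : ev h q.2 = (![ev h p.1, ev h p.2] 1)⁻¹ := eq_inv_of_mul_eq_one_right h1
  funext s
  fin_cases s
  · rw [Fin.mk_zero, hF0, evN_eq_of_agree h3 hr hab.1, evN_scaleNC e0 e1, rescale_apply, hG.1]
    rfl
  · rw [Fin.mk_one, hF1, evN_eq_of_agree h3 hr hab.2, evN_scaleNC e0 e1, rescale_apply, hG.2]
    rfl

theorem equivalent_of_agree_scale_star (h3 : h 3 = iSqrt3) (hF0 : F 0 = evN h a)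
    (hF1 : F 1 = evN h b) (hG : G 0 = T.1.val h ∧ G 1 = T.2.val h) {p q : Poly × Poly}
    (h0 : ev h p.1 * ev h q.1 = 1) (h1 : ev h p.2 * ev h q.2 = 1) (r : List (ℕ × Poly))
    (hr : Valid h r)
    (hab : (agree r a (scaleNC p.1 q (T.1.l.map fun x => (x.1.reverse, x.2))) &&
      agree r b (scaleNC p.2 q (T.2.l.map fun x => (x.1.reverse, x.2)))) = true) :
    Equivalent F G := by
  -- The two alternatives in `Equivalent` trade places when the target is replaced by its
  -- involution.
  obtain ⟨κ, hκ, hG'⟩ : Equivalent F (involute G) := by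
    refine equivalent_of_agree_scale (T := (⟨T.1.l.map fun x => (x.1.reverse, x.2)⟩,
      ⟨T.2.l.map fun x => (x.1.reverse, x.2)⟩)) h3 hF0 hF1 ⟨?_, ?_⟩ h0 h1 r hr hab
    · rw [involute, hG.1, NPoly.val, star_evN, NPoly.val]
    · rw [involute, hG.2, NPoly.val, star_evN, NPoly.val]
  have hi : involute (involute G) = G := funext fun s => star_star (G s)
  rw [hi] at hG'
  exact ⟨κ, hκ, hG'.symm⟩

end

/-! ### The analogs of the separate scalar systems -/

theorem exists_solution {f : CommSystem} {F : FreeSystem} {S : System} {β : ℂ} {Ds : List Density}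
    {x : NC × NC × List Poly} (hF : IsNonAbelianAnalog f F) (hc : checkAll S Ds = true)
    (hx : solution (par S.b₀ S.l₀) (par S.b₁ S.l₁) (blocks Ds) [] = x)
    (h0 : f 0 = abelianize (evN (envHom fun _ => β) S.b₀))
    (h1 : f 1 = abelianize (evN (envHom fun _ => β) S.b₁))
    (hν : ∀ μ ν, IsCommHomogeneous f μ ν →
      if S.bal then ν 0 + ν 1 = S.g.1 + S.g.2 else ν = toReal S.g) :
    ∃ h : ℕ →* ℂ, h 2 = β ∧ h 3 = iSqrt3 ∧ F 0 = evN h x.1 ∧ F 1 = evN h x.2.1 ∧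
      ∀ p ∈ x.2.2, ev h p = 0 := by
  obtain ⟨h, h2, h3, hF0, hF1, hD⟩ := exists_env hF hc h0 h1 hν
  exact ⟨h, h2, h3, solution_sound hF0 hF1 hD (by simp [Valid]) hx⟩

@[simp] theorem valid_nil (h : ℕ →* ℂ) : Valid h [] := by simp [Valid]

@[simp] theorem valid_cons (h : ℕ →* ℂ) (x : ℕ × Poly) (l : List (ℕ × Poly)) :
    Valid h (x :: l) ↔ h x.1 = ev h x.2 ∧ Valid h l := by simp [Valid]

theorem eq_toReal {ν : Fin 2 → ℝ} {g : ℕ × ℕ} (h0 : ν 0 = g.1) (h1 : ν 1 = g.2) :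
    ν = toReal g := by
  funext s
  fin_cases s
  exacts [h0, h1]

theorem C_ofNat (n : ℕ) [n.AtLeastTwo] :
    (MvPolynomial.C (OfNat.ofNat n) : Comm) = OfNat.ofNat n := map_ofNat _ n

theorem iSqrt3_sq {h : ℕ →* ℂ} (h3 : h 3 = iSqrt3) : h 3 * h 3 = -3 := by
  rw [← map_mul]; exact h_nine h3

section

variable {F : FreeSystem}

theorem equivalent_S1 (hF : IsNonAbelianAnalog Scalar.S1 F) : Equivalent F S1' := by
  -- The parameter $\beta$ does not occur here, so its value 0 is arbitrary.
  have h0 : Scalar.S1 0 = abelianize (evN (envHom fun _ => 0) s1.b₀) := by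
    simp [s1, Scalar.S1, abelianize_gen, letter, MvPolynomial.smul_eq_C_mul]
    rw [C_ofNat]
    ring
  have h1 : Scalar.S1 1 = abelianize (evN (envHom fun _ => 0) s1.b₁) := by
    simp [s1, Scalar.S1, abelianize_gen, letter, MvPolynomial.smul_eq_C_mul]
    rw [C_ofNat]
    ring
  obtain ⟨h, -, h3, hF0, hF1, hr⟩ := exists_solution hF check_s1 solution_s1 h0 h1
    fun μ ν hν => by
      -- The term $u_{xx}$ gives $\mu=2$, and $u^2v$ then gives $\nu_1+\nu_2=2$.
      have e1 := wt_of_isCommHomogeneous h0 (by decide +kernel) hν (w := [4]) (c := 1)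
        (by norm_num) (by decide +kernel)
      have e2 := wt_of_isCommHomogeneous h0 (by decide +kernel) hν (w := [0, 0, 1]) (c := 2)
        (by norm_num) (by decide +kernel)
      simp [wt, letter, jetWeight] at e1 e2
      simp [s1]
      linarith
  simp only [s1Solution, List.forall_mem_cons, ev_cons, ev_nil] at hr
  -- The first remaining equation is a multiple of the square of this unknown.
  have h13 : h 13 = 0 := by
    have := hr.1
    rw [show 169 = 13 * 13 from rfl, map_mul] at this
    simpa using this
  exact equivalent_of_agree h3 hF0 hF1 (val_S1' h) [(13, [])] (by simp [h13]) (by decide +kernel)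

theorem equivalent_S2 (hF : IsNonAbelianAnalog Scalar.S2 F) :
    Equivalent F S2' ∨ Equivalent F S2'' := by
  have h0 : Scalar.S2 0 = abelianize (evN (envHom fun _ => 0) s2.b₀) := by
    simp [s2, Scalar.S2, abelianize_gen, letter, MvPolynomial.smul_eq_C_mul]
    repeat rw [C_ofNat]
    ring
  have h1 : Scalar.S2 1 = abelianize (evN (envHom fun _ => 0) s2.b₁) := by
    simp [s2, Scalar.S2, abelianize_gen, letter, MvPolynomial.smul_eq_C_mul]
    repeat rw [C_ofNat]
    ring
  obtain ⟨h, -, h3, hF0, hF1, hr⟩ := exists_solution hF check_s2 solution_s2 h0 h1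
    fun μ ν hν => by
      have e0 := wt_of_isCommHomogeneous h0 (by decide +kernel) hν (w := [4]) (c := 1)
        (by norm_num) (by decide +kernel)
      have e1 := wt_of_isCommHomogeneous h0 (by decide +kernel) hν (w := [0, 2]) (c := 2)
        (by norm_num) (by decide +kernel)
      have e2 := wt_of_isCommHomogeneous h1 (by decide +kernel) hν (w := [1, 3]) (c := 2)
        (by norm_num) (by decide +kernel)
      simp [wt, letter, jetWeight] at e0 e1 e2
      refine eq_toReal ?_ ?_ <;> simp [s2] <;> linarith
  simp only [s2Solution, List.forall_mem_cons, ev_cons, ev_nil,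
    show 2809 = 53 * 53 from rfl,
    show 3233 = 53 * 61 from rfl,
    show 3721 = 61 * 61 from rfl,
    show 171349 = 53 * 53 * 61 from rfl,
    show 197213 = 53 * 61 * 61 from rfl,
    show 226981 = 61 * 61 * 61 from rfl,
    show 12029993 = 53 * 61 * 61 * 61 from rfl,
    show 13845841 = 61 * 61 * 61 * 61 from rfl, map_mul] at hr
  push_cast at hr
  obtain ⟨e1, e2, -⟩ := hr
  -- The unknown `61` is the coefficient of $v_xv$ in $v_t$, and that of $vv_x$ is 2 minus it. The
  -- involution exchanges the two, so the two roots lead to mutually involuted systems.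
  have hy : h 61 = 0 ∨ h 61 = 2 := by
    rw [← sub_eq_zero (b := 2), ← mul_eq_zero]; linear_combination -e2
  rcases hy with hy | hy <;> rw [hy] at e1
  · have hx : h 53 = 0 ∨ h 53 = -2 := by
      rw [eq_neg_iff_add_eq_zero, ← mul_eq_zero]; linear_combination e1 / 2
    rcases hx with hx | hx
    · exact Or.inr (equivalent_of_agree_star h3 hF0 hF1 (val_S2'' h)
        [(61, []), (53, [])]
        (by simp [hx, hy]) (by decide +kernel))
    · exact Or.inl (equivalent_of_agree_star h3 hF0 hF1 (val_S2' h)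
        [(61, []), (53, [(1, -2)])]
        (by simp [hx, hy]) (by decide +kernel))
  · have hx : h 53 = 0 ∨ h 53 = 2 := by
      rw [← sub_eq_zero (b := 2), ← mul_eq_zero]; linear_combination -e1 / 2
    rcases hx with hx | hx
    · exact Or.inl (equivalent_of_agree h3 hF0 hF1 (val_S2' h)
        [(61, [(1, 2)]), (53, [])]
        (by simp [hx, hy]) (by decide +kernel))
    · exact Or.inr (equivalent_of_agree h3 hF0 hF1 (val_S2'' h)
        [(61, [(1, 2)]), (53, [(1, 2)])]
        (by simp [hx, hy]) (by decide +kernel))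

theorem equivalent_S3 (hF : IsNonAbelianAnalog Scalar.S3 F) :
    Equivalent F S3' := by
  have h0 : Scalar.S3 0 = abelianize (evN (envHom fun _ => 0) s3.b₀) := by
    simp [s3, Scalar.S3, abelianize_gen, letter, MvPolynomial.smul_eq_C_mul]
    repeat rw [C_ofNat]
    ring
  have h1 : Scalar.S3 1 = abelianize (evN (envHom fun _ => 0) s3.b₁) := by
    simp [s3, Scalar.S3, abelianize_gen, letter, MvPolynomial.smul_eq_C_mul]
    repeat rw [C_ofNat]
    ring
  obtain ⟨h, -, h3, hF0, hF1, hr⟩ := exists_solution hF check_s3 solution_s3 h0 h1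
    fun μ ν hν => by
      have e0 := wt_of_isCommHomogeneous h0 (by decide +kernel) hν (w := [4]) (c := 1)
        (by norm_num) (by decide +kernel)
      have e1 := wt_of_isCommHomogeneous h0 (by decide +kernel) hν (w := [0, 3]) (c := 2)
        (by norm_num) (by decide +kernel)
      have e2 := wt_of_isCommHomogeneous h1 (by decide +kernel) hν (w := [2]) (c := 2)
        (by norm_num) (by decide +kernel)
      simp [wt, letter, jetWeight] at e0 e1 e2
      refine eq_toReal ?_ ?_ <;> simp [s3] <;> linarith
  simp only [s3Solution, List.forall_mem_cons, ev_cons, ev_nil,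
    show 961 = 31 * 31 from rfl, map_mul] at hr
  push_cast at hr
  obtain ⟨e1, -⟩ := hr
  -- Again the coefficient of $v_xv$ in $v_t$; the involution exchanges the two roots.
  have hx : h 31 = 0 ∨ h 31 = 2 := by
    rw [← sub_eq_zero (b := 2), ← mul_eq_zero]; linear_combination e1 / 2
  rcases hx with hx | hx
  · exact equivalent_of_agree_star h3 hF0 hF1 (val_S3' h)
      [(31, [])]
      (by simp [hx]) (by decide +kernel)
  · exact equivalent_of_agree h3 hF0 hF1 (val_S3' h)
      [(31, [(1, 2)])]
      (by simp [hx]) (by decide +kernel)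

theorem equivalent_S4 (hF : IsNonAbelianAnalog Scalar.S4 F) :
    Equivalent F S4' ∨ Equivalent F S4'' := by
  have h0 : Scalar.S4 0 = abelianize (evN (envHom fun _ => 0) s4.b₀) := by
    simp [s4, Scalar.S4, abelianize_gen, letter, MvPolynomial.smul_eq_C_mul]
    repeat rw [C_ofNat]
    ring
  have h1 : Scalar.S4 1 = abelianize (evN (envHom fun _ => 0) s4.b₁) := by
    simp [s4, Scalar.S4, abelianize_gen, letter, MvPolynomial.smul_eq_C_mul]
    repeat rw [C_ofNat]
    ring
  obtain ⟨h, -, h3, hF0, hF1, hr⟩ := exists_solution hF check_s4 solution_s4 h0 h1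
    fun μ ν hν => by
      have e0 := wt_of_isCommHomogeneous h0 (by decide +kernel) hν (w := [4]) (c := 1)
        (by norm_num) (by decide +kernel)
      have e1 := wt_of_isCommHomogeneous h0 (by decide +kernel) hν (w := [0, 2]) (c := 2)
        (by norm_num) (by decide +kernel)
      have e2 := wt_of_isCommHomogeneous h1 (by decide +kernel) hν (w := [1, 3]) (c := 2)
        (by norm_num) (by decide +kernel)
      simp [wt, letter, jetWeight] at e0 e1 e2
      refine eq_toReal ?_ ?_ <;> simp [s4] <;> linarith
  simp only [s4Solution, List.forall_mem_cons, ev_cons, ev_nil,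
    show 1681 = 41 * 41 from rfl,
    show 2501 = 41 * 61 from rfl,
    show 3721 = 61 * 61 from rfl, map_mul] at hr
  push_cast at hr
  obtain ⟨e1, e2, -⟩ := hr
  -- The coefficient of $v_xv$ in $v_t$ once more; for each of its values a quadratic equation for
  -- `41` separates the two listed systems.
  have hy : h 61 = 0 ∨ h 61 = 2 := by
    rw [← sub_eq_zero (b := 2), ← mul_eq_zero]; linear_combination -e2
  rcases hy with hy | hy <;> rw [hy] at e1
  · have hx : h 41 = 0 ∨ h 41 = 2 := by
      rw [← sub_eq_zero (b := 2), ← mul_eq_zero]; linear_combination -e1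
    rcases hx with hx | hx
    · exact Or.inl (equivalent_of_agree h3 hF0 hF1 (val_S4' h)
        [(61, []), (41, [])]
        (by simp [hx, hy]) (by decide +kernel))
    · exact Or.inr (equivalent_of_agree_star h3 hF0 hF1 (val_S4'' h)
        [(61, []), (41, [(1, 2)])]
        (by simp [hx, hy]) (by decide +kernel))
  · have hx : h 41 = 0 ∨ h 41 = -2 := by
      rw [eq_neg_iff_add_eq_zero, ← mul_eq_zero]; linear_combination -e1
    rcases hx with hx | hx
    · exact Or.inl (equivalent_of_agree_star h3 hF0 hF1 (val_S4' h)
        [(61, [(1, 2)]), (41, [])]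
        (by simp [hx, hy]) (by decide +kernel))
    · exact Or.inr (equivalent_of_agree h3 hF0 hF1 (val_S4'' h)
        [(61, [(1, 2)]), (41, [(1, -2)])]
        (by simp [hx, hy]) (by decide +kernel))

theorem not_isNonAbelianAnalog_B1 (hF : IsNonAbelianAnalog Scalar.B1 F) :
    False := by
  have h0 : Scalar.B1 0 = abelianize (evN (envHom fun _ => 0) b1.b₀) := by
    simp [b1, Scalar.B1, abelianize_gen, letter, MvPolynomial.smul_eq_C_mul]
    repeat rw [C_ofNat]
    ring
  have h1 : Scalar.B1 1 = abelianize (evN (envHom fun _ => 0) b1.b₁) := by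
    simp [b1, Scalar.B1, abelianize_gen, letter, MvPolynomial.smul_eq_C_mul]
    repeat rw [C_ofNat]
    ring
  obtain ⟨h, -, h3, hF0, hF1, hr⟩ := exists_solution hF check_b1 solution_b1 h0 h1
    fun μ ν hν => by
      have e0 := wt_of_isCommHomogeneous h0 (by decide +kernel) hν (w := [4]) (c := 1)
        (by norm_num) (by decide +kernel)
      have e1 := wt_of_isCommHomogeneous h0 (by decide +kernel) hν (w := [0, 0]) (c := 1)
        (by norm_num) (by decide +kernel)
      have e2 := wt_of_isCommHomogeneous h1 (by decide +kernel) hν (w := [1, 1]) (c := -1)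
        (by norm_num) (by decide +kernel)
      simp [wt, letter, jetWeight] at e0 e1 e2
      refine eq_toReal ?_ ?_ <;> simp [b1] <;> linarith
  -- The remaining equation reads $4=0$.
  simp [b1Solution] at hr

theorem equivalent_B2 (hF : IsNonAbelianAnalog Scalar.B2 F) :
    Equivalent F B2' := by
  have h0 : Scalar.B2 0 = abelianize (evN (envHom fun _ => 0) b2.b₀) := by
    simp [b2, Scalar.B2, abelianize_gen, letter, MvPolynomial.smul_eq_C_mul]
    repeat rw [C_ofNat]
    ring
  have h1 : Scalar.B2 1 = abelianize (evN (envHom fun _ => 0) b2.b₁) := by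
    simp [b2, Scalar.B2, abelianize_gen, letter, add_comm]
  obtain ⟨h, -, h3, hF0, hF1, hr⟩ := exists_solution hF check_b2 solution_b2 h0 h1
    fun μ ν hν => by
      have e0 := wt_of_isCommHomogeneous h0 (by decide +kernel) hν (w := [4]) (c := 1)
        (by norm_num) (by decide +kernel)
      have e1 := wt_of_isCommHomogeneous h0 (by decide +kernel) hν (w := [1, 3]) (c := 2)
        (by norm_num) (by decide +kernel)
      have e2 := wt_of_isCommHomogeneous h1 (by decide +kernel) hν (w := [2]) (c := 1)
        (by norm_num) (by decide +kernel)
      simp [wt, letter, jetWeight] at e0 e1 e2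
      refine eq_toReal ?_ ?_ <;> simp [b2] <;> linarith
  simp only [b2Solution, List.forall_mem_cons, ev_cons, ev_nil,
    show 49 = 7 * 7 from rfl, map_mul, map_one] at hr
  push_cast at hr
  obtain ⟨e1, -⟩ := hr
  -- The quadratic $3x^2-6x+4=0$ for the coefficient of $v_xv$ has no real roots; here $i\sqrt3$
  -- enters. The involution takes $x$ to $2-x$ and exchanges the roots.
  have hx : h 7 = 1 + h 3 / 3 ∨ h 7 = 1 - h 3 / 3 := by
    rw [← sub_eq_zero, ← sub_eq_zero (b := 1 - h 3 / 3), ← mul_eq_zero]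
    linear_combination -e1 / 3 - iSqrt3_sq h3 / 9
  rcases hx with hx | hx
  · exact equivalent_of_agree_star h3 hF0 hF1 (val_B2' h3)
      [(7, [(1, 1), (3, 1 / 3)])]
      (by simp [hx, div_eq_inv_mul]) (by decide +kernel)
  · exact equivalent_of_agree h3 hF0 hF1 (val_B2' h3)
      [(7, [(1, 1), (3, -1 / 3)])]
      (by simp [hx, div_eq_inv_mul, sub_eq_add_neg]) (by decide +kernel)

theorem equivalent_B3 (hF : IsNonAbelianAnalog Scalar.B3 F) :
    Equivalent F B3' ∨ Equivalent F B3'' := by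
  have h0 : Scalar.B3 0 = abelianize (evN (envHom fun _ => 0) b3.b₀) := by
    simp [b3, Scalar.B3, abelianize_gen, letter, MvPolynomial.smul_eq_C_mul]
    repeat rw [C_ofNat]
    ring
  have h1 : Scalar.B3 1 = abelianize (evN (envHom fun _ => 0) b3.b₁) := by
    simp [b3, Scalar.B3, abelianize_gen, letter, MvPolynomial.smul_eq_C_mul]
    repeat rw [C_ofNat]
    ring
  obtain ⟨h, -, h3, hF0, hF1, hr⟩ := exists_solution hF check_b3 solution_b3 h0 h1
    fun μ ν hν => by
      have e0 := wt_of_isCommHomogeneous h0 (by decide +kernel) hν (w := [4]) (c := 1)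
        (by norm_num) (by decide +kernel)
      have e1 := wt_of_isCommHomogeneous h0 (by decide +kernel) hν (w := [0, 0, 0]) (c := -6)
        (by norm_num) (by decide +kernel)
      have e2 := wt_of_isCommHomogeneous h0 (by decide +kernel) hν (w := [0, 1, 1]) (c := -18)
        (by norm_num) (by decide +kernel)
      simp [wt, letter, jetWeight] at e0 e1 e2
      refine eq_toReal ?_ ?_ <;> simp [b3] <;> linarith
  simp only [b3Solution, List.forall_mem_cons, ev_cons, ev_nil,
    show 1681 = 41 * 41 from rfl,
    show 2501 = 41 * 61 from rfl,
    show 3721 = 61 * 61 from rfl, map_mul, map_one] at hr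
  push_cast at hr
  obtain ⟨e1, e2, -⟩ := hr
  -- These are the roots of $x^2-6x+12=0$, where $x$ is the coefficient of $u_xv$ in $v_t$. That of
  -- $vu_x$ is $6-x$, so the involution exchanges the roots.
  have hx : h 41 = 3 + h 3 ∨ h 41 = 3 - h 3 := by
    rw [← sub_eq_zero, ← sub_eq_zero (b := 3 - h 3), ← mul_eq_zero]
    linear_combination e2 - iSqrt3_sq h3
  have hy : h 61 = 0 ∨ h 61 = 6 - 2 * h 41 := by
    rw [← sub_eq_zero (b := 6 - 2 * h 41), ← mul_eq_zero]; linear_combination e1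
  rcases hx with hx | hx <;> rw [hx] at hy <;> rcases hy with hy | hy
  · exact Or.inl (equivalent_of_agree h3 hF0 hF1 (val_B3' h3)
      [(41, [(1, 3), (3, 1)]), (61, [])]
      (by simp [hx, hy]) (by decide +kernel))
  · exact Or.inr (equivalent_of_agree_star h3 hF0 hF1 (val_B3'' h3)
      [(41, [(1, 3), (3, 1)]), (61, [(3, -2)])]
      (by simp [hx, hy]; ring) (by decide +kernel))
  · exact Or.inl (equivalent_of_agree_star h3 hF0 hF1 (val_B3' h3)
      [(41, [(1, 3), (3, -1)]), (61, [])]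
      (by simp [hx, hy, sub_eq_add_neg]) (by decide +kernel))
  · exact Or.inr (equivalent_of_agree h3 hF0 hF1 (val_B3'' h3)
      [(41, [(1, 3), (3, -1)]), (61, [(3, 2)])]
      (by simp [hx, hy]; constructor <;> ring) (by decide +kernel))

theorem equivalent_B4 (hF : IsNonAbelianAnalog Scalar.B4 F) :
    Equivalent F B4' ∨ Equivalent F B4'' := by
  have h0 : Scalar.B4 0 = abelianize (evN (envHom fun _ => 0) b4.b₀) := by
    simp [b4, Scalar.B4, abelianize_gen, letter, MvPolynomial.smul_eq_C_mul]
    repeat rw [C_ofNat]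
    ring
  have h1 : Scalar.B4 1 = abelianize (evN (envHom fun _ => 0) b4.b₁) := by
    simp [b4, Scalar.B4, abelianize_gen, letter, MvPolynomial.smul_eq_C_mul]
    repeat rw [C_ofNat]
    ring
  obtain ⟨h, -, h3, hF0, hF1, hr⟩ := exists_solution hF check_b4 solution_b4 h0 h1
    fun μ ν hν => by
      have e0 := wt_of_isCommHomogeneous h0 (by decide +kernel) hν (w := [4]) (c := 1)
        (by norm_num) (by decide +kernel)
      have e1 := wt_of_isCommHomogeneous h0 (by decide +kernel) hν (w := [1, 3]) (c := 2)
        (by norm_num) (by decide +kernel)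
      have e2 := wt_of_isCommHomogeneous h1 (by decide +kernel) hν (w := [0, 2]) (c := 2)
        (by norm_num) (by decide +kernel)
      simp [wt, letter, jetWeight] at e0 e1 e2
      refine eq_toReal ?_ ?_ <;> simp [b4] <;> linarith
  simp only [b4Solution, List.forall_mem_cons, ev_cons, ev_nil,
    show 841 = 29 * 29 from rfl,
    show 12117361 = 59 * 59 * 59 * 59 from rfl,
    show 351403469 = 29 * (59 * 59 * 59 * 59) from rfl, map_mul, map_one] at hr
  push_cast at hr
  obtain ⟨e1, e2, -⟩ := hr
  -- For $x$, the coefficient of $v_xv$ in $u_t$, the equation is $3x^2-6x+4=0$. The other equation,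
  -- $y\,(8+9(x-1)y^3)=0$ with $y$ the value of `59`, gives one of the listed systems for $y=0$ and
  -- the other for the three cube roots.
  have hx : h 29 = 1 + h 3 / 3 ∨ h 29 = 1 - h 3 / 3 := by
    rw [← sub_eq_zero, ← sub_eq_zero (b := 1 - h 3 / 3), ← mul_eq_zero]
    linear_combination e2 / 6 - iSqrt3_sq h3 / 9
  rcases hx with hx | hx
  · by_cases hy : h 59 = 0
    · exact Or.inl (equivalent_of_agree h3 hF0 hF1 (val_B4' h3)
        [(29, [(1, 1), (3, 1 / 3)]), (59, [])]
        (by simp [hx, hy, div_eq_inv_mul]) (by decide +kernel))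
    · have hb : h 59 * h 59 * h 59 = 8 / 9 * h 3 := by
        refine mul_left_cancel₀ hy ?_
        rw [hx] at e1
        linear_combination -h 3 / 9 * e1 + h 59 * h 59 * h 59 * h 59 / 3 * iSqrt3_sq h3
      -- A rule may have a composite key: the code of $y^3$ is replaced wherever it divides a
      -- monomial.
      have hb' : h 205379 = 8 / 9 * h 3 := by
        rw [show 205379 = 59 * 59 * 59 from rfl, map_mul, map_mul, hb]
      have h1 : ev h [(3481, -3 / 4)] * ev h [(177, 1 / 2)] = 1 := by
        simp only [ev_cons, ev_nil, show 3481 = 59 * 59 from rfl, show 177 = 3 * 59 from rfl,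
          map_mul]
        push_cast
        linear_combination -3 / 8 * h 3 * hb - iSqrt3_sq h3 / 3
      -- The factors $\kappa_1=-\frac34y^2$ and $\kappa_2=\frac{i\sqrt3}2y$ are mutually inverse
      -- cube roots of unity, so the scaling preserves the scalar system and relates the three
      -- values of $y$. Being inverse to each other, they reappear swapped in `q`.
      exact Or.inr (equivalent_of_agree_scale h3 hF0 hF1 (val_B4'' h3)
        (p := ([(3481, -3 / 4)], [(177, 1 / 2)]))
        (q := ([(177, 1 / 2)], [(3481, -3 / 4)])) h1
        ((mul_comm _ _).trans h1)
        [(29, [(1, 1), (3, 1 / 3)]), (205379, [(3, 8 / 9)])]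
        (by simp [hx, hb']; ring)
        (by decide +kernel))
  · by_cases hy : h 59 = 0
    · exact Or.inl (equivalent_of_agree_star h3 hF0 hF1 (val_B4' h3)
        [(29, [(1, 1), (3, -1 / 3)]), (59, [])]
        (by simp [hx, hy, div_eq_inv_mul, sub_eq_add_neg]) (by decide +kernel))
    · have hb : h 59 * h 59 * h 59 = -8 / 9 * h 3 := by
        refine mul_left_cancel₀ hy ?_
        rw [hx] at e1
        linear_combination h 3 / 9 * e1 + h 59 * h 59 * h 59 * h 59 / 3 * iSqrt3_sq h3
      have hb' : h 205379 = -8 / 9 * h 3 := by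
        rw [show 205379 = 59 * 59 * 59 from rfl, map_mul, map_mul, hb]
      have h1 : ev h [(3481, -3 / 4)] * ev h [(177, -1 / 2)] = 1 := by
        simp only [ev_cons, ev_nil, show 3481 = 59 * 59 from rfl, show 177 = 3 * 59 from rfl,
          map_mul]
        push_cast
        linear_combination 3 / 8 * h 3 * hb - iSqrt3_sq h3 / 3
      -- As in the other branch, with the sign of $i\sqrt3$ reversed and the involution applied.
      exact Or.inr (equivalent_of_agree_scale_star h3 hF0 hF1 (val_B4'' h3)
        (p := ([(3481, -3 / 4)], [(177, -1 / 2)]))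
        (q := ([(177, -1 / 2)], [(3481, -3 / 4)])) h1
        ((mul_comm _ _).trans h1)
        [(29, [(1, 1), (3, -1 / 3)]), (205379, [(3, -8 / 9)])]
        (by simp [hx, hb']; ring)
        (by decide +kernel))

end

/-! ### Conserved densities and elimination for the systems `S5 1 β`

The variable with number `2` stands for `β`. After elimination by means of the densities of weights
`1`, `2`, `3` there are three cases, which are treated with the densities of weights `3`, `4`. -/

def s5 : System where
  b₀ := [([0, 0, 0, 1, 1], [(1, -2), (2, 1)]), ([0, 0, 3], [(1, 2)]), ([0, 1, 2], [(2, 2)]), ([4],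
    [(1, 1)])]
  b₁ := [([0, 0, 1, 1, 1], [(1, 2), (2, -1)]), ([0, 1, 3], [(2, 2)]), ([1, 1, 2], [(1, 2)]), ([5],
    [(1, -1)])]
  l₀ := [(5, [0, 2, 1]), (7, [0, 3, 0]), (11, [1, 0, 2]), (13, [1, 2, 0]), (17, [2, 0, 1]),
    (19, [2, 1, 0]), (23, [3, 0, 0]), (29, [0, 0, 1, 0, 1]), (31, [0, 0, 1, 1, 0]),
    (37, [0, 1, 0, 0, 1]), (41, [0, 1, 0, 1, 0]), (43, [0, 1, 1, 0, 0]), (47, [1, 0, 0, 0, 1]),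
    (53, [1, 0, 0, 1, 0]), (59, [1, 0, 1, 0, 0]), (61, [1, 1, 0, 0, 0])]
  l₁ := [(67, [0, 3, 1]), (71, [1, 0, 3]), (73, [1, 2, 1]), (79, [1, 3, 0]), (83, [2, 1, 1]),
    (89, [3, 0, 1]), (97, [3, 1, 0]), (101, [0, 1, 0, 1, 1]), (103, [0, 1, 1, 0, 1]),
    (107, [0, 1, 1, 1, 0]), (109, [1, 0, 0, 1, 1]), (113, [1, 0, 1, 0, 1]),
    (127, [1, 0, 1, 1, 0]), (131, [1, 1, 0, 0, 1]), (137, [1, 1, 0, 1, 0]),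
    (139, [1, 1, 1, 0, 0])]
  g := (1, 0)
  k := (0, 1)
  bal := true

def s5Density1 : Density where
  d := 1
  ρ := [([0, 1], [(1, 1)])]
  σ := [([0, 0, 1, 1], [(1, 1), (2, 1)]), ([0, 3], [(1, -1)]), ([1, 2], [(1, 1)])]
  l := []
  steps := [([(1, 0, [1, 0, 1, 0, 1])], 41), ([(1, 0, [0, 1, 0, 1, 1])], 29),
    ([(1, 0, [0, 0, 1, 1, 1])],
    31), ([(1, 0, [2, 1, 1])], 5), ([(1, 0, [0, 3, 1])], 7), ([(1, 0, [1, 0, 3])], 17)]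

def s5Density2 : Density where
  d := 2
  ρ := [([0, 0, 1, 1], [(1, -1)]), ([0, 3], [(1, 1)])]
  σ := [([0, 0, 0, 1, 1, 1], [(1, -2), (2, -1)]), ([0, 0, 1, 3], [(1, 2)]), ([0, 1, 1, 2],
    [(1, -2)]), ([2, 3], [(1, 1)])]
  l := [(149, [0, 1, 0, 1])]
  steps := [([(1, 0, [4, 1, 1])], 149), ([(1, 0, [1, 0, 5])], 19), ([(1, 0, [5, 1, 0])], 11),
    ([(1, 0, [2, 3, 1])], 13), ([(1, 0, [3, 1, 0, 1, 0])], 59), ([(1, 0, [3, 1, 1, 0, 0])], 61),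
    ([(1, 0, [3, 3, 0])], 23), ([(1, 0, [0, 0, 1, 1, 3])], 47), ([(1, 0, [0, 1, 0, 1, 3])], 43),
    ([(1, 0, [2, 1, 3])], 83), ([(1, 0, [3, 0, 0, 1, 1])], 37), ([(1, 0, [1, 1, 0, 0, 3])], 53),
    ([(1, 0, [0, 3, 1, 0, 1])], 103), ([(1, 0, [1, 0, 0, 3, 1])], 109),
    ([(1, 0, [3, 0, 1, 1, 0])], 127), ([(1, 0, [0, 3, 0, 1, 1])], 101),
    ([(1, 0, [0, 3, 1, 1, 0])], 107), ([(1, 0, [0, 0, 3, 1, 1])], 113),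
    ([(1, 0, [0, 0, 1, 1, 0, 1, 1])], 139)]

def s5Density3 : Density where
  d := 3
  ρ := [([0, 0, 0, 1, 1, 1], [(2, 1)]), ([0, 0, 1, 3], [(1, -1), (2, -1)]), ([0, 5], [(1, 1)])]
  σ := [([0, 0, 0, 0, 1, 1, 1, 1], [(1, 1), (2, 2), (4, 1)]), ([0, 0, 0, 1, 1, 3], [(1, -2),
    (2, -2)]), ([0, 0, 1, 1, 1, 2], [(1, 2), (2, 2)]), ([0, 0, 3, 3], [(1, 1)]), ([0, 1, 2, 3],
    [(1, -2)]), ([1, 1, 2, 2], [(1, 1)])]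
  l := [(151, [0, 0, 1, 0, 1, 1]), (157, [0, 0, 1, 1, 0, 1]), (163, [0, 0, 3, 1]),
    (167, [0, 2, 1, 1]), (173, [0, 1, 0, 1, 0, 1]), (179, [0, 1, 0, 3]), (181, [0, 1, 2, 1])]
  steps := [([(1, 0, [3, 4, 1])], 179), ([(1, 1, [7, 0, 0])], 163), ([(1, 0, [1, 3, 4])], 167),
    ([(1, 0, [1, 0, 1, 4, 1])], 173), ([(1, 0, [1, 1, 1, 4, 0])], 151),
    ([(1, 0, [1, 1, 0, 3, 2])], 157), ([(2, 0, [1, 1, 0, 5, 0]), (-1, 0, [3, 3, 0, 0, 1]),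
    (-1/3, 0, [2, 1, 1, 1, 2])], 73), ([(-1/2, 1, [1, 0, 0, 5, 0]), (1/4, 0, [3, 3, 1, 0, 0]),
    (-1/2, 0, [1, 3, 0, 2, 1])], 79), ([(-1/2, 0, [0, 5, 0, 1, 1]), (-1/4, 0, [0, 3, 1, 0, 3])],
    67), ([(-2, 0, [1, 0, 1, 1, 4]), (2, 0, [1, 1, 0, 1, 4])], 97), ([(1, 0, [1, 0, 1, 1, 4])],
    0)]

def s5Density4 : Density where
  d := 4
  ρ := [([0, 0, 0, 0, 1, 1, 1, 1], [(1, 1), (2, -1), (4, -1)]), ([0, 0, 0, 1, 1, 3], [(1, -2),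
    (2, 4), (4, 1)]), ([0, 0, 1, 5], [(2, -3/2)]), ([0, 0, 3, 3], [(1, 1), (2, -3/2)]),
    ([0, 1, 1, 4], [(1, -1)]), ([0, 7], [(1, 1)])]
  σ := [([0, 0, 0, 0, 0, 1, 1, 1, 1, 1], [(1, 4), (2, -6), (4, -2), (8, -1)]),
    ([0, 0, 0, 0, 1, 1, 1, 3], [(1, -4), (2, 10), (4, 1)]), ([0, 0, 0, 1, 1, 1, 1, 2], [(1, 4),
    (2, -10), (4, -1)]), ([0, 0, 0, 1, 1, 5], [(1, -2), (2, 1)]), ([0, 0, 0, 1, 3, 3], [(2, -6)]),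
    ([0, 0, 1, 1, 1, 4], [(1, -2), (2, 1)]), ([0, 0, 1, 1, 2, 3], [(1, -4), (2, 5), (4, -3)]),
    ([0, 0, 3, 5], [(1, 2)]), ([0, 1, 1, 1, 2, 2], [(2, -6)]), ([0, 1, 2, 5], [(2, 2)]),
    ([0, 1, 3, 4], [(2, -2)]), ([0, 2, 3, 3], [(2, -1)]), ([1, 1, 2, 4], [(1, -2)]),
    ([1, 2, 2, 3], [(2, 1)]), ([4, 5], [(1, 1)])]
  l := [(191, [0, 0, 0, 1, 0, 1, 1, 1]), (193, [0, 0, 0, 1, 1, 0, 1, 1]),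
    (197, [0, 0, 0, 1, 1, 1, 0, 1]), (199, [0, 0, 0, 1, 3, 1]), (211, [0, 0, 0, 3, 1, 1]),
    (223, [0, 0, 2, 1, 1, 1]), (227, [0, 0, 1, 0, 0, 1, 1, 1]), (229, [0, 0, 1, 0, 1, 0, 1, 1]),
    (233, [0, 0, 1, 0, 1, 1, 0, 1]), (239, [0, 0, 1, 0, 1, 3]), (241, [0, 0, 1, 0, 3, 1]),
    (251, [0, 0, 1, 2, 1, 1]), (257, [0, 0, 1, 1, 0, 0, 1, 1]), (263, [0, 0, 1, 1, 0, 1, 0, 1]),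
    (269, [0, 0, 1, 1, 0, 3]), (271, [0, 0, 1, 1, 2, 1]), (277, [0, 0, 1, 3, 0, 1]),
    (281, [0, 0, 3, 0, 1, 1]), (283, [0, 0, 3, 1, 0, 1]), (293, [0, 0, 5, 1]),
    (307, [0, 2, 0, 1, 1, 1]), (311, [0, 2, 1, 0, 1, 1]), (313, [0, 2, 1, 1, 0, 1]),
    (317, [0, 2, 1, 3]), (331, [0, 2, 3, 1]), (337, [0, 4, 1, 1]),
    (347, [0, 1, 0, 1, 0, 1, 0, 1]), (349, [0, 1, 0, 1, 0, 3]), (353, [0, 1, 0, 1, 2, 1]),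
    (359, [0, 1, 0, 1, 1, 2]), (367, [0, 1, 0, 5]), (373, [0, 1, 2, 0, 1, 1]),
    (379, [0, 1, 4, 1]), (383, [0, 1, 3, 2]), (389, [0, 3, 0, 3]), (397, [0, 3, 2, 1]),
    (401, [0, 3, 1, 2]), (409, [2, 1, 2, 1])]
  steps := []

/-- The density of weight 4 has no steps of its own: it is listed to reserve its names and verify
its conservation law, and its elimination depends on the branch. -/
def s5Densities : List Density :=
  [s5Density1, s5Density2, s5Density3, s5Density4]

def s5Solution : NC × NC × List Poly := (
  [([0, 0, 0, 1, 1], [(4, -1), (142, 1), (178, 1), (284, -1/2), (356, 1/2), (5041, -1/4),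
  (6319, -1/2), (7921, -1/4), (10082, 1/2), (15842, -1/2), (357911, -1/8), (448649, -1/8),
  (562391, 1/8), (704969, 1/8)]), ([0, 0, 3], [(2, 1), (71, -1/2), (89, -1/2), (142, 1/2),
  (178, -1/2), (5041, -1/4), (7921, 1/4)]), ([0, 0, 1, 0, 1], [(131, -1), (142, -1), (284, 1),
  (356, -1), (5041, 1/2), (6319, 1/2), (10082, -1), (15842, 1), (357911, 1/4), (448649, 1/4),
  (562391, -1/4), (704969, -1/4)]), ([0, 0, 1, 1, 0], [(137, -1), (178, 1), (284, 1), (356, -1),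
  (6319, -1/2), (7921, -1/2), (10082, -1), (15842, 1), (357911, 1/4), (448649, 1/4),
  (562391, -1/4), (704969, -1/4)]), ([0, 1, 2], [(89, 1)]), ([0, 1, 0, 0, 1], [(4, -1), (137, -1),
  (142, 1), (178, 2), (284, 1/2), (356, -1/2), (5041, -1/4), (6319, -1), (7921, -3/4),
  (10082, -1/2), (15842, 1/2), (357911, 1/8), (448649, 1/8), (562391, -1/8), (704969, -1/8)]),
  ([0, 1, 0, 1, 0], [(1, -2), (2, 1), (4, 4), (131, 3), (137, 3), (142, -3), (178, -6), (284, -3),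
  (356, 3), (5041, 1/2), (6319, 5/2), (7921, 2), (10082, 3), (15842, -3), (357911, -3/4),
  (448649, -3/4), (562391, 3/4), (704969, 3/4)]), ([0, 1, 1, 0, 0], [(131, -1)]), ([0, 3, 0],
  [(1, 2), (2, -2), (71, 1), (89, 1)]), ([4], [(1, 1)]), ([1, 0, 2], [(2, 1), (71, -1/2),
  (89, -1/2), (142, -1/2), (178, 1/2), (5041, 1/4), (7921, -1/4)]), ([1, 0, 0, 1, 0], [(4, -1),
  (131, -1), (142, 1), (178, 1), (284, 1/2), (356, -1/2), (5041, -1/4), (6319, -1/2),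
  (7921, -1/4), (10082, -1/2), (15842, 1/2), (357911, 1/8), (448649, 1/8), (562391, -1/8),
  (704969, -1/8)]), ([1, 0, 1, 0, 0], [(137, -1)]), ([1, 1, 0, 0, 0], [(4, -1), (142, 1),
  (178, 1), (284, 1/2), (356, -1/2), (5041, -1/4), (6319, -1/2), (7921, -1/4), (10082, -1/2),
  (15842, 1/2), (357911, 1/8), (448649, 1/8), (562391, -1/8), (704969, -1/8)]), ([2, 0, 1],
  [(2, 1), (71, -1/2), (89, -1/2), (142, 1/2), (178, -1/2), (5041, -1/4), (7921, 1/4)]),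
  ([2, 1, 0], [(71, 1)]), ([3, 0, 0], [(2, 1), (71, -1/2), (89, -1/2), (142, -1/2), (178, 1/2),
  (5041, 1/4), (7921, -1/4)])], [([0, 0, 1, 1, 1], [(4, 1), (142, -1), (178, -1), (284, 1/2),
  (356, -1/2), (5041, 1/4), (6319, 1/2), (7921, 1/4), (10082, -1/2), (15842, 1/2), (357911, 1/8),
  (448649, 1/8), (562391, -1/8), (704969, -1/8)]), ([0, 1, 3], [(2, 1), (71, -1/2), (89, -1/2),
  (142, 1/2), (178, -1/2), (5041, -1/4), (7921, 1/4)]), ([0, 1, 0, 1, 1], [(131, 1), (142, 1),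
  (284, -1), (356, 1), (5041, -1/2), (6319, -1/2), (10082, 1), (15842, -1), (357911, -1/4),
  (448649, -1/4), (562391, 1/4), (704969, 1/4)]), ([0, 1, 1, 0, 1], [(4, 1), (137, 1), (142, -1),
  (178, -2), (284, -1/2), (356, 1/2), (5041, 1/4), (6319, 1), (7921, 3/4), (10082, 1/2),
  (15842, -1/2), (357911, -1/8), (448649, -1/8), (562391, 1/8), (704969, 1/8)]), ([1, 1, 2],
  [(2, 1), (71, -1/2), (89, -1/2), (142, -1/2), (178, 1/2), (5041, 1/4), (7921, -1/4)]),
  ([1, 1, 0, 0, 1], [(131, 1)]), ([1, 1, 0, 1, 0], [(137, 1)]), ([1, 1, 1, 0, 0], [(4, 1),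
  (142, -1), (178, -1), (284, -1/2), (356, 1/2), (5041, 1/4), (6319, 1/2), (7921, 1/4),
  (10082, 1/2), (15842, -1/2), (357911, -1/8), (448649, -1/8), (562391, 1/8), (704969, 1/8)]),
  ([1, 0, 3], [(71, 1)]), ([1, 0, 0, 1, 1], [(137, 1), (178, -1), (284, -1), (356, 1),
  (6319, 1/2), (7921, 1/2), (10082, 1), (15842, -1), (357911, -1/4), (448649, -1/4),
  (562391, 1/4), (704969, 1/4)]), ([1, 0, 1, 0, 1], [(1, 2), (2, -1), (4, -4), (131, -3),
  (137, -3), (142, 3), (178, 6), (284, 3), (356, -3), (5041, -1/2), (6319, -5/2), (7921, -2),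
  (10082, -3), (15842, 3), (357911, 3/4), (448649, 3/4), (562391, -3/4), (704969, -3/4)]),
  ([1, 0, 1, 1, 0], [(4, 1), (131, 1), (142, -1), (178, -1), (284, -1/2), (356, 1/2), (5041, 1/4),
  (6319, 1/2), (7921, 1/4), (10082, 1/2), (15842, -1/2), (357911, -1/8), (448649, -1/8),
  (562391, 1/8), (704969, 1/8)]), ([1, 2, 1], [(1, 2), (2, -2), (71, 1), (89, 1)]), ([5],
  [(1, -1)]), ([2, 1, 1], [(2, 1), (71, -1/2), (89, -1/2), (142, 1/2), (178, -1/2), (5041, -1/4),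
  (7921, 1/4)]), ([3, 0, 1], [(89, 1)]), ([3, 1, 0], [(2, 1), (71, -1/2), (89, -1/2), (142, -1/2),
  (178, 1/2), (5041, 1/4), (7921, -1/4)])], [[(2, 1), (71, -1/2), (89, -1/2), (10082, -1/4),
  (12638, 1/2), (15842, -1/4), (357911, 1/8), (448649, -1/8), (562391, -1/8), (704969, 1/8)]])

def s5EvenSteps3 : List Step :=
  [([(1, 0, [5, 3, 0])], 163), ([(1, 0, [3, 1, 4])], 167), ([(1, 0, [1, 0, 1, 1, 4])], 151),
  ([(1, 0, [1, 1, 0, 1, 4])], 157), ([(1, 0, [1, 3, 4])], 179),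
  ([(-1/2, 0, [1, 2, 1, 0, 1, 1, 0]), (1/4, 0, [1, 2, 0, 1, 0, 1, 1])], 131),
  ([(1/4, 0, [1, 0, 1, 2, 0, 1, 1]), (-1/2, 0, [1, 0, 1, 1, 0, 1, 2])], 137)]

def s5EvenSteps4 : List Step :=
  [([(1, 0, [0, 1, 5, 3, 0])], 199), ([(1, 0, [0, 5, 1, 3, 0])], 211), ([(1, 0, [5, 1, 3, 0, 0])],
  223), ([(1, 0, [1, 3, 0, 0, 5])], 251), ([(1, 0, [5, 2, 0, 1, 1])], 269), ([(1, 0, [7, 3, 0])],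
  293), ([(1, 0, [1, 0, 5, 3, 0])], 241), ([(1, 0, [5, 1, 0, 3, 0])], 283),
  ([(1, 0, [3, 2, 1, 1, 0, 1, 0])], 233), ([(1, 0, [3, 3, 0, 1, 0, 1, 0])], 263),
  ([(1, 0, [0, 1, 0, 1, 1, 4, 1])], 239), ([(1, 0, [1, 2, 1, 0, 0, 1, 3])], 271),
  ([(1, 0, [3, 2, 0, 1, 3])], 277), ([(1, 1, [0, 9, 0])], 367), ([(1, 0, [8, 1, 1])], 379),
  ([(1, 0, [6, 1, 3])], 317), ([(1, 0, [0, 7, 3])], 331), ([(1, 0, [0, 0, 5, 1, 3])], 307),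
  ([(1, 0, [3, 2, 5])], 389), ([(1, 0, [1, 4, 1, 2, 1])], 89), ([(1, 0, [4, 3, 3])], 337),
  ([(1, 0, [1, 2, 3, 2, 1])], 349), ([(1, 0, [4, 0, 1, 1, 3])], 0)]

def s5EvenSolution : NC × NC × List Poly := (
  [([0, 1, 2], [(2, 1)]), ([0, 1, 0, 1, 0], [(1, -2), (2, 1)]), ([0, 3, 0], [(1, 2)]), ([4],
  [(1, 1)]), ([2, 1, 0], [(2, 1)])], [([1, 0, 3], [(2, 1)]), ([1, 0, 1, 0, 1], [(1, 2), (2, -1)]),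
  ([1, 2, 1], [(1, 2)]), ([5], [(1, -1)]), ([3, 0, 1], [(2, 1)])], [[(2, -4), (4, 2)]])

/-- The density of weight 3 is used again, because `solution` keeps the reduced right-hand sides but
not the rules; under the branch condition it also determines `131` and `137`. -/
theorem solution_s5Even :
    solution s5Solution.1 s5Solution.2.1
    [(par s5Density3.ρ s5Density3.l, s5EvenSteps3),
      (par s5Density4.ρ s5Density4.l, s5EvenSteps4)]
    [(71, [(2, 2), (89, -1)])] =
      s5EvenSolution := by
  decide +kernel

def s5LeftSteps3 : List Step :=
  [([(1, 0, [5, 3, 0])], 163), ([(1, 0, [3, 5, 0])], 167), ([(1, 0, [1, 1, 1, 0, 4])], 151),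
  ([(1, 0, [1, 3, 4])], 179), ([(1, 0, [1, 4, 0, 1, 1])], 157), ([(1, 0, [0, 3, 1, 0, 1, 0, 1])],
  137), ([(1, 0, [1, 0, 1, 1, 4])], 173), ([(1, 0, [0, 3, 0, 1, 1, 0, 1])], 131)]

def s5LeftSteps4 : List Step :=
  [([(1, 0, [1, 2, 1, 1, 3, 0, 0])], 191), ([(1, 0, [1, 5, 3, 0, 0])], 199),
  ([(1, 0, [1, 3, 2, 1, 1, 0, 0])], 193), ([(1, 0, [1, 3, 3, 0, 1, 0, 0])], 197),
  ([(1, 0, [1, 3, 1, 0, 2, 1, 0])], 227), ([(1, 0, [0, 5, 1, 3, 0])], 211),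
  ([(1, 0, [5, 1, 3, 0, 0])], 223), ([(1, 0, [7, 3, 0])], 293), ([(1, 0, [5, 1, 0, 2, 1])], 241),
  ([(1, 0, [5, 0, 3, 1, 0])], 281), ([(1, 0, [5, 1, 0, 3, 0])], 283), ([(1, 1, [5, 0, 0, 3, 0])],
  239), ([(1, 0, [1, 2, 1, 1, 4])], 251), ([(1, 0, [5, 1, 4])], 331), ([(1, 1, [0, 0, 9])], 367),
  ([(1, 0, [0, 7, 3])], 379), ([(1, 0, [3, 2, 5])], 389), ([(1, 0, [1, 4, 1, 2, 1])], 89),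
  ([(1, 0, [3, 2, 1, 0, 1, 0, 1])], 347), ([(1, 0, [5, 5, 0])], 317), ([(1, 0, [3, 1, 2, 3, 0])],
  269), ([(1, 0, [0, 1, 1, 6, 1])], 271), ([(1, 0, [3, 3, 0, 1, 2])], 277),
  ([(1, 0, [1, 4, 1, 3, 0])], 311), ([(1, 0, [4, 1, 0, 1, 0, 1, 1])], 229),
  ([(1, 0, [3, 2, 1, 1, 0, 1, 0])], 233), ([(1, 0, [3, 3, 0, 1, 0, 1, 0])], 263),
  ([(1, 0, [0, 5, 1, 0, 3])], 313), ([(1, 0, [0, 2, 0, 1, 1, 1, 3])], 257),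
  ([(1, 0, [1, 2, 0, 1, 1, 0, 0, 1, 1])], 349), ([(1, 0, [4, 0, 1, 3, 1])], 307),
  ([(1, 0, [4, 3, 3])], 337), ([(1, 0, [4, 0, 1, 1, 3])], 0)]

def s5LeftSolution : NC × NC × List Poly := (
  [([0, 0, 0, 1, 1], [(1, -2)]), ([0, 0, 3], [(1, 2)]), ([0, 0, 1, 0, 1], [(1, 2), (2, -1)]),
  ([0, 0, 1, 1, 0], [(2, 1)]), ([0, 1, 2], [(1, -2), (2, 1)]), ([0, 1, 0, 0, 1], [(1, -2),
  (2, 1)]), ([4], [(1, 1)]), ([2, 0, 1], [(1, 2)]), ([2, 1, 0], [(2, 1)])], [([0, 0, 1, 1, 1],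
  [(1, 2)]), ([0, 1, 3], [(1, 2)]), ([0, 1, 0, 1, 1], [(1, -2), (2, 1)]), ([0, 1, 1, 0, 1],
  [(1, 2), (2, -1)]), ([1, 0, 3], [(2, 1)]), ([1, 0, 0, 1, 1], [(2, -1)]), ([5], [(1, -1)]),
  ([2, 1, 1], [(1, 2)]), ([3, 0, 1], [(1, -2), (2, 1)])], [[(2, -4), (4, 2)]])

theorem solution_s5Left :
    solution s5Solution.1 s5Solution.2.1
    [(par s5Density3.ρ s5Density3.l, s5LeftSteps3),
      (par s5Density4.ρ s5Density4.l, s5LeftSteps4)]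
    [(71, [(1, 2), (89, 1)])] =
      s5LeftSolution := by
  decide +kernel

def s5RightSteps3 : List Step :=
  [([(1, 0, [4, 3, 1])], 163), ([(1, 0, [3, 5, 0])], 167), ([(1, 0, [1, 1, 1, 4, 0])], 151),
  ([(1, 0, [1, 3, 4])], 179), ([(1, 0, [1, 4, 0, 1, 1])], 157), ([(1, 0, [1, 0, 1, 1, 4])], 173),
  ([(1, 0, [1, 2, 1, 0, 1, 1, 0])], 131), ([(1, 0, [1, 0, 1, 1, 0, 1, 2])], 137)]

def s5RightSteps4 : List Step :=
  [([(1, 1, [3, 0, 0, 4, 1])], 199), ([(1, 0, [0, 5, 1, 3, 0])], 211), ([(1, 1, [0, 3, 0, 0, 5])],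
  269), ([(1, 0, [4, 1, 1, 2, 1])], 271), ([(1, 1, [0, 9, 0])], 367), ([(1, 1, [7, 1, 0, 0, 0])],
  223), ([(1, 0, [3, 2, 1, 1, 1, 0, 0])], 191), ([(1, 0, [8, 1, 1])], 379), ([(1, 0, [0, 7, 3])],
  293), ([(1, 0, [3, 7, 0])], 317), ([(1, 0, [5, 2, 3])], 331), ([(1, 0, [1, 2, 1, 4, 1])], 89),
  ([(1, 0, [4, 0, 1, 0, 1, 1, 1])], 239), ([(1, 0, [1, 5, 0, 3, 0])], 277),
  ([(1, 0, [1, 3, 0, 5, 0])], 283), ([(1, 0, [4, 1, 1, 0, 3])], 313),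
  ([(1, 0, [2, 1, 0, 1, 0, 1, 3])], 229), ([(1, 0, [0, 3, 1, 0, 2, 1, 1])], 257),
  ([(1, 0, [0, 5, 0, 3, 1])], 281), ([(1, 0, [3, 0, 1, 5, 0])], 311),
  ([(1, 0, [1, 2, 1, 1, 0, 0, 1, 1, 0])], 349), ([(1, 0, [3, 4, 3])], 389), ([(1, 0, [4, 3, 3])],
  337), ([(1, 0, [0, 0, 5, 1, 3])], 307), ([(1, 0, [4, 0, 1, 1, 3])], 0)]

def s5RightSolution : NC × NC × List Poly := (
  [([0, 1, 2], [(2, 1)]), ([0, 1, 1, 0, 0], [(2, 1)]), ([4], [(1, 1)]), ([1, 0, 2], [(1, 2)]),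
  ([1, 0, 0, 1, 0], [(1, -2), (2, 1)]), ([1, 0, 1, 0, 0], [(1, 2), (2, -1)]), ([1, 1, 0, 0, 0],
  [(1, -2)]), ([2, 1, 0], [(1, -2), (2, 1)]), ([3, 0, 0], [(1, 2)])], [([1, 1, 2], [(1, 2)]),
  ([1, 1, 0, 0, 1], [(2, -1)]), ([1, 1, 0, 1, 0], [(1, -2), (2, 1)]), ([1, 1, 1, 0, 0], [(1, 2)]),
  ([1, 0, 3], [(1, -2), (2, 1)]), ([1, 0, 1, 1, 0], [(1, 2), (2, -1)]), ([5], [(1, -1)]),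
  ([3, 0, 1], [(2, 1)]), ([3, 1, 0], [(1, 2)])], [[(2, -4), (4, 2)]])

theorem solution_s5Right :
    solution s5Solution.1 s5Solution.2.1
    [(par s5Density3.ρ s5Density3.l, s5RightSteps3),
      (par s5Density4.ρ s5Density4.l, s5RightSteps4)]
    [(71, [(1, -2), (89, 1)])] =
      s5RightSolution := by
  decide +kernel

theorem solution_s5 :
    solution (par s5.b₀ s5.l₀) (par s5.b₁ s5.l₁) (blocks (s5Densities.take 3)) [] =
      s5Solution := by
  decide +kernel

theorem check_s5 : checkAll s5 s5Densities = true := by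
  decide +kernel

/-! ### Conserved densities and elimination for the system `S5 0 1`

After elimination by means of the densities of weights `1`, `2`, `3` there are two cases, which are
treated with the density of weight `4`. -/

def s50 : System where
  b₀ := [([0, 1, 2], [(1, 2)]), ([4], [(1, 1)])]
  b₁ := [([0, 1, 3], [(1, 2)]), ([5], [(1, -1)])]
  l₀ := [(5, [0, 2, 1]), (7, [0, 3, 0]), (11, [1, 0, 2]), (13, [1, 2, 0]), (17, [2, 0, 1]),
    (19, [2, 1, 0]), (23, [3, 0, 0]), (29, [0, 0, 1, 0, 1]), (31, [0, 0, 1, 1, 0]),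
    (37, [0, 1, 0, 0, 1]), (41, [0, 1, 0, 1, 0]), (43, [0, 1, 1, 0, 0]), (47, [1, 0, 0, 0, 1]),
    (53, [1, 0, 0, 1, 0]), (59, [1, 0, 1, 0, 0]), (61, [1, 1, 0, 0, 0])]
  l₁ := [(67, [0, 3, 1]), (71, [1, 0, 3]), (73, [1, 2, 1]), (79, [1, 3, 0]), (83, [2, 1, 1]),
    (89, [3, 0, 1]), (97, [3, 1, 0]), (101, [0, 1, 0, 1, 1]), (103, [0, 1, 1, 0, 1]),
    (107, [0, 1, 1, 1, 0]), (109, [1, 0, 0, 1, 1]), (113, [1, 0, 1, 0, 1]),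
    (127, [1, 0, 1, 1, 0]), (131, [1, 1, 0, 0, 1]), (137, [1, 1, 0, 1, 0]),
    (139, [1, 1, 1, 0, 0])]
  g := (1, 0)
  k := (0, 1)
  bal := true

def s50Density1 : Density where
  d := 1
  ρ := [([0, 1], [(1, 1)])]
  σ := [([0, 0, 1, 1], [(1, 1)]), ([0, 3], [(1, -1)]), ([1, 2], [(1, 1)])]
  l := []
  steps := [([(1, 0, [1, 0, 1, 0, 1])], 41), ([(1, 0, [2, 1, 1])], 5), ([(1, 0, [0, 1, 0, 1, 1])], 29),
    ([(1, 0, [0, 0, 1, 1, 1])], 31), ([(1, 1, [0, 0, 3])], 7), ([(1, 0, [1, 0, 3])], 17)]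

def s50Density2 : Density where
  d := 2
  ρ := [([0, 3], [(1, 1)])]
  σ := [([2, 3], [(1, 1)])]
  l := [(149, [0, 1, 0, 1])]
  steps := [([(1, 0, [1, 4, 1])], 149), ([(1, 0, [1, 0, 5])], 19), ([(1, 0, [5, 1, 0])], 11),
    ([(1, 0, [2, 3, 1])], 13), ([(1, 0, [3, 1, 0, 1, 0])], 59), ([(1, 0, [3, 1, 1, 0, 0])], 61),
    ([(1, 0, [3, 3, 0])], 23), ([(1, 0, [0, 0, 1, 1, 3])], 47), ([(1, 0, [0, 1, 0, 1, 3])], 43),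
    ([(1, 0, [3, 2, 1])], 83), ([(1, 0, [3, 0, 0, 1, 1])], 37), ([(1, 0, [1, 1, 0, 0, 3])], 53),
    ([(1, 0, [1, 0, 2, 1, 1])], 109), ([(1, 0, [1, 2, 1, 1, 0])], 127),
    ([(1, 0, [0, 1, 2, 1, 1])], 101), ([(1, 0, [1, 2, 0, 1, 1])], 103),
    ([(1, 0, [2, 1, 1, 1, 0])], 107), ([(1, 0, [0, 2, 1, 1, 1])], 113)]

def s50Density3 : Density where
  d := 3
  ρ := [([0, 0, 1, 3], [(1, -1)]), ([0, 5], [(1, 1)])]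
  σ := []
  l := [(151, [0, 0, 1, 0, 1, 1]), (157, [0, 0, 1, 1, 0, 1]), (163, [0, 0, 3, 1]),
    (167, [0, 2, 1, 1]), (173, [0, 1, 0, 1, 0, 1]), (179, [0, 1, 0, 3]), (181, [0, 1, 2, 1])]
  steps := [([(1, 0, [3, 4, 1])], 179), ([(1, 1, [7, 0, 0])], 163), ([(1, 0, [1, 3, 4])], 167),
    ([(1, 0, [1, 0, 1, 4, 1])], 173), ([(1, 0, [1, 1, 1, 4, 0])], 151),
    ([(1, 0, [1, 0, 1, 1, 4])], 157), ([(4, 0, [0, 0, 3, 3, 1]), (-2/3, 0, [1, 1, 2, 2, 1]),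
    (-2, 1, [0, 1, 1, 2, 2]), (-2, 0, [2, 1, 1, 1, 2]), (4, 0, [0, 1, 5, 0, 1]),
    (-4, 0, [1, 5, 0, 0, 1]), (-4, 1, [5, 0, 0, 1, 0])], 71), ([(-1, 0, [1, 2, 3, 1, 0])], 0),
    ([(-1, 0, [1, 0, 4, 1, 1])], 0), ([(1, 0, [2, 1, 0, 1, 3])], 0), ([(-1, 0, [5, 0, 1, 1, 0]),
    (1, 0, [1, 0, 4, 1, 1])], 0), ([(-1/2, 0, [1, 2, 0, 0, 1, 1, 1]),
    (-1/2, 0, [3, 1, 0, 1, 1, 0, 0])], 0), ([(1, 0, [1, 2, 1, 0, 1, 1, 0])], 0),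
    ([(1, 0, [1, 1, 0, 1, 0, 1, 2])], 0)]

def s50Density4 : Density where
  d := 4
  ρ := [([0, 0, 0, 1, 1, 3], [(1, 1)]), ([0, 0, 1, 5], [(1, -3/2)]), ([0, 0, 3, 3], [(1, -3/2)]),
    ([0, 7], [(1, 1)])]
  σ := [([0, 0, 1, 1, 2, 3], [(1, -3)]), ([0, 1, 2, 5], [(1, 2)]), ([0, 1, 3, 4], [(1, -2)]),
    ([0, 2, 3, 3], [(1, -1)]), ([1, 2, 2, 3], [(1, 1)]), ([4, 5], [(1, 1)])]
  l := [(191, [0, 0, 0, 1, 0, 1, 1, 1]), (193, [0, 0, 0, 1, 1, 0, 1, 1]),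
    (197, [0, 0, 0, 1, 1, 1, 0, 1]), (199, [0, 0, 0, 1, 3, 1]), (211, [0, 0, 0, 3, 1, 1]),
    (223, [0, 0, 2, 1, 1, 1]), (227, [0, 0, 1, 0, 0, 1, 1, 1]), (229, [0, 0, 1, 0, 1, 0, 1, 1]),
    (233, [0, 0, 1, 0, 1, 1, 0, 1]), (239, [0, 0, 1, 0, 1, 3]), (241, [0, 0, 1, 0, 3, 1]),
    (251, [0, 0, 1, 2, 1, 1]), (257, [0, 0, 1, 1, 0, 0, 1, 1]), (263, [0, 0, 1, 1, 0, 1, 0, 1]),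
    (269, [0, 0, 1, 1, 0, 3]), (271, [0, 0, 1, 1, 2, 1]), (277, [0, 0, 1, 3, 0, 1]),
    (281, [0, 0, 3, 0, 1, 1]), (283, [0, 0, 3, 1, 0, 1]), (293, [0, 0, 5, 1]),
    (307, [0, 2, 0, 1, 1, 1]), (311, [0, 2, 1, 0, 1, 1]), (313, [0, 2, 1, 1, 0, 1]),
    (317, [0, 2, 1, 3]), (331, [0, 2, 3, 1]), (337, [0, 4, 1, 1]),
    (347, [0, 1, 0, 1, 0, 1, 0, 1]), (349, [0, 1, 0, 1, 0, 3]), (353, [0, 1, 0, 1, 2, 1]),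
    (359, [0, 1, 0, 1, 1, 2]), (367, [0, 1, 0, 5]), (373, [0, 1, 2, 0, 1, 1]),
    (379, [0, 1, 4, 1]), (383, [0, 1, 3, 2]), (389, [0, 3, 0, 3]), (397, [0, 3, 2, 1]),
    (401, [0, 3, 1, 2]), (409, [2, 1, 2, 1])]
  steps := []

def s50Densities : List Density :=
  [s50Density1, s50Density2, s50Density3, s50Density4]

def s50Solution : NC × NC × List Poly := (
  [([0, 1, 2], [(89, 1)]), ([0, 1, 0, 0, 1], [(137, -1), (5767, -1/2), (6497, -1/2),
  (7081, 1/2)]), ([0, 1, 0, 1, 0], [(73, 2), (131, 3), (137, 3), (139, 3), (4891, -2),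
  (5329, 1/2), (5767, -1/2), (6497, -3/2), (7081, -3/2)]), ([0, 1, 1, 0, 0], [(131, -1),
  (4891, 1/2), (5767, -1/2)]), ([0, 2, 1], [(79, 1)]), ([0, 3, 0], [(73, 1)]), ([0, 0, 3],
  [(73, -1), (79, 1), (97, -1)]), ([0, 0, 1, 0, 1], [(131, -1), (5329, 1/2), (5767, -1/2),
  (6497, 1/2), (7081, 1)]), ([0, 0, 1, 1, 0], [(73, -1), (137, -1), (5767, 1/2), (6497, 1/2),
  (7081, 1)]), ([0, 0, 0, 1, 1], [(139, -1), (4891, 1/2), (5329, -1/2), (5767, 1/2), (7081, -1)]),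
  ([4], [(1, 1)]), ([1, 0, 2], [(97, 1)]), ([1, 0, 0, 0, 1], [(139, -1), (7081, -1/2)]),
  ([1, 0, 0, 1, 0], [(73, -1), (131, -1), (4891, 1), (5329, -1/2), (5767, 1), (6497, 1),
  (7081, 1/2)]), ([1, 0, 1, 0, 0], [(137, -1)]), ([1, 2, 0], [(67, 1)]), ([1, 1, 0, 0, 0],
  [(139, -1)]), ([2, 0, 1], [(67, 1), (73, -1), (79, 1), (97, -1)]), ([2, 1, 0], [(1, 2),
  (67, -2), (73, 1), (79, -2), (89, -1)]), ([3, 0, 0], [(79, -1), (97, 1)])], [([0, 1, 3],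
  [(67, 1), (73, -1), (79, 1), (97, -1)]), ([0, 1, 0, 1, 1], [(131, 1), (5329, -1/2), (5767, 1/2),
  (6497, -1/2), (7081, -1)]), ([0, 1, 1, 0, 1], [(137, 1), (4891, 1/2), (6497, 1/2),
  (7081, -1/2)]), ([0, 1, 1, 1, 0], [(139, 1), (7081, 1/2)]), ([0, 3, 1], [(67, 1)]),
  ([0, 0, 1, 1, 1], [(139, 1), (4891, -1/2), (5329, 1/2), (5767, -1/2), (7081, 1)]), ([5],
  [(1, -1)]), ([1, 0, 3], [(1, 2), (67, -2), (73, 1), (79, -2), (89, -1)]), ([1, 0, 0, 1, 1],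
  [(73, 1), (137, 1), (4891, -1/2), (6497, -1/2), (7081, -1)]), ([1, 0, 1, 0, 1], [(73, -2),
  (131, -3), (137, -3), (139, -3), (4891, 2), (5329, -1/2), (5767, 1/2), (6497, 3/2),
  (7081, 3/2)]), ([1, 0, 1, 1, 0], [(73, 1), (131, 1), (4891, -3/2), (5329, 1/2), (5767, -1/2),
  (6497, -1), (7081, -1/2)]), ([1, 2, 1], [(73, 1)]), ([1, 1, 2], [(67, -1), (97, 1)]),
  ([1, 1, 0, 0, 1], [(131, 1)]), ([1, 1, 0, 1, 0], [(137, 1)]), ([1, 1, 1, 0, 0], [(139, 1)]),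
  ([1, 3, 0], [(79, 1)]), ([2, 1, 1], [(67, 1), (73, -1), (97, -1)]), ([3, 0, 1], [(89, 1)]),
  ([3, 1, 0], [(97, 1)])], [[(137, 1), (4489, -1/2), (4891, 1/2), (5963, -1/2), (6497, 1/2),
  (6499, 1), (7081, -1/2), (8633, 1/2), (9179, -1), (9409, -1/2), (10001, 1/2), (10823, -1),
  (12193, -1), (300763, 1/2), (327697, -3/4), (354631, 1/2), (357043, 1/4), (386389, -1/2),
  (399521, 1), (435299, -5/4), (435433, -1), (471077, 1/2), (474281, 1/4), (474427, 1),
  (513263, -1/2), (513421, -1), (516913, -1/4), (530707, 1/2), (559399, 1/2), (578233, -1/2),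
  (578411, -3/2), (630209, 3/4), (630403, 1/2), (682007, -1/2), (686857, -1/4), (743311, 1/2),
  (768337, -1/2), (837401, 1/2)], [(131, 1), (4891, 1/2), (5293, -1/2), (5329, -1), (5767, 1),
  (5963, 1/2), (6497, -1), (7081, -3/2), (7663, 1/2), (8633, -1/2), (8777, -1), (9563, 1/2),
  (10349, -1), (11659, -1), (327697, -1/2), (354631, 1/2), (357043, 5/4), (386389, -7/4),
  (389017, -1/2), (399521, -1/2), (418147, 1/2), (420991, 3/2), (435299, 3/4), (455593, -1),
  (474281, 1/2), (474427, 3/2), (513421, -1/2), (516913, -3/4), (530707, -1/2), (559399, 7/4),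
  (578233, 1), (578411, 1/2), (605377, -1/2), (630209, 5/4), (768337, 1/2)], [(139, -1),
  (9313, 1), (10147, -1/2), (10981, 1), (12371, 1)], [(97, -1), (6499, 1), (7081, -1/2),
  (7663, 1), (8633, 1)], [(79, -1), (5293, 1), (5767, -1/2), (6241, 1), (7031, 1)], [(73, -1),
  (4891, 1), (5329, -1/2), (5767, 1), (6497, 1)], [(67, -1), (4489, 1), (4891, -1/2), (5293, 1),
  (5963, 1)]])

def s50RigidSteps4 : List Step :=
  [([(1, 1, [9, 0, 0])], 367), ([(1, 0, [8, 1, 1])], 379), ([(1, 0, [0, 1, 5, 3, 0])], 199),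
  ([(1, 0, [5, 1, 3, 0, 0])], 223), ([(1, 1, [0, 0, 7, 0, 1])], 239), ([(1, 1, [3, 0, 0, 5, 0])],
  241), ([(1, 0, [1, 3, 0, 0, 5])], 251), ([(1, 0, [5, 2, 0, 1, 1])], 269),
  ([(1, 0, [0, 1, 1, 6, 1])], 271), ([(1, 0, [3, 2, 0, 1, 3])], 277), ([(1, 0, [1, 4, 1, 3, 0])],
  281), ([(1, 0, [0, 3, 1, 4, 1])], 283), ([(1, 0, [4, 1, 2, 1, 1])], 311),
  ([(1, 0, [4, 1, 1, 0, 3])], 313), ([(1, 0, [7, 3, 0])], 293), ([(1, 0, [2, 0, 1, 1, 5])], 349),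
  ([(1, 0, [6, 1, 3])], 317), ([(1, 0, [0, 7, 3])], 331), ([(1, 0, [3, 2, 5])], 389),
  ([(1, 0, [4, 3, 3])], 337), ([(1, 0, [5, 0, 1, 0, 3])], 0)]

def s50RigidSolution : NC × NC × List Poly := (
  [([0, 1, 2], [(89, 1)]), ([4], [(1, 1)]), ([2, 1, 0], [(1, 2), (89, -1)])], [([5], [(1, -1)]),
  ([1, 0, 3], [(1, 2), (89, -1)]), ([3, 0, 1], [(89, 1)])], [[(89, -2), (7921, 1)]])

theorem solution_s50Rigid :
    solution s50Solution.1 s50Solution.2.1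
    [(par s50Density4.ρ s50Density4.l, s50RigidSteps4)]
    [(67, []), (73, []), (79, []), (97, []), (131, []), (137, []), (139, [])] =
      s50RigidSolution := by
  decide +kernel

def s50FreeSteps4 : List Step :=
  [([(1, 1, [0, 9, 0])], 367), ([(1, 0, [8, 1, 1])], 379), ([(1, 0, [7, 3, 0])], 293),
  ([(1, 0, [1, 6, 3])], 317), ([(1, 0, [0, 7, 3])], 331), ([(1, 0, [5, 2, 3])], 389),
  ([(1, 0, [4, 3, 3])], 337), ([(1, 0, [5, 1, 3, 0, 0])], 211), ([(1, 0, [3, 5, 1, 0, 0])], 199),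
  ([(1, 0, [0, 1, 5, 3, 0])], 223), ([(1, 0, [3, 5, 0, 0, 1])], 239), ([(1, 0, [1, 4, 1, 2, 1])],
  131), ([(1, 0, [1, 2, 1, 1, 4])], 251), ([(1, 0, [2, 5, 0, 1, 1])], 281),
  ([(1, 0, [5, 0, 3, 1, 0])], 311), ([(1, 0, [1, 2, 3, 2, 1])], 349), ([(1, 0, [1, 0, 5, 3, 0])],
  241), ([(1, 0, [5, 1, 0, 2, 1])], 137), ([(1, 0, [5, 3, 0, 1, 0])], 283),
  ([(1, 1, [0, 0, 1, 7, 0])], 269), ([(1, 0, [1, 5, 0, 3, 0])], 277), ([(1, 1, [0, 0, 3, 5, 0])],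
  139), ([(1, 0, [3, 3, 3, 0, 0])], 307), ([(-2/3, 0, [0, 5, 0, 1, 3]),
  (1/3, 0, [3, 1, 3, 0, 2])], 67), ([(-1/3, 0, [3, 0, 1, 5, 0]), (-1/3, 0, [2, 1, 3, 3, 0])], 79),
  ([(1, 0, [2, 3, 0, 1, 3])], 0), ([(1, 0, [5, 0, 1, 0, 3])], 0)]

def s50FreeSolution : NC × NC × List Poly := (
  [([0, 1, 2], [(1, 1), (73, 1/2)]), ([0, 1, 0, 0, 1], [(73, -1/2), (97, -1/2), (5329, -1/4),
  (7081, 1/4), (9409, 1/2)]), ([0, 1, 0, 1, 0], [(73, 1/2), (5329, -1/4)]), ([0, 1, 1, 0, 0],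
  [(97, 1/2), (7081, -1/4)]), ([0, 3, 0], [(73, 1)]), ([0, 0, 3], [(73, -1), (97, -1)]),
  ([0, 0, 1, 0, 1], [(73, 1/2), (97, 1/2), (5329, 3/4), (7081, 3/4)]), ([0, 0, 1, 1, 0],
  [(73, -1/2), (97, -1/2), (5329, 1/4), (7081, 3/4), (9409, 1/2)]), ([0, 0, 0, 1, 1],
  [(5329, -1/2), (7081, -1), (9409, -1/2)]), ([4], [(1, 1)]), ([1, 0, 2], [(97, 1)]),
  ([1, 0, 0, 0, 1], [(7081, -1/2), (9409, -1/2)]), ([1, 0, 0, 1, 0], [(97, 1/2), (7081, 1/4)]),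
  ([1, 0, 1, 0, 0], [(97, -1/2), (7081, -1/4), (9409, 1/2)]), ([1, 1, 0, 0, 0], [(9409, -1/2)]),
  ([2, 0, 1], [(73, -1), (97, -1)]), ([2, 1, 0], [(1, 1), (73, 1/2)]), ([3, 0, 0], [(97, 1)])],
  [([0, 1, 3], [(73, -1), (97, -1)]), ([0, 1, 0, 1, 1], [(73, -1/2), (97, -1/2), (5329, -3/4),
  (7081, -3/4)]), ([0, 1, 1, 0, 1], [(73, 1/2), (97, 1/2), (5329, 1/4), (7081, -1/4),
  (9409, -1/2)]), ([0, 1, 1, 1, 0], [(7081, 1/2), (9409, 1/2)]), ([0, 0, 1, 1, 1], [(5329, 1/2),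
  (7081, 1), (9409, 1/2)]), ([5], [(1, -1)]), ([1, 0, 3], [(1, 1), (73, 1/2)]), ([1, 0, 0, 1, 1],
  [(73, 1/2), (97, 1/2), (5329, -1/4), (7081, -3/4), (9409, -1/2)]), ([1, 0, 1, 0, 1],
  [(73, -1/2), (5329, 1/4)]), ([1, 0, 1, 1, 0], [(97, -1/2), (7081, -1/4)]), ([1, 2, 1],
  [(73, 1)]), ([1, 1, 2], [(97, 1)]), ([1, 1, 0, 0, 1], [(97, -1/2), (7081, 1/4)]),
  ([1, 1, 0, 1, 0], [(97, 1/2), (7081, 1/4), (9409, -1/2)]), ([1, 1, 1, 0, 0], [(9409, 1/2)]),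
  ([2, 1, 1], [(73, -1), (97, -1)]), ([3, 0, 1], [(1, 1), (73, 1/2)]), ([3, 1, 0], [(97, 1)])],
  [[(1, -3), (5329, 3/4)], [(7081, -3/2), (9409, -3/2)]])

theorem solution_s50Free :
    solution s50Solution.1 s50Solution.2.1
    [(par s50Density4.ρ s50Density4.l, s50FreeSteps4)]
    [(89, [(1, 1), (67, -1), (73, 1/2), (79, -1)])] =
      s50FreeSolution := by
  decide +kernel

theorem solution_s50 :
    solution (par s50.b₀ s50.l₀) (par s50.b₁ s50.l₁) (blocks (s50Densities.take 3)) [] =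
      s50Solution := by
  decide +kernel

theorem check_s50 : checkAll s50 s50Densities = true := by
  decide +kernel

/-! ### The analogs of the systems `S5 α β` -/

section

variable {F : FreeSystem}

theorem equivalent_S5_one {β : ℂ} (hF : IsNonAbelianAnalog (Scalar.S5 1 β) F) :
    (β = 2 ∧ (Equivalent F S5_12' ∨ Equivalent F S5_12'')) ∨
      (β = 0 ∧ (Equivalent F S5_10' ∨ Equivalent F S5_10'')) := by
  have h0 : Scalar.S5 1 β 0 = abelianize (evN (envHom fun _ => β) s5.b₀) := by
    simp [s5, Scalar.S5, abelianize_gen, letter, envHom_prime _ Nat.prime_two,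
      MvPolynomial.smul_eq_C_mul]
    repeat rw [C_ofNat]
    ring
  have h1 : Scalar.S5 1 β 1 = abelianize (evN (envHom fun _ => β) s5.b₁) := by
    simp [s5, Scalar.S5, abelianize_gen, letter, envHom_prime _ Nat.prime_two,
      MvPolynomial.smul_eq_C_mul]
    repeat rw [C_ofNat]
    ring
  obtain ⟨h, h2, h3, hF0, hF1, hD⟩ := exists_env hF check_s5 h0 h1 fun μ ν hν => by
    have e0 := wt_of_isCommHomogeneous h0 (by decide +kernel) hν (w := [4]) (c := 1)
      (by norm_num) (by decide +kernel)
    have e1 := wt_of_isCommHomogeneous h0 (by decide +kernel) hν (w := [0, 0, 3]) (c := 2)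
      (by norm_num) (by decide +kernel)
    simp [wt, letter, jetWeight] at e0 e1
    simp [s5]
    linarith
  have hD3 : IsFreeDensity F (evN h (par s5Density3.ρ s5Density3.l)) :=
    hD (par s5Density3.ρ s5Density3.l, s5Density3.steps) (by simp [blocks, s5Densities])
  have hD4 : IsFreeDensity F (evN h (par s5Density4.ρ s5Density4.l)) :=
    hD (par s5Density4.ρ s5Density4.l, s5Density4.steps) (by simp [blocks, s5Densities])
  obtain ⟨hF0, hF1, hr⟩ := solution_sound hF0 hF1 (fun y hy => hD y (by
    simp only [blocks, List.map_take] at hy ⊢; exact List.mem_of_mem_take hy)) (valid_nil h)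
    solution_s5
  -- All three branches end with the same condition $2\beta^2-4\beta=0$ on the parameter itself.
  have hβ : ∀ {p : List Poly}, p = [[(2, -4), (4, 2)]] → (∀ q ∈ p, ev h q = 0) →
      β = 2 ∨ β = 0 := by
    rintro _ rfl hp
    simp only [List.forall_mem_cons, ev_cons, ev_nil, show 4 = 2 * 2 from rfl, map_mul, h2] at hp
    push_cast at hp
    rw [← sub_eq_zero, ← mul_eq_zero]
    linear_combination hp.1 / 2
  -- The cubic left by weights 1 to 3 is a product of three linear factors. The unknowns `71` and
  -- `89` are the coefficients of $vuv_x$ and $v_xuv$ in $v_t$, which the involution exchanges: it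
  -- preserves the first branch and swaps the other two.
  have hbr : h 71 = 2 * h 2 - h 89 ∨ h 71 = 2 + h 89 ∨ h 71 = -2 + h 89 := by
    simp only [s5Solution, List.forall_mem_cons, ev_cons, ev_nil,
      show 10082 = 2 * 71 * 71 from rfl, show 12638 = 2 * 71 * 89 from rfl,
      show 15842 = 2 * 89 * 89 from rfl, show 357911 = 71 * 71 * 71 from rfl,
      show 448649 = 71 * 71 * 89 from rfl, show 562391 = 71 * 89 * 89 from rfl,
      show 704969 = 89 * 89 * 89 from rfl, map_mul] at hr
    push_cast at hr
    rw [← sub_eq_zero, ← sub_eq_zero (b := 2 + h 89), ← sub_eq_zero (b := -2 + h 89),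
      ← mul_eq_zero, ← mul_eq_zero]
    linear_combination 8 * hr.1
  rcases hbr with hbr | hbr | hbr
  · obtain ⟨hF0, hF1, hr⟩ := solution_sound hF0 hF1 (by simp [hD3, hD4])
      (show Valid h [(71, [(2, 2), (89, -1)])] by simp [hbr, sub_eq_add_neg]) solution_s5Even
    rcases hβ rfl hr with hβ | hβ
    · refine Or.inl ⟨hβ, ?_⟩
      rw [← h2] at hβ
      exact Or.inl (equivalent_of_agree h3 hF0 hF1 (val_S5_12' h)
        [(2, [(1, 2)])] (by simp [hβ]) (by decide +kernel))
    · refine Or.inr ⟨hβ, ?_⟩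
      rw [← h2] at hβ
      exact Or.inl (equivalent_of_agree h3 hF0 hF1 (val_S5_10' h)
        [(2, [])] (by simp [hβ]) (by decide +kernel))
  · obtain ⟨hF0, hF1, hr⟩ := solution_sound hF0 hF1 (by simp [hD3, hD4])
      (show Valid h [(71, [(1, 2), (89, 1)])] by simp [hbr]) solution_s5Left
    rcases hβ rfl hr with hβ | hβ
    · refine Or.inl ⟨hβ, ?_⟩
      rw [← h2] at hβ
      exact Or.inr (equivalent_of_agree h3 hF0 hF1 (val_S5_12'' h)
        [(2, [(1, 2)])] (by simp [hβ]) (by decide +kernel))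
    · refine Or.inr ⟨hβ, ?_⟩
      rw [← h2] at hβ
      exact Or.inr (equivalent_of_agree h3 hF0 hF1 (val_S5_10'' h)
        [(2, [])] (by simp [hβ]) (by decide +kernel))
  · obtain ⟨hF0, hF1, hr⟩ := solution_sound hF0 hF1 (by simp [hD3, hD4])
      (show Valid h [(71, [(1, -2), (89, 1)])] by simp [hbr]) solution_s5Right
    rcases hβ rfl hr with hβ | hβ
    · refine Or.inl ⟨hβ, ?_⟩
      rw [← h2] at hβ
      exact Or.inr (equivalent_of_agree_star h3 hF0 hF1 (val_S5_12'' h)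
        [(2, [(1, 2)])] (by simp [hβ]) (by decide +kernel))
    · refine Or.inr ⟨hβ, ?_⟩
      rw [← h2] at hβ
      exact Or.inr (equivalent_of_agree_star h3 hF0 hF1 (val_S5_10'' h)
        [(2, [])] (by simp [hβ]) (by decide +kernel))

theorem equivalent_S5_zero (hF : IsNonAbelianAnalog (Scalar.S5 0 1) F) :
    Equivalent F S5_01' ∨ Equivalent F S5_01'' ∨ Equivalent F S5_01''' := by
  have h0 : Scalar.S5 0 1 0 = abelianize (evN (envHom fun _ => 0) s50.b₀) := by
    simp [s50, Scalar.S5, abelianize_gen, letter, MvPolynomial.smul_eq_C_mul]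
    rw [C_ofNat]
    ring
  have h1 : Scalar.S5 0 1 1 = abelianize (evN (envHom fun _ => 0) s50.b₁) := by
    simp [s50, Scalar.S5, abelianize_gen, letter, MvPolynomial.smul_eq_C_mul]
    rw [C_ofNat]
    ring
  obtain ⟨h, -, h3, hF0, hF1, hD⟩ := exists_env hF check_s50 h0 h1 fun μ ν hν => by
    have e0 := wt_of_isCommHomogeneous h0 (by decide +kernel) hν (w := [4]) (c := 1)
      (by norm_num) (by decide +kernel)
    have e1 := wt_of_isCommHomogeneous h0 (by decide +kernel) hν (w := [0, 1, 2]) (c := 2)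
      (by norm_num) (by decide +kernel)
    simp [wt, letter, jetWeight] at e0 e1
    simp [s50]
    linarith
  have hD4 : IsFreeDensity F (evN h (par s50Density4.ρ s50Density4.l)) :=
    hD (par s50Density4.ρ s50Density4.l, s50Density4.steps) (by simp [blocks, s50Densities])
  obtain ⟨hF0, hF1, hr⟩ := solution_sound hF0 hF1 (fun y hy => hD y (by
    simp only [blocks, List.map_take] at hy ⊢; exact List.mem_of_mem_take hy)) (valid_nil h)
    solution_s50
  -- Five of the remaining equations are a single unknown times one common linear factor. Either
  -- that factor vanishes, or these unknowns do.
  by_cases hT : h 89 = 1 - h 67 + 1 / 2 * h 73 - h 79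
  · obtain ⟨hF0, hF1, hr⟩ := solution_sound hF0 hF1 (by simp [hD4])
      (show Valid h [(89, [(1, 1), (67, -1), (73, 1 / 2), (79, -1)])] by simp [hT]; ring)
      solution_s50Free
    simp only [s50FreeSolution, List.forall_mem_cons, ev_cons, ev_nil,
      show 5329 = 73 * 73 from rfl, show 7081 = 73 * 97 from rfl, show 9409 = 97 * 97 from rfl,
      map_mul, map_one] at hr
    push_cast at hr
    obtain ⟨e1, e2, -⟩ := hr
    -- The sign of `73` decides between the two listed systems, and the choice of `97` between each
    -- of them and its involution.
    have hx : h 73 = 2 ∨ h 73 = -2 := by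
      rw [← sub_eq_zero, eq_neg_iff_add_eq_zero, ← mul_eq_zero]; linear_combination 4 / 3 * e1
    have hy : h 97 = 0 ∨ h 97 = -h 73 := by
      rw [eq_neg_iff_add_eq_zero, ← mul_eq_zero]; linear_combination -2 / 3 * e2
    rcases hx with hx | hx <;> rw [hx] at hy <;> rcases hy with hy | hy
    · exact Or.inr (Or.inr (equivalent_of_agree h3 hF0 hF1 (val_S5_01''' h)
        [(73, [(1, 2)]), (97, [])] (by simp [hx, hy]) (by decide +kernel)))
    · exact Or.inr (Or.inr (equivalent_of_agree_star h3 hF0 hF1 (val_S5_01''' h)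
        [(73, [(1, 2)]), (97, [(1, -2)])] (by simp [hx, hy]) (by decide +kernel)))
    · exact Or.inr (Or.inl (equivalent_of_agree_star h3 hF0 hF1 (val_S5_01'' h)
        [(73, [(1, -2)]), (97, [])] (by simp [hx, hy]) (by decide +kernel)))
    · exact Or.inr (Or.inl (equivalent_of_agree h3 hF0 hF1 (val_S5_01'' h)
        [(73, [(1, -2)]), (97, [(1, 2)])] (by simp [hx, hy]) (by decide +kernel)))
  · simp only [s50Solution, List.forall_mem_cons, ev_cons, ev_nil,
      show 4489 = 67 * 67 from rfl, show 4891 = 67 * 73 from rfl, show 5293 = 67 * 79 from rfl,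
      show 5329 = 73 * 73 from rfl, show 5767 = 73 * 79 from rfl, show 5963 = 67 * 89 from rfl,
      show 6241 = 79 * 79 from rfl, show 6497 = 73 * 89 from rfl, show 6499 = 67 * 97 from rfl,
      show 7031 = 79 * 89 from rfl, show 7081 = 73 * 97 from rfl, show 7663 = 79 * 97 from rfl,
      show 8633 = 89 * 97 from rfl, show 8777 = 67 * 131 from rfl,
      show 9179 = 67 * 137 from rfl, show 9313 = 67 * 139 from rfl,
      show 9409 = 97 * 97 from rfl, show 9563 = 73 * 131 from rfl,
      show 10001 = 73 * 137 from rfl, show 10147 = 73 * 139 from rfl,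
      show 10349 = 79 * 131 from rfl, show 10823 = 79 * 137 from rfl,
      show 10981 = 79 * 139 from rfl, show 11659 = 89 * 131 from rfl,
      show 12193 = 89 * 137 from rfl, show 12371 = 89 * 139 from rfl,
      show 300763 = 67 * 67 * 67 from rfl, show 327697 = 67 * 67 * 73 from rfl,
      show 354631 = 67 * 67 * 79 from rfl, show 357043 = 67 * 73 * 73 from rfl,
      show 386389 = 67 * 73 * 79 from rfl, show 389017 = 73 * 73 * 73 from rfl,
      show 399521 = 67 * 67 * 89 from rfl, show 418147 = 67 * 79 * 79 from rfl,
      show 420991 = 73 * 73 * 79 from rfl, show 435299 = 67 * 73 * 89 from rfl,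
      show 435433 = 67 * 67 * 97 from rfl, show 455593 = 73 * 79 * 79 from rfl,
      show 471077 = 67 * 79 * 89 from rfl, show 474281 = 73 * 73 * 89 from rfl,
      show 474427 = 67 * 73 * 97 from rfl, show 513263 = 73 * 79 * 89 from rfl,
      show 513421 = 67 * 79 * 97 from rfl, show 516913 = 73 * 73 * 97 from rfl,
      show 530707 = 67 * 89 * 89 from rfl, show 559399 = 73 * 79 * 97 from rfl,
      show 578233 = 73 * 89 * 89 from rfl, show 578411 = 67 * 89 * 97 from rfl,
      show 605377 = 79 * 79 * 97 from rfl, show 630209 = 73 * 89 * 97 from rfl,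
      show 630403 = 67 * 97 * 97 from rfl, show 682007 = 79 * 89 * 97 from rfl,
      show 686857 = 73 * 97 * 97 from rfl, show 743311 = 79 * 97 * 97 from rfl,
      show 768337 = 89 * 89 * 97 from rfl, show 837401 = 89 * 97 * 97 from rfl, map_mul] at hr
    push_cast at hr
    obtain ⟨e1, e2, e3, e4, e5, e6, e7, -⟩ := hr
    have hT' : h 89 - (1 - h 67 + 1 / 2 * h 73 - h 79) ≠ 0 := sub_ne_zero.2 hT
    have x67 : h 67 = 0 := (mul_eq_zero.1 (by linear_combination e7)).resolve_right hT'
    have x73 : h 73 = 0 := (mul_eq_zero.1 (by linear_combination e6)).resolve_right hT'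
    have x79 : h 79 = 0 := (mul_eq_zero.1 (by linear_combination e5)).resolve_right hT'
    have x97 : h 97 = 0 := (mul_eq_zero.1 (by linear_combination e4)).resolve_right hT'
    have x139 : h 139 = 0 := (mul_eq_zero.1 (by linear_combination e3)).resolve_right hT'
    -- With these unknowns gone, the two long equations also reduce to one unknown times the common
    -- factor.
    simp only [x67, x73, x79, x97] at e1 e2 hT'
    have x131 : h 131 = 0 := (mul_eq_zero.1 (by linear_combination -e2)).resolve_right hT'
    have x137 : h 137 = 0 := (mul_eq_zero.1 (by linear_combination -e1)).resolve_right hT'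
    obtain ⟨hF0, hF1, hr⟩ := solution_sound hF0 hF1 (by simp [hD4])
      (show Valid h [(67, []), (73, []), (79, []), (97, []), (131, []), (137, []), (139, [])] by
        simp [x67, x73, x79, x97, x131, x137, x139]) solution_s50Rigid
    simp only [s50RigidSolution, List.forall_mem_cons, ev_cons, ev_nil,
      show 7921 = 89 * 89 from rfl, map_mul] at hr
    push_cast at hr
    have hx : h 89 = 0 ∨ h 89 = 2 := by
      rw [← sub_eq_zero (b := 2), ← mul_eq_zero]; linear_combination hr.1
    rcases hx with hx | hx
    · exact Or.inl (equivalent_of_agree_star h3 hF0 hF1 (val_S5_01' h)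
        [(89, [])] (by simp [hx]) (by decide +kernel))
    · exact Or.inl (equivalent_of_agree h3 hF0 hF1 (val_S5_01' h)
        [(89, [(1, 2)])] (by simp [hx]) (by decide +kernel))

/-- Scaling $u$ by $c$ divides the cubic terms by $c$ and the quintic ones by $c^2$, in accordance
with the coefficient $\alpha(\beta-2\alpha)$. -/
theorem crescale_S5 {c : ℂ} (hc : c ≠ 0) (α β : ℂ) :
    crescale ![c, 1] (Scalar.S5 α β) = Scalar.S5 (α / c) (β / c) := by
  have hC : ∀ r : ℂ, cscale ![c, 1] (MvPolynomial.C r) = MvPolynomial.C r := fun r => by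
    rw [cscale, MvPolynomial.aeval_C]; rfl
  have h2 : cscale ![c, 1] 2 = 2 := map_ofNat _ 2
  have e1 : (MvPolynomial.C c * MvPolynomial.C c⁻¹ : Comm) = 1 := by
    rw [← map_mul, mul_inv_cancel₀ hc, map_one]
  funext s
  fin_cases s <;>
    simp only [crescale, Scalar.S5, Fin.zero_eta, Fin.mk_one, Matrix.cons_val_zero,
      Matrix.cons_val_one, map_add, map_sub, map_neg, map_mul, map_pow, cscale_X, hC, h2,
      MvPolynomial.smul_eq_C_mul, inv_one, map_one, one_mul, div_eq_mul_inv]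
  · linear_combination (Scalar.uxx +
      MvPolynomial.C c⁻¹ * (2 * MvPolynomial.C α * Scalar.u ^ 2 * Scalar.vx +
        2 * MvPolynomial.C β * Scalar.u * Scalar.v * Scalar.ux) +
      MvPolynomial.C c⁻¹ ^ 2 * MvPolynomial.C α * Scalar.u ^ 3 * Scalar.v ^ 2 *
        (MvPolynomial.C β - MvPolynomial.C 2 * MvPolynomial.C α)) * e1
  · ring

theorem equivalent_S5 {α β : ℂ} (h : ¬(α = 0 ∧ β = 0))
    (hF : IsNonAbelianAnalog (Scalar.S5 α β) F) :
    (β = 2 * α ∧ (Equivalent F S5_12' ∨ Equivalent F S5_12'')) ∨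
      (α = 0 ∧ (Equivalent F S5_01' ∨ Equivalent F S5_01'' ∨ Equivalent F S5_01''')) ∨
      (β = 0 ∧ (Equivalent F S5_10' ∨ Equivalent F S5_10'')) := by
  have key : ∀ {c : ℂ}, c ≠ 0 → IsNonAbelianAnalog (Scalar.S5 (α / c) (β / c))
      (rescale ![c, 1] F) ∧ ∀ G, Equivalent (rescale ![c, 1] F) G → Equivalent F G := by
    intro c hc
    have hκ : ∀ s, (![c, 1] : Fin 2 → ℂ) s ≠ 0 := by
      intro s
      fin_cases s
      exacts [hc, one_ne_zero]
    exact ⟨crescale_S5 hc α β ▸ hF.rescale hκ, fun G => Equivalent.of_rescale hκ⟩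
  -- The scaling factor is $\beta$ if $\alpha=0$ and $\alpha$ otherwise, giving the normal forms
  -- $(0,1)$ and $(1,\beta/\alpha)$.
  by_cases hα : α = 0
  · have hβ : β ≠ 0 := fun hβ => h ⟨hα, hβ⟩
    obtain ⟨h1, h2⟩ := key hβ
    rw [hα, zero_div, div_self hβ] at h1
    exact Or.inr (Or.inl ⟨hα, (equivalent_S5_zero h1).imp (h2 _) (Or.imp (h2 _) (h2 _))⟩)
  · obtain ⟨h1, h2⟩ := key hα
    rw [div_self hα] at h1
    rcases equivalent_S5_one h1 with ⟨hβ, h3⟩ | ⟨hβ, h3⟩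
    · exact Or.inl ⟨(div_eq_iff hα).1 hβ, h3.imp (h2 _) (h2 _)⟩
    · exact Or.inr (Or.inr ⟨by simpa [hα] using hβ, h3.imp (h2 _) (h2 _)⟩)

end

end NonAbelian

end

theorem theorem2 (F : NonAbelian.FreeSystem) :
    (NonAbelian.IsNonAbelianAnalog NonAbelian.Scalar.S1 F →
      NonAbelian.Equivalent F NonAbelian.S1') ∧
    (NonAbelian.IsNonAbelianAnalog NonAbelian.Scalar.S2 F →
      NonAbelian.Equivalent F NonAbelian.S2' ∨ NonAbelian.Equivalent F NonAbelian.S2'') ∧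
    (NonAbelian.IsNonAbelianAnalog NonAbelian.Scalar.S3 F →
      NonAbelian.Equivalent F NonAbelian.S3') ∧
    (NonAbelian.IsNonAbelianAnalog NonAbelian.Scalar.S4 F →
      NonAbelian.Equivalent F NonAbelian.S4' ∨ NonAbelian.Equivalent F NonAbelian.S4'') ∧
    (∀ α β : ℂ, ¬ (α = 0 ∧ β = 0) →
      NonAbelian.IsNonAbelianAnalog (NonAbelian.Scalar.S5 α β) F →
      (β = 2 * α ∧ (NonAbelian.Equivalent F NonAbelian.S5_12' ∨
        NonAbelian.Equivalent F NonAbelian.S5_12'')) ∨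
      (α = 0 ∧ (NonAbelian.Equivalent F NonAbelian.S5_01' ∨
        NonAbelian.Equivalent F NonAbelian.S5_01'' ∨
        NonAbelian.Equivalent F NonAbelian.S5_01''')) ∨
      (β = 0 ∧ (NonAbelian.Equivalent F NonAbelian.S5_10' ∨
        NonAbelian.Equivalent F NonAbelian.S5_10''))) ∧
    (¬ NonAbelian.IsNonAbelianAnalog NonAbelian.Scalar.B1 F) ∧
    (NonAbelian.IsNonAbelianAnalog NonAbelian.Scalar.B2 F →
      NonAbelian.Equivalent F NonAbelian.B2') ∧
    (NonAbelian.IsNonAbelianAnalog NonAbelian.Scalar.B3 F →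
      NonAbelian.Equivalent F NonAbelian.B3' ∨ NonAbelian.Equivalent F NonAbelian.B3'') ∧
    (NonAbelian.IsNonAbelianAnalog NonAbelian.Scalar.B4 F →
      NonAbelian.Equivalent F NonAbelian.B4' ∨ NonAbelian.Equivalent F NonAbelian.B4'') := by
  exact ⟨NonAbelian.equivalent_S1, NonAbelian.equivalent_S2, NonAbelian.equivalent_S3,
    NonAbelian.equivalent_S4, fun _ _ => NonAbelian.equivalent_S5,
    NonAbelian.not_isNonAbelianAnalog_B1, NonAbelian.equivalent_B2, NonAbelian.equivalent_B3,
    NonAbelian.equivalent_B4⟩
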